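/- Let $r$ be an odd positive integer, let $k$ be a real number with $k\ge r+1$, and let $x>0$. Let $\sigma_r(n)=\sum_{d\mid n}d^r$, let $\sigma_r^{-1}$ be its Dirichlet inverse ($\sigma_r*\sigma_r^{-1}=I$, where $I(1)=1$ and $I(n)=0$ for $n>1$), and let $${}_1F_1(a;b;z)=\sum_{n=0}^\infty\frac{(a)_n}{(b)_n}\frac{z^n}{n!},\qquad (a)_n=\frac{\Gamma(a+n)}{\Gamma(a)}.$$ Assume that all non-trivial zeros $\rho$ of the Riemann zeta function $\zeta$ (those with $0<\Re\rho<1$) are simple. Then $$\begin{aligned} \sum_{n=1}^{\infty}\frac{\sigma_r^{-1}(n)}{n^k}e^{-x/n} ={}&\frac{(-1)^{\frac{r+1}{2}}(2\pi)^{r+1}}{x^k}\,\frac{\Gamma(k)}{\Gamma(r+1)}\sum_{n=1}^{\infty}\frac{\sigma_r^{-1}(n)}{n^{r+1}}\,{}_1F_1\!\left(k;r+1;-\frac{4\pi^2}{nx}\right)\\ &+\sum_{m=1}^{\lfloor r/2\rfloor}\frac{\Gamma(k-r+2m)}{\zeta(r-2m)\,\zeta(2m+1)}\,\frac{(-1)^m\,2\,(2\pi)^{2m}}{(2m)!}\,x^{r-k-2m}\\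 &+\sum_{\rho}\frac{x^{\rho-k}}{\zeta'(\rho)}\left[\frac{\Gamma(k-\rho)}{\zeta(\rho-r)}+\frac{x^r\,\Gamma(k-r-\rho)}{\zeta(r+\rho)}\right], \end{aligned}$$ where $1/\zeta(1)$ is read as $0$ (this occurs in the term $m=(r-1)/2$ when $r\ge3$), and where $\rho$ runs over the non-trivial zeros of $\zeta$. The two infinite series over $n$ converge as limits of their partial sums. The series over $\rho$ converges after bracketing: there is a constant $A_0>0$, independent of $r,k,x$, such that, if two non-trivial zeros $\rho_1,\rho_2$ are put in the same bracket whenever $$|\Im\rho_1-\Im\rho_2|<\exp\!\left(-\frac{A_0|\Im\rho_1|}{\log|\Im\rho_1|}\right)+\exp\!\left(-\frac{A_0|\Im\rho_2|}{\log|\Im\rho_2|}\right)$$ (the brackets being the classes of the equivalence relation generated by this), then every bracket is finite and the series of the bracket sums converges, in any order of the brackets, to the value that enters the identity. -/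

import Mathlib

open Filter Topology
open scoped ArithmeticFunction.sigma

noncomputable section

/-- `σ_r(1) = 1` is invertible, so `σ_r` has a Dirichlet inverse. -/
@[reducible] def invertibleSigmaOne (r : ℕ) :
    Invertible ((((σ r : ArithmeticFunction ℕ) : ArithmeticFunction ℂ)) 1) :=
  invertibleOne.copy _ (by simp)

/-- The Dirichlet inverse `σ_r⁻¹` of the divisor function `σ_r(n) = ∑_{d ∣ n} d ^ r`. -/
def sigmaInv (r : ℕ) : ArithmeticFunction ℂ :=
  ArithmeticFunction.dirichletInverse
    ((σ r : ArithmeticFunction ℕ) : ArithmeticFunction ℂ) (invertibleSigmaOne r)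

/-- Kummer's function `₁F₁(a; b; z) = ∑_{n ≥ 0} (a)_n / (b)_n * z ^ n / n!`, where
`(a)_n = a (a + 1) ⋯ (a + n - 1) = Γ(a + n) / Γ(a)`. -/
def kummerF (a b z : ℂ) : ℂ :=
  ∑' n : ℕ, (ascPochhammer ℂ n).eval a / (ascPochhammer ℂ n).eval b * (z ^ n / (n.factorial : ℂ))

/-- The meromorphic function `1 / ζ`: at the pole `s = 1` of `ζ` its value is `0` (there
Mathlib's `riemannZeta` takes a finite conventional value). -/
def zetaRecip (s : ℂ) : ℂ :=
  if s = 1 then 0 else 1 / riemannZeta s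

/-- `zetaRecip` has the right value at `1`: it is continuous there. -/
theorem continuousAt_zetaRecip_one : ContinuousAt zetaRecip 1 := by
  have h1 : Tendsto (fun s : ℂ => (s - 1) / ((s - 1) * riemannZeta s)) (𝓝[≠] 1) (𝓝 (0 / 1)) := by
    refine Tendsto.div ?_ riemannZeta_residue_one one_ne_zero
    have : ContinuousAt (fun s : ℂ => s - 1) 1 := by fun_prop
    simpa [ContinuousAt] using this.tendsto.mono_left (nhdsWithin_le_nhds (s := {1}ᶜ))
  rw [continuousAt_iff_punctured_nhds]
  have h2 : zetaRecip 1 = 0 / 1 := by simp [zetaRecip]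
  rw [h2]
  refine h1.congr' ?_
  filter_upwards [self_mem_nhdsWithin] with s hs
  have hs' : s - 1 ≠ 0 := sub_ne_zero.mpr hs
  have hs1 : s ≠ 1 := hs
  rw [zetaRecip, if_neg hs1, div_mul_eq_div_div, div_self hs']

/-- The set of non-trivial zeros of the Riemann zeta function. -/
def zetaZeros : Set ℂ := {ρ | riemannZeta ρ = 0 ∧ 0 < ρ.re ∧ ρ.re < 1}

/-- The quantity `exp (-A |Im ρ| / log |Im ρ|)`. -/
def bracketWidth (A : ℝ) (ρ : ℂ) : ℝ :=
  Real.exp (-(A * |ρ.im|) / Real.log |ρ.im|)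

/-- The equivalence relation on the non-trivial zeros of `ζ` generated by
`|Im ρ₁ - Im ρ₂| < exp (-A |Im ρ₁| / log |Im ρ₁|) + exp (-A |Im ρ₂| / log |Im ρ₂|)`:
zeros satisfying this inequality lie in the same bracket. -/
def bracketSetoid (A : ℝ) : Setoid zetaZeros :=
  Relation.EqvGen.setoid fun ρ₁ ρ₂ =>
    |(ρ₁ : ℂ).im - (ρ₂ : ℂ).im| < bracketWidth A ρ₁ + bracketWidth A ρ₂

/-- The brackets with constant `A`. -/
def ZetaBracket (A : ℝ) : Type := Quotient (bracketSetoid A)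

/-- The set of non-trivial zeros in a bracket. -/
def ZetaBracket.zeros {A : ℝ} (b : ZetaBracket A) : Set ℂ :=
  {ρ | ∃ h : ρ ∈ zetaZeros, Quotient.mk (bracketSetoid A) ⟨ρ, h⟩ = b}

/-- The series `∑_ρ f(ρ)` over the non-trivial zeros of `ζ`, bracketed with constant `A`,
converges to `S`: every bracket is finite, and the series whose terms are the finite sums of `f`
over the brackets has the sum `S`. -/
structure BracketedHasSum (A : ℝ) (f : ℂ → ℂ) (S : ℂ) : Prop where
  finite : ∀ b : ZetaBracket A, b.zeros.Finite
  hasSum : HasSum (fun b : ZetaBracket A => ∑ᶠ ρ ∈ b.zeros, f ρ) S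

end

noncomputable section

/-! Put F(w) = Γ(k - w) x^(w - k) / (ζ(w) ζ(w - r)) (`zetaKernel`). Every term of the identity is a
residue of F, and the identity says that all residues add up to zero.

At w = k + j the Gamma factor gives -(-x)^j / j! · 1/(ζ(k + j) ζ(k + j - r)). Since 1/(ζ(u) ζ(u -
r)) = ∑ σ_r⁻¹(n) n^(-u), the sum over j rebuilds e^(-x/n) and yields minus the left side. For w near
-j, the functional equation applied to both zeta factors turns F into a constant times (2π)^(-2w)
Γ(k - w) Γ(w - r) / Γ(1 - w) · x^(w - k) / (ζ(1 - w) ζ(r + 1 - w)) (`zetaKernel_eq_reflected`), and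
the residues become the Taylor coefficients of ₁F₁. Oddness of r keeps the trivial zeros of the two
zeta factors apart, so that these poles are simple. The points r - 2m > 0 give the finite sum, and
the points ρ and ρ + r give the two halves of the series over zeros.

F is integrated over the rectangle with vertical sides Re w = -J - 1/2 and Re w = k + J + 1/2 and
horizontal sides at heights ±u. First u → ∞ with J fixed, then J → ∞; the vertical sides contribute
O(Y^J / J!) (`tendsto_residue_sums`). No Mellin inversion is needed, and k = r + 1 requires no other
contour.

The horizontal sides need a lower bound for ζ. Jensen's inequality gives O(log t) zeros near height
t; after these are replaced by Blaschke factors, Borel–Carathéodory bounds |ζ| below by t^(-C) times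
the product of the normalised distances to them. If t keeps the distance exp(-A|Im ρ| / log|Im ρ|)
from every ordinate Im ρ, with A small, this is at least e^(-t/4), and the decay of Γ wins. Such
heights ("uncovered") are abundant, because the forbidden intervals have small total length. The
brackets are the clusters of overlapping forbidden intervals. Hence a bracket far from the real axis
is cut out by a thin rectangle with uncovered horizontal sides (`bracket_eq_strip`); its sum is a
contour integral of size O(e^(-t/2)), and the series of bracket sums converges absolutely.

It remains to exchange the sums over j and n. This uses partial sums of ∑ σ_r⁻¹(n) n^(-u-j) that are
bounded uniformly in j. At the boundary u = r + 1, j = 0, convergence rests on the prime number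
theorem in the form ∑ μ(n)/n = 0, which is obtained from a Tauberian theorem for bounded slowly
oscillating functions (`tendsto_zero_of_laplace`). -/

/-! ### Bounds and residues of the Gamma function -/

lemma norm_Gamma_half_le (t : ℝ) :
    ‖Complex.Gamma (1 / 2 + t * Complex.I)‖ ≤
      Real.sqrt (2 * Real.pi) * Real.exp (-(Real.pi / 2 * |t|)) := by
  have h := Complex.Gamma_mul_Gamma_one_sub (1 / 2 + t * Complex.I)
  have hc : (1 : ℂ) - (1 / 2 + t * Complex.I) =
      (starRingEnd ℂ) (1 / 2 + t * Complex.I) := by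
    simp only [map_add, map_mul, Complex.conj_I, Complex.conj_ofReal, map_div₀, map_one,
      Complex.conj_ofNat]
    ring
  rw [hc, Complex.Gamma_conj, Complex.mul_conj] at h
  have hs : Complex.sin (Real.pi * (1 / 2 + t * Complex.I)) = (Real.cosh (Real.pi * t) : ℂ) := by
    rw [show (Real.pi : ℂ) * (1 / 2 + t * Complex.I) =
      (Real.pi * t : ℂ) * Complex.I + Real.pi / 2 by ring, Complex.sin_add_pi_div_two,
      Complex.cos_mul_I]
    simp
  rw [hs, ← Complex.ofReal_div] at h
  have h2 : ‖Complex.Gamma (1 / 2 + t * Complex.I)‖ ^ 2 = Real.pi / Real.cosh (Real.pi * t) := by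
    rw [← Complex.normSq_eq_norm_sq]; exact_mod_cast h
  have hcosh : Real.exp (Real.pi * |t|) / 2 ≤ Real.cosh (Real.pi * t) := by
    rw [← Real.cosh_abs, abs_mul, abs_of_pos Real.pi_pos, Real.cosh_eq]
    have := Real.exp_pos (-(Real.pi * |t|))
    linarith
  refine le_of_sq_le_sq ?_ (by positivity)
  rw [h2, mul_pow, Real.sq_sqrt (by positivity), ← Real.exp_nat_mul,
    div_le_iff₀ (Real.cosh_pos _)]
  calc Real.pi = 2 * Real.pi * Real.exp (-(Real.pi * |t|)) * (Real.exp (Real.pi * |t|) / 2) := by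
        rw [Real.exp_neg]; field_simp
    _ ≤ _ := by
        rw [show ((2 : ℕ) : ℝ) * -(Real.pi / 2 * |t|) = -(Real.pi * |t|) by push_cast; ring]
        gcongr

/-- Taking absolute values inside the Beta integral gives |B(z, δ)| ≤ B(Re z, δ). Hence |Γ(z)| /
Γ(Re z) can only grow when z moves to the right. -/
lemma norm_Gamma_mul_Gamma_le {z : ℂ} (hz : 0 < z.re) {δ : ℝ} (hδ : 0 < δ) :
    ‖Complex.Gamma z‖ * Real.Gamma (z.re + δ) ≤
      Real.Gamma z.re * ‖Complex.Gamma (z + δ)‖ := by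
  have h1 := Complex.Gamma_mul_Gamma_eq_betaIntegral (s := z) (t := (δ : ℂ)) hz (by simpa)
  have h2 := Complex.Gamma_mul_Gamma_eq_betaIntegral (s := (z.re : ℂ)) (t := (δ : ℂ))
    (by simpa) (by simpa)
  set B : ℝ := ∫ x : ℝ in (0 : ℝ)..1, x ^ (z.re - 1) * (1 - x) ^ (δ - 1) with hB
  have hBc : Complex.betaIntegral (z.re : ℂ) (δ : ℂ) = B := by
    rw [Complex.betaIntegral, hB, ← intervalIntegral.integral_ofReal]
    refine intervalIntegral.integral_congr fun x hx => ?_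
    rw [Set.uIcc_of_le zero_le_one] at hx
    have hx' : 0 ≤ 1 - x := by linarith [hx.2]
    simp only [Complex.ofReal_mul]
    rw [Complex.ofReal_cpow hx.1, Complex.ofReal_cpow hx']
    push_cast
    rfl
  have hBle : ‖Complex.betaIntegral z δ‖ ≤ B := by
    rw [Complex.betaIntegral, hB]
    refine (intervalIntegral.norm_integral_le_integral_norm zero_le_one).trans (le_of_eq ?_)
    refine intervalIntegral.integral_congr_ae ?_
    -- The norm formula for powers needs a positive base, which fails for 1 - x at the end point.
    have hne : ∀ᵐ x : ℝ, x ≠ 1 := by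
      simp [MeasureTheory.ae_iff, MeasureTheory.measure_singleton]
    filter_upwards [hne] with x hx1 hx
    rw [Set.uIoc_of_le zero_le_one] at hx
    have hx' : 0 < 1 - x := by
      rcases lt_or_eq_of_le hx.2 with h | h
      · linarith
      · exact absurd h hx1
    rw [norm_mul, Complex.norm_cpow_eq_rpow_re_of_pos hx.1,
      show (1 : ℂ) - x = ((1 - x : ℝ) : ℂ) by push_cast; rfl,
      Complex.norm_cpow_eq_rpow_re_of_pos hx']
    simp
  rw [hBc, ← Complex.ofReal_add, Complex.Gamma_ofReal, Complex.Gamma_ofReal,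
    Complex.Gamma_ofReal] at h2
  have h2' : Real.Gamma z.re * Real.Gamma δ = Real.Gamma (z.re + δ) * B := by exact_mod_cast h2
  have hG := Real.Gamma_pos_of_pos hδ
  have h1' : ‖Complex.Gamma z‖ * Real.Gamma δ =
      ‖Complex.Gamma (z + δ)‖ * ‖Complex.betaIntegral z δ‖ := by
    rw [← norm_mul, ← h1, norm_mul, Complex.Gamma_ofReal, Complex.norm_real, Real.norm_eq_abs,
      abs_of_pos hG]
  have h3 : 0 < Real.Gamma (z.re + δ) := Real.Gamma_pos_of_pos (by linarith)
  refine le_of_mul_le_mul_right ?_ hG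
  calc ‖Complex.Gamma z‖ * Real.Gamma (z.re + δ) * Real.Gamma δ
      = ‖Complex.Gamma (z + δ)‖ * ‖Complex.betaIntegral z δ‖ * Real.Gamma (z.re + δ) := by
        rw [← h1']; ring
    _ ≤ ‖Complex.Gamma (z + δ)‖ * B * Real.Gamma (z.re + δ) := by gcongr
    _ = _ := by linear_combination (-‖Complex.Gamma (z + δ)‖) * h2'

lemma Gamma_sub_nat_mul_prod {z : ℂ} (n : ℕ) (hz : ∀ i ∈ Finset.range n, z - (i + 1) ≠ 0) :
    Complex.Gamma (z - n) * ∏ i ∈ Finset.range n, (z - (i + 1)) = Complex.Gamma z := by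
  induction n with
  | zero => simp
  | succ n ih =>
    rw [Finset.prod_range_succ, ← ih fun i hi => hz i (by simp at hi ⊢; omega)]
    have h := Complex.Gamma_add_one (z - (n + 1)) (hz n (by simp))
    rw [show z - (n + 1) + 1 = z - n by ring] at h
    rw [h]
    push_cast
    ring

/-- Each factor z - (i + 1) divided out by the recurrence has modulus at least i + 1. This is the
source of the 1 / J! on the vertical sides. -/
lemma norm_Gamma_sub_nat_le {z : ℂ} (hz : z.re < 0) (n : ℕ) :
    ‖Complex.Gamma (z - n)‖ ≤ ‖Complex.Gamma z‖ / n.factorial := by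
  have hle : ∀ i : ℕ, ((i : ℝ) + 1) ≤ ‖z - (i + 1)‖ := by
    intro i
    have h1 := Complex.abs_re_le_norm (z - (i + 1))
    have h2 : (z - (i + 1)).re = z.re - (i + 1) := by simp
    rw [h2, abs_of_neg (by linarith [(Nat.cast_nonneg i : (0 : ℝ) ≤ i)])] at h1
    linarith
  have h := Gamma_sub_nat_mul_prod (z := z) n fun i _ h0 => by
    have := hle i
    rw [h0, norm_zero] at this
    linarith [(Nat.cast_nonneg i : (0 : ℝ) ≤ i)]
  have hp : (n.factorial : ℝ) ≤ ∏ i ∈ Finset.range n, ‖z - (i + 1)‖ := by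
    rw [← Finset.prod_range_add_one_eq_factorial]
    push_cast
    exact Finset.prod_le_prod (fun i _ => by positivity) fun i _ => hle i
  rw [le_div_iff₀ (by positivity), ← h, norm_mul, norm_prod]
  gcongr

/-- The recurrence transports w Γ(w) → 1 at 0 to the pole at -n. -/
lemma tendsto_Gamma_residue (n : ℕ) :
    Tendsto (fun w : ℂ => (w + n) * Complex.Gamma w) (𝓝[≠] (-n : ℂ))
      (𝓝 ((-1) ^ n / (n.factorial : ℂ))) := by
  have hne : ∀ i ∈ Finset.range n, ((-n : ℂ) + n) - (i + 1) ≠ 0 := by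
    intro i _ h
    have h1 : ((i : ℂ) + 1) = 0 := by linear_combination -h
    exact Nat.cast_add_one_ne_zero i h1
  have hprod : ContinuousAt (fun w : ℂ => ∏ i ∈ Finset.range n, ((w + n) - (i + 1))) (-n : ℂ) := by
    fun_prop
  have hval : ∏ i ∈ Finset.range n, (((-n : ℂ) + n) - (i + 1)) = (-1) ^ n * n.factorial := by
    rw [← Finset.prod_range_add_one_eq_factorial]
    push_cast
    rw [← Finset.card_range n, ← Finset.prod_const, Finset.card_range, ← Finset.prod_mul_distrib]
    exact Finset.prod_congr rfl fun i _ => by ring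
  have hmap : Tendsto (fun w : ℂ => w + n) (𝓝[≠] (-n : ℂ)) (𝓝[≠] 0) := by
    refine tendsto_nhdsWithin_of_tendsto_nhds_of_eventually_within _ ?_ ?_
    · have : ContinuousAt (fun w : ℂ => w + n) (-n : ℂ) := by fun_prop
      simpa [ContinuousAt] using this.tendsto.mono_left (nhdsWithin_le_nhds (s := {(-n : ℂ)}ᶜ))
    · filter_upwards [self_mem_nhdsWithin] with w hw h0
      exact hw (by simpa using eq_neg_of_add_eq_zero_left h0)
  have hfac : ((-1) ^ n * n.factorial : ℂ) ≠ 0 :=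
    mul_ne_zero (pow_ne_zero _ (by norm_num)) (by exact_mod_cast n.factorial_ne_zero)
  have h0 := (Complex.tendsto_self_mul_Gamma_nhds_zero.comp hmap).div
    (hprod.tendsto.mono_left nhdsWithin_le_nhds) (by rw [hval]; exact hfac)
  rw [hval] at h0
  have hev : ∀ᶠ w : ℂ in 𝓝[≠] (-n : ℂ), ∏ i ∈ Finset.range n, ((w + n) - (i + 1)) ≠ 0 :=
    (hprod.eventually_ne (by rw [hval]; exact hfac)).filter_mono nhdsWithin_le_nhds
  have hlim : (1 / ((-1) ^ n * n.factorial) : ℂ) = (-1) ^ n / n.factorial := by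
    rw [one_div, mul_inv, ← inv_pow, inv_neg_one, div_eq_mul_inv]
  rw [hlim] at h0
  refine h0.congr' ?_
  filter_upwards [hev] with w hw
  have := Gamma_sub_nat_mul_prod (z := w + n) n (fun i hi => (Finset.prod_ne_zero_iff.1 hw) i hi)
  simp only [add_sub_cancel_right] at this
  simp only [Pi.div_apply, Function.comp_apply, ← this]
  field_simp

lemma norm_Gamma_le_norm_Gamma_add_nat {z : ℂ} (hz : 1 ≤ |z.im|) (n : ℕ) :
    ‖Complex.Gamma z‖ ≤ ‖Complex.Gamma (z + n)‖ := by
  induction n with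
  | zero => simp
  | succ n ih =>
    have him : (z + n).im = z.im := by simp
    have h1 : 1 ≤ ‖z + n‖ := by
      rw [← him] at hz
      exact hz.trans (Complex.abs_im_le_norm _)
    have h0 : z + n ≠ 0 := by
      intro h
      rw [h, norm_zero] at h1
      linarith
    refine ih.trans ?_
    rw [Nat.cast_succ, ← add_assoc, Complex.Gamma_add_one _ h0, norm_mul]
    exact le_mul_of_one_le_left (norm_nonneg _) h1

lemma norm_Gamma_add_nat_le {z : ℂ} (hz : 0 < z.re) (n : ℕ) :
    ‖Complex.Gamma (z + n)‖ ≤ (‖z‖ + n) ^ n * ‖Complex.Gamma z‖ := by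
  have key : ∀ m : ℕ, m ≤ n →
      ‖Complex.Gamma (z + m)‖ ≤ (‖z‖ + n) ^ m * ‖Complex.Gamma z‖ := by
    intro m
    induction m with
    | zero => simp
    | succ m ih =>
      intro hm
      have h0 : z + m ≠ 0 := by
        intro h
        have : (z + m).re = z.re + m := by simp
        rw [h, Complex.zero_re] at this
        linarith [(Nat.cast_nonneg m : (0 : ℝ) ≤ m)]
      have h1 : ‖z + m‖ ≤ ‖z‖ + n := by
        refine (norm_add_le _ _).trans ?_
        have : (m : ℝ) ≤ n := by exact_mod_cast (by omega : m ≤ n)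
        simpa using this
      rw [Nat.cast_succ, ← add_assoc, Complex.Gamma_add_one _ h0, norm_mul, pow_succ',
        mul_assoc]
      exact mul_le_mul h1 (ih (by omega)) (norm_nonneg _) (by positivity)
  exact key n le_rfl

lemma pow_le_factorial_mul_exp {ε x : ℝ} (hε : 0 < ε) (hx : 0 ≤ x) (n : ℕ) :
    x ^ n ≤ n.factorial / ε ^ n * Real.exp (ε * x) := by
  have h := Real.pow_div_factorial_le_exp (ε * x) (by positivity) n
  rw [div_le_iff₀ (by positivity), mul_pow] at h
  rw [div_mul_eq_mul_div, le_div_iff₀ (by positivity)]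
  linarith

/-- Exponential decay of `Γ` on vertical strips. -/
theorem exists_norm_Gamma_le_exp (σ₀ σ₁ : ℝ) {ε : ℝ} (hε : 0 < ε) :
    ∃ C : ℝ, 0 < C ∧ ∀ z : ℂ, σ₀ ≤ z.re → z.re ≤ σ₁ → 1 ≤ |z.im| →
      ‖Complex.Gamma z‖ ≤ C * Real.exp (-((Real.pi / 2 - ε) * |z.im|)) := by
  -- The point z + M lies in Re ≥ 1/2. From there the Beta comparison leads right to the line Re =
  -- 1/2 + N, and the recurrence leads back to Re = 1/2, where the reflection formula controls Γ.
  -- The loss is a polynomial of degree N in |Im z|, absorbed by exp(ε |Im z|).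
  obtain ⟨M, hM⟩ := exists_nat_ge (1 / 2 - σ₀)
  obtain ⟨N, hN⟩ := exists_nat_gt (σ₁ + M)
  have hcont : ContinuousOn Real.Gamma (Set.Icc (1 / 2) (σ₁ + M)) := by
    intro x hx
    refine (Real.differentiableAt_Gamma fun m h => ?_).continuousAt.continuousWithinAt
    have := hx.1
    rw [h] at this
    linarith [(Nat.cast_nonneg m : (0 : ℝ) ≤ m)]
  obtain ⟨K, hK⟩ := isCompact_Icc.exists_bound_of_continuousOn hcont
  have hK0 : 0 ≤ |K| := abs_nonneg K
  set g := Real.Gamma (1 / 2 + N) with hg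
  have hgpos : 0 < g := Real.Gamma_pos_of_pos (by positivity)
  set C := (|K| + 1) / g * (N.factorial / ε ^ N * Real.exp (ε * (1 / 2 + N)) *
    Real.sqrt (2 * Real.pi)) with hC
  refine ⟨C, by positivity, fun z h0 h1 him => ?_⟩
  set u : ℂ := z + M with hu
  have hure : u.re = z.re + M := by simp [hu]
  have hupos : 0 < u.re := by rw [hure]; linarith
  have hδ : 0 < 1 / 2 + N - u.re := by rw [hure]; linarith
  have h2 := norm_Gamma_mul_Gamma_le hupos hδ
  have h3 : u + ((1 / 2 + N - u.re : ℝ) : ℂ) = (1 / 2 + z.im * Complex.I) + N := by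
    apply Complex.ext <;> simp [hu]
  rw [h3, show u.re + (1 / 2 + N - u.re) = 1 / 2 + (N : ℝ) by ring] at h2
  have h4 : Real.Gamma u.re ≤ |K| + 1 := by
    have := hK u.re ⟨by rw [hure]; linarith, by rw [hure]; linarith⟩
    linarith [(le_abs_self (Real.Gamma u.re)).trans this, le_abs_self K]
  have h5 := norm_Gamma_add_nat_le (z := 1 / 2 + z.im * Complex.I) (by simp) N
  have h6 : ‖(1 / 2 + z.im * Complex.I : ℂ)‖ + N ≤ |z.im| + (1 / 2 + N) := by
    have := norm_add_le (1 / 2 : ℂ) (z.im * Complex.I)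
    simp at this ⊢
    linarith
  have h7 : (‖(1 / 2 + z.im * Complex.I : ℂ)‖ + N) ^ N ≤
      N.factorial / ε ^ N * (Real.exp (ε * |z.im|) * Real.exp (ε * (1 / 2 + N))) := by
    rw [← Real.exp_add, ← mul_add]
    refine (pow_le_pow_left₀ (by positivity) h6 N).trans ?_
    exact pow_le_factorial_mul_exp hε (by positivity) N
  have h8 : ‖Complex.Gamma z‖ ≤ ‖Complex.Gamma u‖ := norm_Gamma_le_norm_Gamma_add_nat him M
  have h9 : ‖Complex.Gamma u‖ * g ≤ (|K| + 1) *
      (N.factorial / ε ^ N * (Real.exp (ε * |z.im|) * Real.exp (ε * (1 / 2 + N))) *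
        (Real.sqrt (2 * Real.pi) * Real.exp (-(Real.pi / 2 * |z.im|)))) := by
    refine h2.trans (mul_le_mul h4 (h5.trans ?_) (norm_nonneg _) (by positivity))
    exact mul_le_mul h7 (norm_Gamma_half_le _) (norm_nonneg _) (by positivity)
  rw [← le_div_iff₀ hgpos] at h9
  refine (h8.trans h9).trans (le_of_eq ?_)
  rw [hC, show -((Real.pi / 2 - ε) * |z.im|) = ε * |z.im| + -(Real.pi / 2 * |z.im|) by ring,
    Real.exp_add]
  ring

/-- A real shift c is dominated by an integral shift n > c: the Beta comparison leads from z + c to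
z + n, and the quotient of real Gamma values is at most 1 because Γ increases on [2, ∞). It serves
to bound Γ(k - w) / Γ(1 - w) for non-integral k. -/
lemma norm_Gamma_add_le {z : ℂ} (hz : 0 < z.re) {c : ℝ} (hc : 2 ≤ z.re + c) {n : ℕ}
    (hn : c < n) :
    ‖Complex.Gamma (z + c)‖ ≤ (‖z‖ + n) ^ n * ‖Complex.Gamma z‖ := by
  refine le_trans ?_ (norm_Gamma_add_nat_le hz n)
  have h := norm_Gamma_mul_Gamma_le (z := z + c) (by simp; linarith) (sub_pos.2 hn)
  have h1 : (z + c).re = z.re + c := by simp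
  rw [h1, show z.re + c + (n - c) = z.re + n by ring,
    show z + c + ((n - c : ℝ) : ℂ) = z + n by push_cast; ring] at h
  have h2 : Real.Gamma (z.re + c) ≤ Real.Gamma (z.re + n) :=
    Real.Gamma_strictMonoOn_Ici.monotoneOn (Set.mem_Ici.2 hc)
      (Set.mem_Ici.2 (by linarith)) (by linarith)
  have h3 : 0 < Real.Gamma (z.re + n) := Real.Gamma_pos_of_pos (by linarith)
  refine le_of_mul_le_mul_right (h.trans ?_) h3
  rw [mul_comm]
  gcongr

/-! ### The residue theorem on rectangles -/

/-- The integral of `f` over the boundary of the rectangle `[a, b] × [c, d]`. -/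
def rectIntegral (f : ℂ → ℂ) (a b c d : ℝ) : ℂ :=
  (∫ x : ℝ in a..b, f (x + c * Complex.I)) - (∫ x : ℝ in a..b, f (x + d * Complex.I)) +
    Complex.I * (∫ y : ℝ in c..d, f (b + y * Complex.I)) -
    Complex.I * (∫ y : ℝ in c..d, f (a + y * Complex.I))

lemma log_I_mul {u : ℂ} (hu : 0 < u.re) :
    Complex.log (Complex.I * u) = Complex.log u + Real.pi / 2 * Complex.I := by
  have hu0 : u ≠ 0 := by rintro rfl; simp at hu
  have h := Complex.abs_arg_lt_pi_div_two_iff.2 (Or.inl hu)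
  rw [abs_lt] at h
  rw [Complex.log_mul Complex.I_ne_zero hu0, Complex.log_I, add_comm]
  rw [Complex.arg_I]
  constructor <;> linarith [Real.pi_pos, h.1, h.2]

/-- The rotation q moves the segment into the right half-plane, away from the cut of the logarithm,
and cancels in the logarithmic derivative. -/
lemma integral_log_deriv_segment (α β q : ℂ) (hq : q ≠ 0) (s t : ℝ)
    (h : ∀ y ∈ Set.uIcc s t, 0 < (q * (α + y * β)).re) :
    ∫ y : ℝ in s..t, β * (α + y * β)⁻¹ =
      Complex.log (q * (α + t * β)) - Complex.log (q * (α + s * β)) := by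
  have hne : ∀ y ∈ Set.uIcc s t, (α + (y : ℂ) * β) ≠ 0 := by
    intro y hy h0
    have := h y hy
    simp [h0] at this
  refine intervalIntegral.integral_eq_sub_of_hasDerivAt
    (f := fun y : ℝ => Complex.log (q * (α + y * β))) (fun y hy => ?_) ?_
  · have h1 : HasDerivAt (fun y : ℝ => q * (α + (y : ℂ) * β)) (q * β) y := by
      have := (((Complex.ofRealCLM.hasDerivAt (x := y)).mul_const β).const_add α).const_mul q
      simpa using this
    have h2 := h1.clog_real (Or.inl (h y hy))
    rw [mul_div_mul_left _ _ hq, div_eq_mul_inv] at h2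
    exact h2
  · refine ContinuousOn.intervalIntegrable ?_
    refine continuousOn_const.mul (ContinuousOn.inv₀ (by fun_prop) hne)

/-- Each side has its own rotated logarithm. At each of the four corners consecutive branches differ
by πi/2, and the rest telescopes. -/
lemma rectIntegral_inv_sub {a b c d : ℝ} {p : ℂ} (ha : a < p.re) (hb : p.re < b) (hc : c < p.im)
    (hd : p.im < d) :
    rectIntegral (fun w => (w - p)⁻¹) a b c d = 2 * Real.pi * Complex.I := by
  have hab : a ≤ b := by linarith
  have hcd : c ≤ d := by linarith
  have hI := Complex.I_ne_zero
  have bot := integral_log_deriv_segment (c * Complex.I - p) 1 Complex.I hI a b (by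
    intro y _; simp; linarith)
  have top := integral_log_deriv_segment (d * Complex.I - p) 1 (-Complex.I) (by simp) a b (by
    intro y _; simp; linarith)
  have right := integral_log_deriv_segment (b - p) Complex.I 1 (by simp) c d (by
    intro y _; simp; linarith)
  have left := integral_log_deriv_segment (a - p) Complex.I (-1) (by simp) c d (by
    intro y _; simp; linarith)
  have e1 : ∀ x e : ℝ, (x : ℂ) + e * Complex.I - p = (e * Complex.I - p) + x * 1 := by
    intros; ring
  have e2 : ∀ x e : ℝ, (x : ℂ) + e * Complex.I - p = (x - p) + e * Complex.I := by
    intros; ring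
  have k1 : Complex.log (Complex.I * (c * Complex.I - p + b * 1)) =
      Complex.log (1 * (b - p + c * Complex.I)) + Real.pi / 2 * Complex.I := by
    rw [← log_I_mul (by simp; linarith)]; congr 1; ring
  have k2 : Complex.log (1 * (b - p + d * Complex.I)) =
      Complex.log (-Complex.I * (d * Complex.I - p + b * 1)) + Real.pi / 2 * Complex.I := by
    rw [← log_I_mul (by simp; linarith)]; congr 1; ring_nf; simp; ring
  have k3 : Complex.log (-Complex.I * (d * Complex.I - p + a * 1)) =
      Complex.log (-1 * (a - p + d * Complex.I)) + Real.pi / 2 * Complex.I := by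
    rw [← log_I_mul (by simp; linarith)]; congr 1; ring_nf
  have k4 : Complex.log (-1 * (a - p + c * Complex.I)) =
      Complex.log (Complex.I * (c * Complex.I - p + a * 1)) + Real.pi / 2 * Complex.I := by
    rw [← log_I_mul (by simp; linarith)]; congr 1; ring_nf; simp; ring
  rw [rectIntegral, ← intervalIntegral.integral_const_mul, ← intervalIntegral.integral_const_mul]
  simp only [one_mul] at bot top
  simp_rw [e2 b, e2 a]
  simp_rw [e1 _ c, e1 _ d]
  rw [bot, top, right, left, k1, k2, k3, k4]
  ring

lemma mem_rect {a b c d : ℝ} {x : ℝ} (hx : x ∈ Set.uIcc a b)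
    {e : ℝ} (he : e ∈ Set.uIcc c d) :
    (x : ℂ) + e * Complex.I ∈ Set.uIcc a b ×ℂ Set.uIcc c d := by
  simp [Complex.mem_reProdIm, hx, he]

lemma rectIntegral_eq_zero {F : ℂ → ℂ} {a b c d : ℝ}
    (hF : ∀ z ∈ Set.uIcc a b ×ℂ Set.uIcc c d, DifferentiableAt ℂ F z) :
    rectIntegral F a b c d = 0 := by
  have := Complex.integral_boundary_rect_eq_zero_of_differentiableOn F
    (a + c * Complex.I) (b + d * Complex.I) (by
      intro z hz
      simp at hz
      exact (hF z hz).differentiableWithinAt)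
  simpa [rectIntegral] using this

lemma rectIntegral_congr {F G : ℂ → ℂ} {a b c d : ℝ}
    (h : ∀ z ∈ Set.uIcc a b ×ℂ Set.uIcc c d, (z.re = a ∨ z.re = b ∨ z.im = c ∨ z.im = d) →
      F z = G z) :
    rectIntegral F a b c d = rectIntegral G a b c d := by
  unfold rectIntegral
  congr 1
  · congr 1
    · congr 1
      · exact intervalIntegral.integral_congr fun x hx =>
          h _ (mem_rect hx Set.left_mem_uIcc) (by simp)
      · exact intervalIntegral.integral_congr fun x hx =>
          h _ (mem_rect hx Set.right_mem_uIcc) (by simp)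
    · congr 1
      exact intervalIntegral.integral_congr fun x hx =>
          h _ (mem_rect Set.right_mem_uIcc hx) (by simp)
  · congr 1
    exact intervalIntegral.integral_congr fun x hx =>
          h _ (mem_rect Set.left_mem_uIcc hx) (by simp)

lemma rectIntegral_sub_const_mul {F G : ℂ → ℂ} {a b c d : ℝ} (A : ℂ)
    (hF : ∀ z ∈ Set.uIcc a b ×ℂ Set.uIcc c d, (z.re = a ∨ z.re = b ∨ z.im = c ∨ z.im = d) →
      ContinuousAt F z)
    (hG : ∀ z ∈ Set.uIcc a b ×ℂ Set.uIcc c d, (z.re = a ∨ z.re = b ∨ z.im = c ∨ z.im = d) →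
      ContinuousAt G z) :
    rectIntegral (fun z => F z - A * G z) a b c d =
      rectIntegral F a b c d - A * rectIntegral G a b c d := by
  have key : ∀ {H : ℂ → ℂ}, (∀ z ∈ Set.uIcc a b ×ℂ Set.uIcc c d,
      (z.re = a ∨ z.re = b ∨ z.im = c ∨ z.im = d) → ContinuousAt H z) →
      IntervalIntegrable (fun x : ℝ => H (x + c * Complex.I)) MeasureTheory.volume a b ∧
      IntervalIntegrable (fun x : ℝ => H (x + d * Complex.I)) MeasureTheory.volume a b ∧
      IntervalIntegrable (fun x : ℝ => H (a + x * Complex.I)) MeasureTheory.volume c d ∧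
      IntervalIntegrable (fun x : ℝ => H (b + x * Complex.I)) MeasureTheory.volume c d := by
    intro H hH
    refine ⟨?_, ?_, ?_, ?_⟩ <;> refine ContinuousOn.intervalIntegrable fun x hx => ?_ <;>
      refine ContinuousAt.continuousWithinAt ?_
    · exact (hH _ (mem_rect hx Set.left_mem_uIcc) (by simp)).comp
        (f := fun x : ℝ => (x : ℂ) + c * Complex.I) (by fun_prop)
    · exact (hH _ (mem_rect hx Set.right_mem_uIcc) (by simp)).comp
        (f := fun x : ℝ => (x : ℂ) + d * Complex.I) (by fun_prop)
    · exact (hH _ (mem_rect Set.left_mem_uIcc hx) (by simp)).comp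
        (f := fun x : ℝ => (a : ℂ) + x * Complex.I) (by fun_prop)
    · exact (hH _ (mem_rect Set.right_mem_uIcc hx) (by simp)).comp
        (f := fun x : ℝ => (b : ℂ) + x * Complex.I) (by fun_prop)
  obtain ⟨f1, f2, f3, f4⟩ := key hF
  obtain ⟨g1, g2, g3, g4⟩ := key hG
  unfold rectIntegral
  rw [intervalIntegral.integral_sub f1 (g1.const_mul A),
    intervalIntegral.integral_sub f2 (g2.const_mul A),
    intervalIntegral.integral_sub f3 (g3.const_mul A),
    intervalIntegral.integral_sub f4 (g4.const_mul A)]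
  simp only [intervalIntegral.integral_const_mul]
  ring

/-- The residue theorem for a rectangle and finitely many simple poles. -/
theorem rectIntegral_eq_sum_residues {a b c d : ℝ} (hab : a < b) (hcd : c < d) (S : Finset ℂ)
    (res : ℂ → ℂ) (hS : ∀ p ∈ S, (a < p.re ∧ p.re < b) ∧ (c < p.im ∧ p.im < d)) (F : ℂ → ℂ)
    (hF : ∀ z ∈ Set.uIcc a b ×ℂ Set.uIcc c d, z ∉ S → DifferentiableAt ℂ F z)
    (hres : ∀ p ∈ S, Tendsto (fun w => (w - p) * F w) (𝓝[≠] p) (𝓝 (res p))) :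
    rectIntegral F a b c d = 2 * Real.pi * Complex.I * ∑ p ∈ S, res p := by
  classical
  induction S using Finset.induction_on generalizing F with
  | empty => simpa using rectIntegral_eq_zero (fun z hz => hF z hz (by simp))
  | insert p S hp ih =>
    -- Subtracting the principal part at p makes p removable, so the induction continues with `G'`,
    -- which is `G` with its arbitrary value at p replaced by the limit. As poles are described only
    -- by the limit of (w - p) F(w), regular points with residue 0 may be listed as well; this
    -- happens later at w = 0 and w = 1.
    set G : ℂ → ℂ := fun w => F w - res p * (w - p)⁻¹ with hG
    set G' : ℂ → ℂ := Function.update G p (limUnder (𝓝[≠] p) G) with hG'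
    have hpS := hS p (Finset.mem_insert_self _ _)
    have hne : ∀ z : ℂ, (z.re = a ∨ z.re = b ∨ z.im = c ∨ z.im = d) → ∀ q ∈ insert p S, z ≠ q := by
      rintro z hz q hq rfl
      obtain ⟨⟨h1, h2⟩, h3, h4⟩ := hS z hq
      rcases hz with h | h | h | h <;> linarith
    have hGd : ∀ z ∈ Set.uIcc a b ×ℂ Set.uIcc c d, z ∉ insert p S → DifferentiableAt ℂ G z := by
      intro z hz hzS
      have hzp : z - p ≠ 0 := sub_ne_zero.2 (fun h => hzS (by simp [h]))
      have h1 : DifferentiableAt ℂ (fun w : ℂ => res p * (w - p)⁻¹) z := by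
        fun_prop (disch := assumption)
      exact (hF z hz hzS).sub h1
    have heq : ∀ z, z ≠ p → G' =ᶠ[𝓝 z] G := by
      intro z hz
      filter_upwards [isOpen_ne.mem_nhds hz] with w hw
      simp [hG', Function.update_of_ne hw]
    have hG'd : ∀ z ∈ Set.uIcc a b ×ℂ Set.uIcc c d, z ∉ S → DifferentiableAt ℂ G' z := by
      intro z hz hzS
      by_cases hzp : z = p
      · subst hzp
        set s : Set ℂ := (Set.Ioo a b ×ℂ Set.Ioo c d) \ S with hs
        have hso : IsOpen s := (isOpen_Ioo.reProdIm isOpen_Ioo).sdiff S.finite_toSet.isClosed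
        have hzs : s ∈ 𝓝 z := hso.mem_nhds ⟨⟨hpS.1, hpS.2⟩, by simpa using hp⟩
        have hd : DifferentiableOn ℂ G (s \ {z}) := by
          intro w hw
          refine (hGd w ?_ ?_).differentiableWithinAt
          · obtain ⟨⟨h1, h2⟩, -⟩ := hw.1
            rw [Set.uIcc_of_le hab.le, Set.uIcc_of_le hcd.le]
            exact ⟨Set.Ioo_subset_Icc_self h1, Set.Ioo_subset_Icc_self h2⟩
          · have h1 := hw.1.2
            have h2 := hw.2
            simp at h1 h2 ⊢
            exact ⟨h2, h1⟩
        have hlim : Tendsto (fun w => (w - z) * (G w - G z)) (𝓝[≠] z) (𝓝 0) := by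
          have h1 := hres z (Finset.mem_insert_self _ _)
          have h2 : Tendsto (fun w : ℂ => (w - z) * G z) (𝓝[≠] z) (𝓝 0) := by
            have : ContinuousAt (fun w : ℂ => (w - z) * G z) z := by fun_prop
            simpa [ContinuousAt] using this.tendsto.mono_left (nhdsWithin_le_nhds (s := {z}ᶜ))
          have h3 := (h1.sub_const (res z)).sub h2
          rw [sub_self, sub_zero] at h3
          refine h3.congr' ?_
          filter_upwards [self_mem_nhdsWithin] with w hw
          have : w - z ≠ 0 := sub_ne_zero.2 hw
          simp only [hG]
          field_simp
        have ho : (fun w => G w - G z) =o[𝓝[≠] z] fun w => (w - z)⁻¹ := by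
          rw [Asymptotics.isLittleO_iff_tendsto']
          · refine hlim.congr fun w => ?_
            rw [div_inv_eq_mul, mul_comm]
          · filter_upwards [self_mem_nhdsWithin] with w hw h
            exact absurd (inv_eq_zero.1 h) (sub_ne_zero.2 hw)
        exact (Complex.differentiableOn_update_limUnder_of_isLittleO hzs hd ho).differentiableAt hzs
      · exact (hGd z hz (by simp [hzp, hzS])).congr_of_eventuallyEq (heq z hzp)
    have h1 := ih (fun q hq => hS q (Finset.mem_insert_of_mem hq)) G' hG'd (by
      intro q hq
      have hqp : q ≠ p := fun h => hp (h ▸ hq)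
      have h2 := hres q (Finset.mem_insert_of_mem hq)
      have h3 : Tendsto (fun w : ℂ => (w - q) * (res p * (w - p)⁻¹)) (𝓝[≠] q) (𝓝 0) := by
        have : ContinuousAt (fun w : ℂ => (w - q) * (res p * (w - p)⁻¹)) q := by
          have : q - p ≠ 0 := sub_ne_zero.2 hqp
          fun_prop (disch := assumption)
        simpa [ContinuousAt] using this.tendsto.mono_left (nhdsWithin_le_nhds (s := {q}ᶜ))
      have h4 := h2.sub h3
      rw [sub_zero] at h4
      refine h4.congr' ?_
      filter_upwards [(heq q hqp).filter_mono nhdsWithin_le_nhds] with w hw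
      rw [hw]
      simp only [hG]
      ring)
    have h2 : rectIntegral G' a b c d = rectIntegral F a b c d -
        res p * rectIntegral (fun w => (w - p)⁻¹) a b c d := by
      rw [← rectIntegral_sub_const_mul]
      · refine rectIntegral_congr fun z hz hzb => ?_
        exact (heq z (hne z hzb p (Finset.mem_insert_self _ _))).self_of_nhds
      · intro z hz hzb
        exact (hF z hz fun h => hne z hzb z h rfl).continuousAt
      · intro z hz hzb
        have : z - p ≠ 0 := sub_ne_zero.2 (hne z hzb p (Finset.mem_insert_self _ _))
        fun_prop (disch := assumption)
    rw [rectIntegral_inv_sub hpS.1.1 hpS.1.2 hpS.2.1 hpS.2.2, h1] at h2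
    rw [Finset.sum_insert hp]
    linear_combination -h2

/-! ### Zeros and lower bounds of holomorphic functions in a disc -/

/-- A holomorphic function vanishing on a finite set is divisible by the corresponding product. -/
lemma exists_eq_prod_sub_mul {U : Set ℂ} (hU : IsOpen U) (S : Finset ℂ) {f : ℂ → ℂ}
    (hf : DifferentiableOn ℂ f U) (hSU : ∀ w ∈ S, w ∈ U) (h0 : ∀ w ∈ S, f w = 0) :
    ∃ g : ℂ → ℂ, DifferentiableOn ℂ g U ∧ ∀ z, f z = (∏ w ∈ S, (z - w)) * g z := by
  classical
  induction S using Finset.induction_on generalizing f with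
  | empty => exact ⟨f, hf, by simp⟩
  | insert p S hp ih =>
    have hfp : f p = 0 := h0 p (Finset.mem_insert_self _ _)
    have hd : ∀ z, f z = (z - p) * dslope f p z := by
      intro z
      have := sub_smul_dslope f p z
      rw [hfp, sub_zero, smul_eq_mul] at this
      exact this.symm
    obtain ⟨g, hg, hfg⟩ := ih (f := dslope f p)
      ((Complex.differentiableOn_dslope (hU.mem_nhds (hSU p (Finset.mem_insert_self _ _)))).2 hf)
      (fun w hw => hSU w (Finset.mem_insert_of_mem hw)) (fun w hw => by
        have h1 := hd w
        rw [h0 w (Finset.mem_insert_of_mem hw)] at h1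
        have hwp : w - p ≠ 0 := sub_ne_zero.2 fun h => hp (h ▸ hw)
        exact (mul_eq_zero.1 h1.symm).resolve_left hwp)
    refine ⟨g, hg, fun z => ?_⟩
    rw [hd z, hfg z, Finset.prod_insert hp, mul_assoc]

/-- Simplicity of the zeros enters here: if g vanished at a zero listed in S, the product rule would
make f' vanish there too. -/
lemma ne_zero_of_eq_prod_sub_mul {f g : ℂ → ℂ} {S : Finset ℂ} {U : Set ℂ} (hU : IsOpen U)
    (hg : DifferentiableOn ℂ g U) (hfg : ∀ z, f z = (∏ w ∈ S, (z - w)) * g z) {p : ℂ}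
    (hp : p ∈ U) (hd : f p = 0 → p ∈ S ∧ deriv f p ≠ 0) : g p ≠ 0 := by
  classical
  intro hgp
  have hfp : f p = 0 := by rw [hfg, hgp, mul_zero]
  obtain ⟨hpS, hd⟩ := hd hfp
  refine hd ?_
  have h1 : DifferentiableAt ℂ (fun z : ℂ => ∏ w ∈ S, (z - w)) p := by fun_prop
  have h2 : DifferentiableAt ℂ g p := hg.differentiableAt (hU.mem_nhds hp)
  have h3 : f = fun z => (∏ w ∈ S, (z - w)) * g z := funext hfg
  rw [h3, deriv_fun_mul h1 h2, hgp, Finset.prod_eq_zero hpS (sub_self p)]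
  simp

/-- On |z| = R one has R² = conj(z) z, so the numerator is conj(z - w) z. This Blaschke factor can
replace z - w without changing moduli on the circle. -/
lemma norm_sq_sub_conj_mul {R : ℝ} (hR : 0 < R) {z w : ℂ} (hz : ‖z‖ = R) :
    ‖((R : ℂ) ^ 2 - (starRingEnd ℂ) w * z) / R‖ = ‖z - w‖ := by
  have h1 : (R : ℂ) ^ 2 = (starRingEnd ℂ) z * z := by
    rw [mul_comm, Complex.mul_conj, Complex.normSq_eq_norm_sq, hz]; push_cast; rfl
  rw [h1, ← sub_mul, ← map_sub, norm_div, norm_mul, Complex.norm_conj, hz, Complex.norm_real,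
    Real.norm_eq_abs, abs_of_pos hR, mul_div_assoc, div_self hR.ne', mul_one]

/-- A nonvanishing holomorphic function bounded by `M` is bounded below in a smaller ball. -/
lemma norm_ge_of_ne_zero {h : ℂ → ℂ} {R₁ R₂ M c : ℝ} (h12 : R₁ < R₂) (hR₁ : 0 ≤ R₁)
    (hc : 0 < c) (hcM : c < M) (hh : DifferentiableOn ℂ h (Metric.ball 0 R₂))
    (h0 : ∀ z ∈ Metric.ball (0 : ℂ) R₂, h z ≠ 0)
    (hM : ∀ z ∈ Metric.ball (0 : ℂ) R₂, ‖h z‖ ≤ M) (hch : c ≤ ‖h 0‖) {z : ℂ} (hz : ‖z‖ ≤ R₁) :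
    c * Real.exp (-(2 * R₁ / (R₂ - R₁) * Real.log (M / c))) ≤ ‖h z‖ := by
  have hR₂ : 0 < R₂ := by linarith
  have hB : IsOpen (Metric.ball (0 : ℂ) R₂) := Metric.isOpen_ball
  have h0B : (0 : ℂ) ∈ Metric.ball (0 : ℂ) R₂ := by simpa
  have hzB : z ∈ Metric.ball (0 : ℂ) R₂ := by simp; linarith
  have hq : DifferentiableOn ℂ (fun z => deriv h z / h z) (Metric.ball 0 R₂) :=
    (hh.deriv hB).div hh h0
  -- A primitive L of h'/h with L(0) = 0 satisfies h = h(0) e^L, because h e^(-L) has derivative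
  -- zero.
  obtain ⟨L, hL0, hL⟩ := hq.isExactOn_ball.with_val_at 0 0
  have hLd : DifferentiableOn ℂ L (Metric.ball 0 R₂) :=
    fun w hw => (hL w hw).differentiableAt.differentiableWithinAt
  have hconst : ∀ w ∈ Metric.ball (0 : ℂ) R₂, h w * Complex.exp (-L w) = h 0 := by
    intro w hw
    have hd : ∀ v ∈ Metric.ball (0 : ℂ) R₂,
        HasDerivAt (fun v => h v * Complex.exp (-L v)) 0 v := by
      intro v hv
      have h1 := (hh.differentiableAt (hB.mem_nhds hv)).hasDerivAt
      have h2 := h1.mul (hL v hv).neg.cexp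
      have := h0 v hv
      refine h2.congr_deriv ?_
      field_simp
      ring
    have h3 := (convex_ball (0 : ℂ) R₂).is_const_of_fderivWithin_eq_zero (𝕜 := ℂ)
      (f := fun v => h v * Complex.exp (-L v))
      (fun v hv => (hd v hv).differentiableAt.differentiableWithinAt) (fun v hv => by
        rw [fderivWithin_of_isOpen hB hv]
        ext
        simp [(hd v hv).hasFDerivAt.fderiv]) hw h0B
    simpa [hL0] using h3
  have hexp : ∀ w ∈ Metric.ball (0 : ℂ) R₂, ‖h w‖ = ‖h 0‖ * Real.exp (L w).re := by
    intro w hw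
    rw [← hconst w hw, norm_mul, Complex.norm_exp, mul_assoc, ← Real.exp_add]
    simp
  have hlog : 0 < Real.log (M / c) := Real.log_pos ((one_lt_div hc).2 hcM)
  -- The bounds ‖h‖ ≤ M and ‖h(0)‖ ≥ c turn into Re L ≤ log(M / c), which is what Borel–Carathéodory
  -- requires.
  have hre : Set.MapsTo L (Metric.ball 0 R₂) {z | z.re ≤ Real.log (M / c)} := by
    intro w hw
    have h1 := hM w hw
    rw [hexp w hw] at h1
    simp only [Set.mem_ofPred_eq]
    rw [Real.le_log_iff_exp_le (div_pos (hc.trans hcM) hc), le_div_iff₀ hc]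
    have := Real.exp_pos (L w).re
    nlinarith
  have hBC := Complex.borelCaratheodory_zero hlog hLd hre hR₂ hzB hL0
  have hle : 2 * Real.log (M / c) * ‖z‖ / (R₂ - ‖z‖) ≤
      2 * R₁ / (R₂ - R₁) * Real.log (M / c) := by
    rw [div_mul_eq_mul_div]
    have : 0 < R₂ - R₁ := by linarith
    refine div_le_div₀ (by positivity) ?_ this (by linarith)
    nlinarith
  rw [hexp z hzB]
  refine mul_le_mul hch (Real.exp_le_exp.2 ?_) (by positivity) (norm_nonneg _)
  have := (abs_le.1 ((Complex.abs_re_le_norm (L z)).trans (hBC.trans hle))).1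
  exact this

/-- Number of zeros and lower bound for a holomorphic function with simple zeros in a disc. -/
theorem card_zeros_and_lower_bound {f : ℂ → ℂ} {R₁ R₂ R R' M c : ℝ} (hR₁ : 0 ≤ R₁)
    (h12 : R₁ < R₂) (h2R : R₂ < R) (hRR' : R < R') (hc : 0 < c) (hcM : c < M)
    (hf : DifferentiableOn ℂ f (Metric.ball 0 R')) (hM : ∀ z : ℂ, ‖z‖ = R → ‖f z‖ ≤ M)
    (hcf : c ≤ ‖f 0‖) (S : Finset ℂ)
    (hS : ∀ z : ℂ, z ∈ S ↔ ‖z‖ ≤ R₂ ∧ f z = 0) (hd : ∀ z ∈ S, deriv f z ≠ 0) :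
    (R / R₂) ^ S.card * c ≤ M ∧
    ∀ z : ℂ, ‖z‖ ≤ R₁ →
      c * Real.exp (-(2 * R₁ / (R₂ - R₁) * Real.log (M / c))) *
        ∏ w ∈ S, (‖z - w‖ / (2 * R)) ≤ ‖f z‖ := by
  have hR₂ : 0 < R₂ := by linarith
  have hR : 0 < R := by linarith
  obtain ⟨g, hg, hfg⟩ := exists_eq_prod_sub_mul Metric.isOpen_ball S hf
    (fun w hw => by have := ((hS w).1 hw).1; simp; linarith) (fun w hw => ((hS w).1 hw).2)
  -- With the zeros replaced by Blaschke factors, |h| = |f| on |z| = R, so ‖h‖ ≤ M inside by the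
  -- maximum principle, and h has no zero in |z| < R₂. At 0 each replaced factor gains at least R /
  -- R₂, which is Jensen's bound on their number.
  set h : ℂ → ℂ := fun z => g z * ∏ w ∈ S, (((R : ℂ) ^ 2 - (starRingEnd ℂ) w * z) / R) with hh
  have hhd : DifferentiableOn ℂ h (Metric.ball 0 R') := by
    refine hg.mul ?_
    fun_prop
  have hsph : ∀ z : ℂ, ‖z‖ = R → ‖h z‖ ≤ M := by
    intro z hz
    refine le_trans (le_of_eq ?_) (hM z hz)
    rw [hfg, hh]
    simp only [norm_mul, norm_prod]
    rw [Finset.prod_congr rfl fun w _ => norm_sq_sub_conj_mul hR hz, mul_comm]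
  have hball : ∀ z : ℂ, ‖z‖ ≤ R → ‖h z‖ ≤ M := by
    intro z hz
    refine Complex.norm_le_of_forall_mem_frontier_norm_le (U := Metric.ball 0 R)
      Metric.isBounded_ball ⟨hhd.mono (Metric.ball_subset_ball hRR'.le), ?_⟩ (fun w hw => ?_) ?_
    · rw [closure_ball _ hR.ne']
      exact (hhd.mono (Metric.closedBall_subset_ball hRR')).continuousOn
    · rw [frontier_ball _ hR.ne'] at hw
      exact hsph w (by simpa using hw)
    · rw [closure_ball _ hR.ne']; simpa
  have hne : ∀ z ∈ Metric.ball (0 : ℂ) R₂, h z ≠ 0 := by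
    intro z hz
    have hz' : ‖z‖ < R₂ := by simpa using hz
    refine mul_ne_zero (ne_zero_of_eq_prod_sub_mul Metric.isOpen_ball hg hfg
      (by simp; linarith) fun h0 => ?_) ?_
    · have : z ∈ S := (hS z).2 ⟨hz'.le, h0⟩
      exact ⟨this, hd z this⟩
    · refine Finset.prod_ne_zero_iff.2 fun w hw => div_ne_zero (fun h0 => ?_) (by
        exact_mod_cast hR.ne')
      have hw' := ((hS w).1 hw).1
      have h1 : ‖(R : ℂ) ^ 2‖ = ‖w‖ * ‖z‖ := by
        rw [sub_eq_zero.1 h0, norm_mul, Complex.norm_conj]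
      simp only [norm_pow, Complex.norm_real, Real.norm_eq_abs, sq_abs] at h1
      nlinarith [norm_nonneg w, norm_nonneg z]
  have hh0 : (R / R₂) ^ S.card * c ≤ ‖h 0‖ := by
    have h1 : ‖f 0‖ ≤ R₂ ^ S.card * ‖g 0‖ := by
      rw [hfg 0, norm_mul, norm_prod]
      refine mul_le_mul_of_nonneg_right ?_ (norm_nonneg _)
      rw [← Finset.prod_const]
      refine Finset.prod_le_prod (fun _ _ => norm_nonneg _) fun w hw => ?_
      simpa using ((hS w).1 hw).1
    have h2 : ‖h 0‖ = ‖g 0‖ * R ^ S.card := by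
      simp only [hh, mul_zero, sub_zero, norm_mul, norm_div, norm_pow,
        Complex.norm_real, Real.norm_eq_abs, abs_of_pos hR, Finset.prod_const]
      rw [pow_two, mul_div_assoc, div_self hR.ne', mul_one]
    rw [h2, div_pow, div_mul_eq_mul_div, div_le_iff₀ (by positivity)]
    have := hcf.trans h1
    have hp : 0 < R ^ S.card := by positivity
    nlinarith
  refine ⟨hh0.trans (hball 0 (by simpa using hR.le)), fun z hz => ?_⟩
  have hone : 1 ≤ (R / R₂) ^ S.card := one_le_pow₀ ((one_le_div hR₂).2 h2R.le)
  have hlow := norm_ge_of_ne_zero h12 hR₁ hc hcM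
    (hhd.mono (Metric.ball_subset_ball (by linarith))) hne
    (fun z hz => hball z (by have : ‖z‖ < R₂ := by simpa using hz
                             linarith)) (by nlinarith) hz
  have hfz : ‖h z‖ * ∏ w ∈ S, (‖z - w‖ / (2 * R)) ≤ ‖f z‖ := by
    rw [hfg z, hh]
    simp only [norm_mul, norm_prod]
    rw [mul_assoc, mul_comm (∏ w ∈ S, ‖z - w‖), ← Finset.prod_mul_distrib]
    refine mul_le_mul_of_nonneg_left ?_ (norm_nonneg _)
    refine Finset.prod_le_prod (fun _ _ => by positivity) fun w hw => ?_
    have hw' := ((hS w).1 hw).1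
    have h1 : ‖((R : ℂ) ^ 2 - (starRingEnd ℂ) w * z) / R‖ ≤ 2 * R := by
      rw [norm_div, Complex.norm_real, Real.norm_eq_abs, abs_of_pos hR, div_le_iff₀ hR]
      refine (norm_sub_le _ _).trans ?_
      simp only [norm_pow, Complex.norm_real, Real.norm_eq_abs, sq_abs, norm_mul,
        Complex.norm_conj]
      nlinarith [norm_nonneg w, norm_nonneg z]
    rw [mul_div_assoc', div_le_iff₀ (by positivity), mul_comm]
    gcongr
  refine le_trans ?_ hfz
  gcongr

/-! ### Analyticity, functional equation and bounds for ζ and 1/ζ -/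

/-- `riemannZeta₁` is entire and equals (s - 1) ζ(s) off s = 1. The formula has no exceptional
points: at a zero of ζ both sides are 0 by the convention on division. It shows that 1/ζ is
holomorphic at 1. -/
lemma zetaRecip_eq_div (s : ℂ) : zetaRecip s = (s - 1) / riemannZeta₁ s := by
  by_cases hs : s = 1
  · simp [zetaRecip, hs]
  · rw [zetaRecip, if_neg hs, riemannZeta_eq_inv_sub_mul hs, one_div, mul_inv, inv_inv,
      div_eq_mul_inv]

lemma riemannZeta₁_ne_zero {s : ℂ} (hs : s = 1 ∨ riemannZeta s ≠ 0) : riemannZeta₁ s ≠ 0 := by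
  by_cases h1 : s = 1
  · simp [h1]
  · have h := hs.resolve_left h1
    rw [riemannZeta_eq_inv_sub_mul h1] at h
    exact right_ne_zero_of_mul h

lemma differentiableAt_zetaRecip {s : ℂ} (hs : s = 1 ∨ riemannZeta s ≠ 0) :
    DifferentiableAt ℂ zetaRecip s := by
  have h : zetaRecip = fun s => (s - 1) / riemannZeta₁ s := funext zetaRecip_eq_div
  rw [h]
  have := riemannZeta₁_ne_zero hs
  fun_prop (disch := assumption)

lemma differentiableAt_zetaRecip_of_one_le_re {s : ℂ} (hs : 1 ≤ s.re) :
    DifferentiableAt ℂ zetaRecip s :=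
  differentiableAt_zetaRecip (Or.inr (riemannZeta_ne_zero_of_one_le_re hs))

lemma zetaRecip_functional_equation {w : ℂ} (hw : ∀ n : ℕ, w ≠ -n) (hw1 : w ≠ 1)
    (hc : Complex.cos (Real.pi * w / 2) ≠ 0) :
    zetaRecip w = 2 * (2 * Real.pi : ℂ) ^ (-w) * Complex.cos (Real.pi * w / 2) *
      Complex.Gamma w * zetaRecip (1 - w) := by
  have h := riemannZeta_one_sub hw hw1
  have hw0 : w ≠ 0 := by simpa using hw 0
  have h1 : 1 - w ≠ 1 := by simpa using hw0
  have hpi : (2 * Real.pi : ℂ) ≠ 0 := by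
    exact_mod_cast (by positivity : (2 * Real.pi : ℝ) ≠ 0)
  have hp : (2 * Real.pi : ℂ) ^ (-w) ≠ 0 := by simp [Complex.cpow_eq_zero_iff, hpi]
  have hG := Complex.Gamma_ne_zero hw
  rw [zetaRecip, if_neg hw1, zetaRecip, if_neg h1, h]
  -- At a zero of ζ both sides are 0 by the convention 1 / 0 = 0.
  by_cases hz : riemannZeta w = 0
  · simp [hz]
  · field_simp

/-- The integral `∫_1^∞ {t} t^{-s-1} dt`. -/
def fractMellin (s : ℂ) : ℂ :=
  mellin (Set.indicator (Set.Ioi 1) fun t : ℝ => ((Int.fract t : ℝ) : ℂ)) (-s)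

lemma fractMellin_eq (s : ℂ) :
    fractMellin s = ∫ t in Set.Ioi (1 : ℝ), ((Int.fract t : ℝ) : ℂ) * (t : ℂ) ^ (-(s + 1)) := by
  have h : ∀ t : ℝ, (t : ℂ) ^ (-s - 1) •
      Set.indicator (Set.Ioi 1) (fun t : ℝ => ((Int.fract t : ℝ) : ℂ)) t =
      Set.indicator (Set.Ioi 1) (fun t : ℝ => ((Int.fract t : ℝ) : ℂ) * (t : ℂ) ^ (-(s + 1))) t := by
    intro t
    by_cases ht : t ∈ Set.Ioi (1 : ℝ)
    · rw [Set.indicator_of_mem ht, Set.indicator_of_mem ht, smul_eq_mul, mul_comm,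
        show -(s + 1) = -s - 1 by ring]
    · rw [Set.indicator_of_notMem ht, Set.indicator_of_notMem ht, smul_zero]
  rw [fractMellin, mellin]
  simp_rw [h]
  rw [MeasureTheory.setIntegral_indicator measurableSet_Ioi]
  congr 2
  ext t
  simp only [Set.mem_inter_iff, Set.mem_Ioi]
  constructor
  · exact fun h => h.2
  · exact fun h => ⟨by linarith, h⟩

lemma norm_fract_le (t : ℝ) : ‖((Int.fract t : ℝ) : ℂ)‖ ≤ 1 := by
  rw [Complex.norm_real, Real.norm_eq_abs, abs_of_nonneg (Int.fract_nonneg t)]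
  exact (Int.fract_lt_one t).le

lemma norm_fractMellin_le {s : ℂ} (hs : 0 < s.re) : ‖fractMellin s‖ ≤ 1 / s.re := by
  rw [fractMellin_eq]
  have h1 : ∫ t in Set.Ioi (1 : ℝ), t ^ (-s.re - 1) = 1 / s.re := by
    rw [integral_Ioi_rpow_of_lt (by linarith) one_pos]
    simp
  rw [← h1]
  refine MeasureTheory.norm_integral_le_of_norm_le
    (integrableOn_Ioi_rpow_of_lt (by linarith) one_pos) ?_
  filter_upwards [MeasureTheory.self_mem_ae_restrict measurableSet_Ioi] with t ht
  have ht0 : 0 < t := lt_trans one_pos ht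
  rw [norm_mul, Complex.norm_cpow_eq_rpow_re_of_pos ht0]
  have hre : (-(s + 1)).re = -s.re - 1 := by simp; ring
  rw [hre]
  exact mul_le_of_le_one_left (Real.rpow_nonneg ht0.le _) (norm_fract_le t)

/-- The integral is a Mellin transform of a bounded function that vanishes on (0, 1], hence
holomorphic in the half-plane. -/
lemma differentiableAt_fractMellin {s : ℂ} (hs : 0 < s.re) : DifferentiableAt ℂ fractMellin s := by
  have hm : Measurable (Set.indicator (Set.Ioi 1) fun t : ℝ => ((Int.fract t : ℝ) : ℂ)) :=
    (Complex.measurable_ofReal.comp measurable_fract).indicator measurableSet_Ioi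
  have hb : ∀ t : ℝ, ‖Set.indicator (Set.Ioi 1) (fun t : ℝ => ((Int.fract t : ℝ) : ℂ)) t‖ ≤ 1 := by
    intro t
    refine (norm_indicator_le_norm_self _ _).trans ?_
    exact norm_fract_le t
  have h : DifferentiableAt ℂ
      (mellin (Set.indicator (Set.Ioi 1) fun t : ℝ => ((Int.fract t : ℝ) : ℂ))) (-s) := by
    refine mellin_differentiableAt_of_isBigO_rpow (a := 0) (b := -s.re - 1) ?_ ?_ ?_ ?_ ?_
    · refine (MeasureTheory.LocallyIntegrable.mono (MeasureTheory.locallyIntegrable_const (1 : ℝ))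
        hm.aestronglyMeasurable ?_).locallyIntegrableOn _
      exact Eventually.of_forall fun t => by simpa using hb t
    · refine Asymptotics.IsBigO.of_bound 1 (Eventually.of_forall fun t => ?_)
      simpa using hb t
    · simpa using hs
    · refine Asymptotics.IsBigO.of_bound 1 ?_
      have : Set.Iio (1 : ℝ) ∈ 𝓝[>] (0 : ℝ) :=
        nhdsWithin_le_nhds (Iio_mem_nhds one_pos)
      filter_upwards [this] with t ht
      rw [Set.indicator_of_notMem (by simpa using (Set.mem_Iio.1 ht).le)]
      simp
    · simp
  exact h.comp s (differentiableAt_id.neg)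

lemma riemannZeta₁_eq_of_one_lt_re {s : ℂ} (hs : 1 < s.re) :
    riemannZeta₁ s = s - s * (s - 1) * fractMellin s := by
  have hs1 : s ≠ 1 := by rintro rfl; simp at hs
  have hs1' : s - 1 ≠ 0 := sub_ne_zero.2 hs1
  have h0 : riemannZeta s = s * ∫ t in Set.Ioi (1 : ℝ),
      (∑ k ∈ Finset.Icc 1 ⌊t⌋₊, (1 : ℕ → ℂ) k) * (t : ℂ) ^ (-(s + 1)) := by
    rw [← LSeries_one_eq_riemannZeta hs]
    refine LSeries_eq_mul_integral _ (r := 1) zero_le_one (by simpa using hs)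
      (LSeriesSummable_one_iff.2 hs) ?_
    refine Asymptotics.IsBigO.of_bound 1 (Eventually.of_forall fun n => ?_)
    simp
  have hint : MeasureTheory.IntegrableOn (fun t : ℝ => (t : ℂ) ^ (-s)) (Set.Ioi 1) :=
    integrableOn_Ioi_cpow_of_lt (by simpa using hs) one_pos
  have hfr : MeasureTheory.IntegrableOn
      (fun t : ℝ => ((Int.fract t : ℝ) : ℂ) * (t : ℂ) ^ (-(s + 1))) (Set.Ioi 1) := by
    refine MeasureTheory.Integrable.bdd_mul (c := 1) ?_ ?_ ?_
    · exact integrableOn_Ioi_cpow_of_lt (by simp; linarith) one_pos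
    · exact (Complex.measurable_ofReal.comp measurable_fract).aestronglyMeasurable
    · exact Eventually.of_forall norm_fract_le
  have h1 : ∫ t in Set.Ioi (1 : ℝ),
      (∑ k ∈ Finset.Icc 1 ⌊t⌋₊, (1 : ℕ → ℂ) k) * (t : ℂ) ^ (-(s + 1)) =
      1 / (s - 1) - fractMellin s := by
    have h2 : ∫ t in Set.Ioi (1 : ℝ), (t : ℂ) ^ (-s) = 1 / (s - 1) := by
      rw [integral_Ioi_cpow_of_lt (by simpa using hs) one_pos]
      simp only [Complex.ofReal_one, Complex.one_cpow]
      rw [neg_div, ← div_neg]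
      congr 1
      ring
    rw [fractMellin_eq, ← h2, ← MeasureTheory.integral_sub hint hfr]
    refine MeasureTheory.setIntegral_congr_fun measurableSet_Ioi fun t ht => ?_
    have ht0 : (0 : ℝ) < t := lt_trans one_pos ht
    have ht' : (t : ℂ) ≠ 0 := by exact_mod_cast ht0.ne'
    have h3 : (t : ℂ) ^ (-s) = t * (t : ℂ) ^ (-(s + 1)) := by
      rw [show -s = 1 + -(s + 1) by ring, Complex.cpow_add _ _ ht', Complex.cpow_one]
    have h4 : ((⌊t⌋₊ : ℝ) : ℂ) = (t : ℂ) - ((Int.fract t : ℝ) : ℂ) := by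
      rw [← Complex.ofReal_sub, Int.self_sub_fract, ← natCast_floor_eq_intCast_floor ht0.le]
    simp only [Pi.one_apply, Finset.sum_const, Nat.card_Icc, add_tsub_cancel_right, nsmul_eq_mul,
      mul_one]
    rw [h3, ← sub_mul, ← h4]
    simp
  have h5 := riemannZeta_eq_inv_sub_mul hs1
  rw [h0, h1] at h5
  field_simp at h5
  linear_combination -h5

/-- Abel summation proves the formula for Re s > 1, and both sides are holomorphic on Re s > 0. -/
lemma riemannZeta₁_eq {s : ℂ} (hs : 0 < s.re) :
    riemannZeta₁ s = s - s * (s - 1) * fractMellin s := by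
  have hU : IsOpen {s : ℂ | 0 < s.re} := isOpen_lt continuous_const Complex.continuous_re
  have hf : AnalyticOnNhd ℂ riemannZeta₁ {s : ℂ | 0 < s.re} :=
    (differentiable_riemannZeta₁.differentiableOn).analyticOnNhd hU
  have hg : AnalyticOnNhd ℂ (fun s => s - s * (s - 1) * fractMellin s) {s : ℂ | 0 < s.re} := by
    refine DifferentiableOn.analyticOnNhd (fun w hw => ?_) hU
    have := differentiableAt_fractMellin hw
    exact DifferentiableAt.differentiableWithinAt (by fun_prop)
  refine hf.eqOn_of_preconnected_of_eventuallyEq hg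
    (convex_halfSpace_re_gt 0).isPreconnected (z₀ := 2) (by simp) ?_ hs
  have : {s : ℂ | 1 < s.re} ∈ 𝓝 (2 : ℂ) :=
    (isOpen_lt continuous_const Complex.continuous_re).mem_nhds (by simp)
  filter_upwards [this] with w hw
  exact riemannZeta₁_eq_of_one_lt_re hw

/-- Polynomial growth is all that is needed. The abscissa 1/5 = 2 - 9/5 is the left edge of the
discs of radius 9/5 around 2 + it. -/
lemma norm_riemannZeta_le {s : ℂ} (hs : 1 / 5 ≤ s.re) (him : 1 ≤ |s.im|) :
    ‖riemannZeta s‖ ≤ 6 * ‖s‖ := by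
  have h1 : 1 ≤ ‖s - 1‖ := by
    have := Complex.abs_im_le_norm (s - 1)
    simp at this
    linarith
  have hs1 : s - 1 ≠ 0 := by
    intro h; rw [h, norm_zero] at h1; linarith
  have h0 : 0 < s.re := by linarith
  have h2 : riemannZeta s = s / (s - 1) - s * fractMellin s := by
    rw [riemannZeta_eq_inv_sub_mul (sub_ne_zero.1 hs1), riemannZeta₁_eq h0]
    field_simp
  have h3 : ‖fractMellin s‖ ≤ 5 := by
    refine (norm_fractMellin_le h0).trans ?_
    rw [div_le_iff₀ h0]
    linarith
  rw [h2]
  refine (norm_sub_le _ _).trans ?_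
  rw [norm_div, norm_mul]
  have h4 : ‖s‖ / ‖s - 1‖ ≤ ‖s‖ := div_le_self (norm_nonneg _) h1
  nlinarith [norm_nonneg s]

lemma exists_norm_zetaRecip_le :
    ∃ C : ℝ, 1 ≤ C ∧ ∀ s : ℂ, 3 / 2 ≤ s.re → ‖zetaRecip s‖ ≤ C := by
  have hsum : Summable fun n : ℕ => 1 / (n : ℝ) ^ (3 / 2 : ℝ) :=
    Real.summable_one_div_nat_rpow.2 (by norm_num)
  refine ⟨max 1 (∑' n : ℕ, 1 / (n : ℝ) ^ (3 / 2 : ℝ)), le_max_left _ _, fun s hs => ?_⟩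
  have hs1 : 1 < s.re := by linarith
  have h1 := ArithmeticFunction.LSeries_zeta_mul_Lseries_moebius hs1
  rw [ArithmeticFunction.LSeries_zeta_eq_riemannZeta hs1] at h1
  have hne : s ≠ 1 := by rintro rfl; simp at hs1
  have h2 : zetaRecip s = LSeries (fun n => ((ArithmeticFunction.moebius n : ℤ) : ℂ)) s := by
    rw [zetaRecip, if_neg hne]
    exact (eq_one_div_of_mul_eq_one_right h1).symm
  rw [h2]
  refine le_trans ?_ (le_max_right _ _)
  rw [LSeries]
  refine tsum_of_norm_bounded hsum.hasSum fun n => ?_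
  rcases Nat.eq_zero_or_pos n with rfl | hn
  · simp
  · rw [LSeries.norm_term_eq, if_neg hn.ne']
    have h3 : (1 : ℝ) ≤ n := by exact_mod_cast hn
    refine div_le_div₀ zero_le_one ?_ (by positivity)
      (Real.rpow_le_rpow_of_exponent_le h3 hs)
    rw [Complex.norm_intCast]
    exact_mod_cast ArithmeticFunction.abs_moebius_le_one

lemma mem_zetaZeros_of_zero {ρ : ℂ} (h : riemannZeta ρ = 0) (h0 : 0 < ρ.re) : ρ ∈ zetaZeros := by
  refine ⟨h, h0, ?_⟩
  by_contra h1
  exact riemannZeta_ne_zero_of_one_le_re (not_lt.1 h1) h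

lemma conj_mem_zetaZeros {ρ : ℂ} (h : ρ ∈ zetaZeros) : (starRingEnd ℂ) ρ ∈ zetaZeros := by
  refine ⟨?_, by simpa using h.2.1, by simpa using h.2.2⟩
  rw [riemannZeta_conj, h.1, map_zero]

lemma one_sub_mem_zetaZeros {ρ : ℂ} (h : ρ ∈ zetaZeros) : 1 - ρ ∈ zetaZeros := by
  refine ⟨?_, by simpa using h.2.2, by simpa using h.2.1⟩
  rw [riemannZeta_one_sub (fun n hn => ?_) (fun h1 => ?_), h.1, mul_zero]
  · have := h.2.1
    rw [hn] at this
    simp at this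
    linarith [(Nat.cast_nonneg n : (0 : ℝ) ≤ n)]
  · have := h.2.2
    rw [h1] at this
    simp at this

/-! ### Local zeros of ζ and a lower bound in terms of them -/

lemma finite_zeros_closedBall (c : ℂ) (R : ℝ) :
    {ρ : ℂ | ‖ρ - c‖ ≤ R ∧ riemannZeta ρ = 0}.Finite := by
  refine ((isCompact_closedBall c R).inter_riemannZetaZeros_finite).subset fun ρ hρ => ⟨?_, hρ.2⟩
  simpa [dist_eq_norm] using hρ.1

/-- The zeros of `ζ` in the disc of radius `8 / 5` around `2 + i t`. -/
def localZeros (t : ℝ) : Finset ℂ := (finite_zeros_closedBall (2 + t * Complex.I) (8 / 5)).toFinset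

lemma mem_localZeros {t : ℝ} {ρ : ℂ} :
    ρ ∈ localZeros t ↔ ‖ρ - (2 + t * Complex.I)‖ ≤ 8 / 5 ∧ riemannZeta ρ = 0 := by
  simp [localZeros]

lemma abs_im_sub_le_of_mem_localZeros {t : ℝ} {ρ : ℂ} (h : ρ ∈ localZeros t) :
    |ρ.im - t| ≤ 8 / 5 := by
  have h1 := (mem_localZeros.1 h).1
  have := Complex.abs_im_le_norm (ρ - (2 + t * Complex.I))
  simp at this
  linarith

lemma localZeros_subset {t : ℝ} {ρ : ℂ} (h : ρ ∈ localZeros t) : ρ ∈ zetaZeros := by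
  have h1 := (mem_localZeros.1 h).1
  have := Complex.abs_re_le_norm (ρ - (2 + t * Complex.I))
  simp at this
  exact mem_zetaZeros_of_zero (mem_localZeros.1 h).2 (by linarith [(abs_le.1 this).1])

/-- The local count of zeros and a lower bound for `|ζ|` in terms of the nearby zeros. -/
theorem exists_card_localZeros_and_lower_bound
    (hsimple : ∀ ρ ∈ zetaZeros, deriv riemannZeta ρ ≠ 0) :
    ∃ C : ℝ, 0 < C ∧ ∀ t : ℝ, 4 ≤ |t| →
      ((localZeros t).card : ℝ) ≤ C * Real.log |t| ∧
      ∀ u : ℝ, 1 / 2 ≤ u → u ≤ 2 →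
        Real.exp (-(C * Real.log |t|)) *
          ∏ ρ ∈ localZeros t, (‖u + t * Complex.I - ρ‖ / (17 / 5)) ≤
            ‖riemannZeta (u + t * Complex.I)‖ := by
  obtain ⟨B, hB1, hB⟩ := exists_norm_zetaRecip_le
  set K : ℝ := Real.log (18 * B) + 1 with hK
  have hlogB : 0 < Real.log (18 * B) := Real.log_pos (by linarith)
  have hlogr : 0 < Real.log ((17 / 10) / (8 / 5) : ℝ) := Real.log_pos (by norm_num)
  have hBpos : 0 < B := by linarith
  -- The exponent 2 R₁ / (R₂ - R₁) equals 30 for R₁ = 3/2, R₂ = 8/5, which 31 K covers. The second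
  -- summand bounds the number of zeros, and B pays for exp(-B) ≤ 1 / B.
  refine ⟨31 * K + K / Real.log ((17 / 10) / (8 / 5)) + B, by positivity, fun t ht => ?_⟩
  have ht1 : 1 ≤ Real.log |t| := by
    rw [Real.le_log_iff_exp_le (by linarith)]
    linarith [Real.exp_one_lt_d9]
  have ht0 : 0 < |t| := by linarith
  set c : ℂ := 2 + t * Complex.I with hc
  have hcz : riemannZeta c ≠ 0 := riemannZeta_ne_zero_of_one_le_re (by simp [hc])
  have hc1 : c ≠ 1 := by
    intro h
    have : c.re = 2 := by simp [hc]
    rw [h] at this; simp at this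
  have hcf : 1 / B ≤ ‖riemannZeta (c + 0)‖ := by
    have h1 := hB c (by simp [hc]; norm_num)
    rw [zetaRecip, if_neg hc1, norm_div, norm_one, div_le_iff₀ (norm_pos_iff.2 hcz)] at h1
    rw [add_zero, div_le_iff₀ hBpos]
    linarith
  have him : ∀ z : ℂ, ‖z‖ < 9 / 5 → 1 ≤ |(c + z).im| ∧ 1 / 5 ≤ (c + z).re ∧
      ‖c + z‖ ≤ 3 * |t| := by
    intro z hz
    have h1 := (Complex.abs_im_le_norm z).trans_lt hz
    have h2 := (Complex.abs_re_le_norm z).trans_lt hz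
    have h3 : (c + z).im = t + z.im := by simp [hc]
    have h4 : (c + z).re = 2 + z.re := by simp [hc]
    refine ⟨?_, ?_, ?_⟩
    · rw [h3]
      have := abs_sub_abs_le_abs_sub t (-z.im)
      rw [abs_neg, sub_neg_eq_add] at this
      linarith
    · rw [h4]; linarith [(abs_lt.1 h2).1]
    · refine (norm_add_le _ _).trans ?_
      have : ‖c‖ ≤ 2 + |t| := by
        refine (norm_add_le _ _).trans ?_
        simp
      linarith
  have hne1 : ∀ z : ℂ, ‖z‖ < 9 / 5 → c + z ≠ 1 := by
    intro z hz h
    have := (him z hz).1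
    rw [h] at this
    simp at this
    linarith
  have hdiff : ∀ z : ℂ, ‖z‖ < 9 / 5 → DifferentiableAt ℂ (fun z => riemannZeta (c + z)) z :=
    fun z hz => DifferentiableAt.comp (g := riemannZeta) z
      (differentiableAt_riemannZeta (hne1 z hz)) (by fun_prop)
  set S : Finset ℂ := (localZeros t).image (fun ρ => ρ - c) with hS
  have hSmem : ∀ z : ℂ, z ∈ S ↔ ‖z‖ ≤ 8 / 5 ∧ riemannZeta (c + z) = 0 := by
    intro z
    simp only [hS, Finset.mem_image, mem_localZeros]
    constructor
    · rintro ⟨ρ, ⟨h1, h2⟩, rfl⟩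
      exact ⟨h1, by simpa using h2⟩
    · rintro ⟨h1, h2⟩
      exact ⟨c + z, ⟨by simpa [hc] using h1, h2⟩, by ring⟩
  have hinj : Set.InjOn (fun ρ : ℂ => ρ - c) (localZeros t) := fun _ _ _ _ h => by simpa using h
  have hcard : S.card = (localZeros t).card := Finset.card_image_of_injOn hinj
  have hM : 1 / B < 18 * |t| := by
    rw [div_lt_iff₀ hBpos]; nlinarith
  -- Around 2 + it, radius 3/2 reaches the critical line, 8/5 collects the zeros, 17/10 carries the
  -- maximum principle, and 9/5 keeps Re s > 1/5. The bound 18 |t| is 6 ‖s‖ with ‖s‖ ≤ 3 |t|.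
  obtain ⟨h1, h2⟩ := card_zeros_and_lower_bound (f := fun z => riemannZeta (c + z))
    (R₁ := 3 / 2) (R₂ := 8 / 5) (R := 17 / 10) (R' := 9 / 5) (M := 18 * |t|) (c := 1 / B)
    (by norm_num) (by norm_num) (by norm_num) (by norm_num) (by positivity) hM
    (fun z hz => (hdiff z (by simpa using hz)).differentiableWithinAt)
    (fun z hz => by
      obtain ⟨a1, a2, a3⟩ := him z (by rw [hz]; norm_num)
      refine (norm_riemannZeta_le a2 a1).trans ?_
      linarith)
    hcf S hSmem (fun z hz => by
      have h3 : c + z ∈ zetaZeros := by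
        obtain ⟨ρ, hρ, rfl⟩ := Finset.mem_image.1 hz
        simpa using localZeros_subset hρ
      rw [deriv_comp_const_add]
      exact hsimple _ h3)
  have hMc : Real.log (18 * |t| / (1 / B)) ≤ K * Real.log |t| := by
    rw [show 18 * |t| / (1 / B) = (18 * B) * |t| by field_simp,
      Real.log_mul (by positivity) (by positivity), hK]
    nlinarith
  have hKpos : 0 < K := by positivity
  have hq : 0 ≤ K / Real.log ((17 / 10) / (8 / 5)) := by positivity
  constructor
  · rw [hcard] at h1
    have h3 : ((17 / 10) / (8 / 5) : ℝ) ^ (localZeros t).card ≤ 18 * |t| / (1 / B) := by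
      rw [le_div_iff₀ (by positivity)]; exact h1
    have h4 := Real.log_le_log (by positivity) h3
    rw [Real.log_pow] at h4
    have h5 : ((localZeros t).card : ℝ) ≤
        K / Real.log ((17 / 10) / (8 / 5)) * Real.log |t| := by
      rw [div_mul_eq_mul_div, le_div_iff₀ hlogr]
      linarith
    refine h5.trans ?_
    nlinarith
  · intro u hu hu2
    have h3 := h2 (u - 2 : ℝ) (by
      rw [Complex.norm_real, Real.norm_eq_abs, abs_le]; constructor <;> linarith)
    have e1 : c + ((u - 2 : ℝ) : ℂ) = u + t * Complex.I := by simp [hc]; ring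
    rw [e1, hS, Finset.prod_image hinj] at h3
    have e2 : ∀ ρ : ℂ, ((u - 2 : ℝ) : ℂ) - (ρ - c) = u + t * Complex.I - ρ := by
      intro ρ; rw [← e1]; ring
    simp_rw [e2] at h3
    refine le_trans ?_ h3
    rw [show (2 * (17 / 10) : ℝ) = 17 / 5 by norm_num]
    refine mul_le_mul_of_nonneg_right ?_ (Finset.prod_nonneg fun _ _ => by positivity)
    have h6 : Real.exp (-B) ≤ 1 / B := by
      rw [Real.exp_neg, ← one_div]
      exact one_div_le_one_div_of_le hBpos (by linarith [Real.add_one_le_exp B])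
    refine le_trans ?_ (mul_le_mul_of_nonneg_right h6 (Real.exp_pos _).le)
    rw [← Real.exp_add]
    refine Real.exp_le_exp.2 ?_
    rw [show (2 * (3 / 2) / (8 / 5 - 3 / 2) : ℝ) = 30 by norm_num]
    have h7 : 0 ≤ K * (Real.log |t|) := by positivity
    have h8 : B * 1 ≤ B * Real.log |t| := by gcongr
    have h9 : 0 ≤ K / Real.log ((17 / 10) / (8 / 5)) * Real.log |t| := by positivity
    linarith

/-! ### Heights that keep away from all ordinates of zeros -/

/-- Heights at distance at least `bracketWidth A ρ` from the ordinate of every zero `ρ`. -/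
def uncovered (A : ℝ) : Set ℝ := {t | ∀ ρ ∈ zetaZeros, bracketWidth A ρ ≤ |t - ρ.im|}

lemma neg_mem_uncovered {A t : ℝ} (ht : t ∈ uncovered A) : -t ∈ uncovered A := by
  intro ρ hρ
  have h := ht _ (conj_mem_zetaZeros hρ)
  have e : bracketWidth A ((starRingEnd ℂ) ρ) = bracketWidth A ρ := by
    simp [bracketWidth]
  rw [e] at h
  rw [show -t - ρ.im = -(t - ((starRingEnd ℂ) ρ).im) by simp; ring, abs_neg]
  exact h

/-- Replacing Im ρ by t costs a factor 4 in the exponent: 2 from |Im ρ| ≤ 2 |t| and 2 from log|Im ρ|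
≥ (log|t|) / 2. -/
lemma bracketWidth_ge {A t : ℝ} (hA : 0 < A) (ht : 20 ≤ |t|) {ρ : ℂ} (hρ : |ρ.im - t| ≤ 8 / 5) :
    Real.exp (-(4 * A * |t| / Real.log |t|)) ≤ bracketWidth A ρ := by
  have h1 : |ρ.im| ≤ 2 * |t| := by
    have := abs_sub_abs_le_abs_sub ρ.im t
    linarith
  have h2 : |t| - 2 ≤ |ρ.im| := by
    have := abs_sub_abs_le_abs_sub t ρ.im
    rw [abs_sub_comm] at this
    linarith
  have hlogt : 0 < Real.log |t| := Real.log_pos (by linarith)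
  have h3 : Real.log |t| / 2 ≤ Real.log |ρ.im| := by
    have h4 : Real.log |t| ≤ Real.log (|ρ.im| ^ 2) := by
      refine Real.log_le_log (by linarith) ?_
      nlinarith
    rw [Real.log_pow] at h4
    push_cast at h4
    linarith
  rw [bracketWidth, neg_div]
  refine Real.exp_le_exp.2 (neg_le_neg ?_)
  rw [div_le_div_iff₀ (by linarith) hlogt]
  have h5 : 0 ≤ A * |t| := by positivity
  calc A * |ρ.im| * Real.log |t| ≤ A * (2 * |t|) * Real.log |t| := by gcongr
    _ = 4 * A * |t| * (Real.log |t| / 2) := by ring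
    _ ≤ _ := by gcongr

lemma exists_log_le (C : ℝ) {ε : ℝ} (hε : 0 < ε) :
    ∃ T : ℝ, ∀ t : ℝ, T ≤ |t| → C * Real.log |t| ≤ ε * |t| := by
  have h := (Real.isLittleO_log_id_atTop.const_mul_left C).def hε
  obtain ⟨T, hT⟩ := eventually_atTop.1 h
  refine ⟨T, fun t ht => ?_⟩
  have h1 := hT |t| ht
  simp only [id, Real.norm_eq_abs, abs_abs] at h1
  exact (le_abs_self _).trans h1

/-- On uncovered heights, `ζ` is bounded below by `e^{-|t|/4}` if the constant is small. -/
theorem exists_riemannZeta_lower_bound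
    (hsimple : ∀ ρ ∈ zetaZeros, deriv riemannZeta ρ ≠ 0) :
    ∃ A T : ℝ, 0 < A ∧ 1 ≤ T ∧ ∀ t ∈ uncovered A, T ≤ |t| → ∀ u : ℝ, 1 / 2 ≤ u → u ≤ 2 →
      Real.exp (-(|t| / 4)) ≤ ‖riemannZeta (u + t * Complex.I)‖ := by
  obtain ⟨C, hC, h⟩ := exists_card_localZeros_and_lower_bound hsimple
  obtain ⟨T, hT⟩ := exists_log_le (3 * C) (ε := 1 / 8) (by norm_num)
  -- There are at most C log|t| nearby zeros, each at distance at least exp(-4A|t| / log|t|). With A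
  -- = 1 / (32 C) these distances multiply to at least e^(-|t|/8); the remaining loss exp(-3C
  -- log|t|) is at least e^(-|t|/8) for |t| ≥ T.
  refine ⟨1 / (32 * C), max 20 T, by positivity, by norm_num, fun t ht hTt u hu hu2 => ?_⟩
  have ht20 : 20 ≤ |t| := (le_max_left _ _).trans hTt
  have htT := hT t ((le_max_right _ _).trans hTt)
  obtain ⟨h1, h2⟩ := h t (by linarith)
  refine le_trans ?_ (h2 u hu hu2)
  have hlogt : 0 < Real.log |t| := Real.log_pos (by linarith)
  set A := 1 / (32 * C) with hA
  have hApos : 0 < A := by positivity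
  -- The summand 2 absorbs the normalisation by 17/5, since 17/5 ≤ e².
  set e : ℝ := 4 * A * |t| / Real.log |t| + 2 with he
  have hepos : 0 < e := by positivity
  have hterm : ∀ ρ ∈ localZeros t, Real.exp (-e) ≤ ‖u + t * Complex.I - ρ‖ / (17 / 5) := by
    intro ρ hρ
    have h3 := bracketWidth_ge hApos ht20 (abs_im_sub_le_of_mem_localZeros hρ)
    have h4 := ht ρ (localZeros_subset hρ)
    have h5 := Complex.abs_im_le_norm (u + t * Complex.I - ρ)
    have h6 : (u + t * Complex.I - ρ).im = t - ρ.im := by simp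
    rw [h6] at h5
    have h7 : Real.exp (-2) ≤ 1 / (17 / 5) := by
      have h8 : (17 / 5 : ℝ) ≤ Real.exp 2 := by
        have := Real.exp_one_gt_d9
        have h9 : Real.exp 2 = Real.exp 1 * Real.exp 1 := by rw [← Real.exp_add]; norm_num
        nlinarith
      rw [Real.exp_neg, ← one_div]
      exact one_div_le_one_div_of_le (by norm_num) h8
    rw [he, neg_add, Real.exp_add, div_eq_mul_one_div ‖_‖]
    exact mul_le_mul (h3.trans (h4.trans h5)) h7 (Real.exp_pos _).le (norm_nonneg _)
  have hprod : Real.exp (-e) ^ (localZeros t).card ≤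
      ∏ ρ ∈ localZeros t, (‖u + t * Complex.I - ρ‖ / (17 / 5)) := by
    rw [← Finset.prod_const]
    exact Finset.prod_le_prod (fun _ _ => (Real.exp_pos _).le) hterm
  refine le_trans ?_ (mul_le_mul_of_nonneg_left hprod (Real.exp_pos _).le)
  rw [← Real.exp_nat_mul, ← Real.exp_add]
  refine Real.exp_le_exp.2 ?_
  have h10 : ((localZeros t).card : ℝ) * e ≤ C * Real.log |t| * e := by gcongr
  have h11 : C * Real.log |t| * e = |t| / 8 + 2 * (C * Real.log |t|) := by
    rw [he, hA]
    field_simp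
    ring
  nlinarith

/-- The zeros of `ζ` in the critical strip with ordinate near `t`. -/
def nearbyZeros (t : ℝ) : Finset ℂ :=
  localZeros t ∪ (localZeros (-t)).image (fun ρ => 1 - ρ)

/-- The radius 8/5 suffices because (3/2)² + (1/2)² < (8/5)². -/
lemma mem_localZeros_of_half_le {ρ : ℂ} {t : ℝ} (hρ : ρ ∈ zetaZeros) (h : 1 / 2 ≤ ρ.re)
    (ht : |ρ.im - t| ≤ 1 / 2) : ρ ∈ localZeros t := by
  refine mem_localZeros.2 ⟨?_, hρ.1⟩
  refine le_of_sq_le_sq ?_ (by norm_num)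
  rw [← Complex.normSq_eq_norm_sq, Complex.normSq_apply]
  have h1 := hρ.2.2
  have h2 := abs_le.1 ht
  simp
  nlinarith [h2.1, h2.2]

/-- A zero left of the critical line is caught through its reflection 1 - ρ, which lies to the right
of it at height -Im ρ. -/
lemma mem_nearbyZeros {ρ : ℂ} {t : ℝ} (hρ : ρ ∈ zetaZeros) (ht : |ρ.im - t| ≤ 1 / 2) :
    ρ ∈ nearbyZeros t := by
  rcases le_total (1 / 2) ρ.re with h | h
  · exact Finset.mem_union_left _ (mem_localZeros_of_half_le hρ h ht)
  · refine Finset.mem_union_right _ (Finset.mem_image.2 ⟨1 - ρ, ?_, by ring⟩)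
    refine mem_localZeros_of_half_le (one_sub_mem_zetaZeros hρ) (by simp; linarith) ?_
    rw [show (1 - ρ).im - -t = -(ρ.im - t) by simp; ring, abs_neg]
    exact ht

lemma exists_card_nearbyZeros_le (hsimple : ∀ ρ ∈ zetaZeros, deriv riemannZeta ρ ≠ 0) :
    ∃ C : ℝ, 0 < C ∧ ∀ t : ℝ, 4 ≤ |t| → ((nearbyZeros t).card : ℝ) ≤ C * Real.log |t| := by
  obtain ⟨C, hC, h⟩ := exists_card_localZeros_and_lower_bound hsimple
  refine ⟨2 * C, by positivity, fun t ht => ?_⟩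
  have h1 := (h t ht).1
  have h2 := (h (-t) (by rwa [abs_neg])).1
  rw [abs_neg] at h2
  have h3 : (nearbyZeros t).card ≤ (localZeros t).card + (localZeros (-t)).card :=
    (Finset.card_union_le _ _).trans (Nat.add_le_add_left Finset.card_image_le _)
  have h4 : ((nearbyZeros t).card : ℝ) ≤ (localZeros t).card + (localZeros (-t)).card := by
    exact_mod_cast h3
  linarith

lemma finite_zetaZeros_abs_im_le (T : ℝ) : {ρ : ℂ | ρ ∈ zetaZeros ∧ |ρ.im| ≤ T}.Finite := by
  refine (finite_zeros_closedBall 0 (1 + T)).subset fun ρ hρ => ⟨?_, hρ.1.1⟩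
  have h1 := Complex.norm_le_abs_re_add_abs_im ρ
  have h2 : |ρ.re| ≤ 1 := abs_le.2 ⟨by linarith [hρ.1.2.1], hρ.1.2.2.le⟩
  rw [sub_zero]
  linarith [hρ.2]

lemma bracketWidth_pos (A : ℝ) (ρ : ℂ) : 0 < bracketWidth A ρ := Real.exp_pos _

/-- Since (log y)² = o(y), the exponent A y / log y eventually exceeds 2 log y. -/
lemma exists_bracketWidth_le {A : ℝ} (hA : 0 < A) :
    ∃ T : ℝ, 2 ≤ T ∧ ∀ ρ : ℂ, T ≤ |ρ.im| → bracketWidth A ρ ≤ 1 / |ρ.im| ^ 2 := by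
  have h := (Real.isLittleO_pow_log_id_atTop (n := 2)).def (c := A / 2) (by positivity)
  obtain ⟨T, hT⟩ := eventually_atTop.1 h
  refine ⟨max 2 T, le_max_left _ _, fun ρ hρ => ?_⟩
  have h2 : 2 ≤ |ρ.im| := (le_max_left _ _).trans hρ
  have h1 := hT |ρ.im| ((le_max_right _ _).trans hρ)
  simp only [id, Real.norm_eq_abs, abs_abs, abs_pow, sq_abs] at h1
  have hlog : 0 < Real.log |ρ.im| := Real.log_pos (by linarith)
  have hpos : 0 < |ρ.im| := by linarith
  rw [bracketWidth, neg_div, Real.exp_neg, ← one_div]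
  refine one_div_le_one_div_of_le (by positivity) ?_
  rw [← Real.exp_log (pow_pos hpos 2), Real.log_pow]
  refine Real.exp_le_exp.2 ?_
  rw [le_div_iff₀ hlog]
  push_cast
  nlinarith

/-- Every interval of length `1 / 2` far from the origin contains an uncovered height. -/
theorem exists_uncovered (hsimple : ∀ ρ ∈ zetaZeros, deriv riemannZeta ρ ≠ 0) {A : ℝ}
    (hA : 0 < A) :
    ∃ T : ℝ, 4 ≤ T ∧ ∀ t : ℝ, T ≤ |t| → ∃ u ∈ uncovered A, |u - t| ≤ 1 / 4 := by
  obtain ⟨C, hC, hcard⟩ := exists_card_nearbyZeros_le hsimple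
  obtain ⟨T₁, hT₁, hwidth⟩ := exists_bracketWidth_le hA
  obtain ⟨G, hG⟩ := ((finite_zetaZeros_abs_im_le T₁).image
    (fun ρ => |ρ.im| + bracketWidth A ρ)).bddAbove
  -- For |t| ≥ 32 C the forbidden intervals near t have total length at most 8 C / |t| ≤ 1/4, less
  -- than the available 1/2. G covers the finitely many zeros below T₁, whose widths are not
  -- controlled.
  refine ⟨max (max 4 (32 * C)) (max (G + 1) (T₁ + 1)), by simp, fun t ht => ?_⟩
  have ht4 : 4 ≤ |t| := ((le_max_left _ _).trans (le_max_left _ _)).trans ht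
  have htC : 32 * C ≤ |t| := ((le_max_right _ _).trans (le_max_left _ _)).trans ht
  have htG : G + 1 ≤ |t| := ((le_max_left _ _).trans (le_max_right _ _)).trans ht
  have htT : T₁ + 1 ≤ |t| := ((le_max_right _ _).trans (le_max_right _ _)).trans ht
  set N : Finset ℂ := (nearbyZeros t).filter (fun ρ => |t| / 2 ≤ |ρ.im| ∧ T₁ ≤ |ρ.im|) with hN
  set bad : Set ℝ := ⋃ ρ ∈ N, Set.Ioo (ρ.im - bracketWidth A ρ) (ρ.im + bracketWidth A ρ) with hbad
  have hlog : Real.log |t| ≤ |t| := by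
    have := Real.log_le_sub_one_of_pos (show 0 < |t| by linarith)
    linarith
  have hvol : MeasureTheory.volume bad <
      MeasureTheory.volume (Set.Icc (t - 1 / 4) (t + 1 / 4)) := by
    have h1 : MeasureTheory.volume bad ≤ ∑ ρ ∈ N, ENNReal.ofReal (8 / |t| ^ 2) := by
      refine (MeasureTheory.measure_biUnion_finset_le _ _).trans
        (Finset.sum_le_sum fun ρ hρ => ?_)
      rw [Real.volume_Ioo]
      refine ENNReal.ofReal_le_ofReal ?_
      obtain ⟨-, h2, h3⟩ := Finset.mem_filter.1 hρ
      have h4 := hwidth ρ h3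
      have h5 : 1 / |ρ.im| ^ 2 ≤ 1 / (|t| / 2) ^ 2 :=
        one_div_le_one_div_of_le (by positivity) (by gcongr)
      have h6 : 1 / (|t| / 2) ^ 2 = 4 / |t| ^ 2 := by field_simp; norm_num
      have h7 : 8 / |t| ^ 2 = 2 * (4 / |t| ^ 2) := by ring
      linarith
    refine h1.trans_lt ?_
    rw [Finset.sum_const, nsmul_eq_mul, Real.volume_Icc, ← ENNReal.ofReal_natCast,
      ← ENNReal.ofReal_mul (by positivity)]
    refine (ENNReal.ofReal_lt_ofReal_iff (by linarith)).2 ?_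
    have h2 : (N.card : ℝ) ≤ C * |t| := by
      have h3 : (N.card : ℝ) ≤ (nearbyZeros t).card := by
        exact_mod_cast Finset.card_le_card (Finset.filter_subset _ _)
      have := hcard t ht4
      nlinarith
    calc (N.card : ℝ) * (8 / |t| ^ 2) ≤ C * |t| * (8 / |t| ^ 2) := by gcongr
      _ = 8 * C / |t| := by
        have : |t| ≠ 0 := by linarith
        field_simp
      _ < _ := by
        rw [div_lt_iff₀ (by linarith)]
        linarith
  obtain ⟨u, hu, hub⟩ := Set.not_subset.1 fun h => not_le.2 hvol (MeasureTheory.measure_mono h)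
  have hut : |u - t| ≤ 1 / 4 := abs_le.2 ⟨by linarith [hu.1], by linarith [hu.2]⟩
  refine ⟨u, fun ρ hρ => ?_, hut⟩
  have hu2 : |t| - 1 / 4 ≤ |u| := by
    have := abs_sub_abs_le_abs_sub t u
    rw [abs_sub_comm] at this
    linarith
  have hu3 := abs_sub_abs_le_abs_sub u ρ.im
  -- Low zeros are excluded by G and those within 1/2 of t by the choice of u. Every other zero is
  -- more than 1/4 away from u, and its width is at most 1/4.
  rcases le_total |ρ.im| T₁ with hle | hge
  · have h1 : |ρ.im| + bracketWidth A ρ ≤ G := hG ⟨ρ, ⟨hρ, hle⟩, rfl⟩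
    linarith
  · by_cases hnear : |ρ.im - t| ≤ 1 / 2
    · by_contra hlt
      rw [not_le, abs_lt] at hlt
      refine hub (Set.mem_biUnion (x := ρ) ?_ ⟨by linarith [hlt.1], by linarith [hlt.2]⟩)
      refine Finset.mem_coe.2 (Finset.mem_filter.2 ⟨mem_nearbyZeros hρ hnear, ?_, hge⟩)
      have := abs_sub_abs_le_abs_sub t ρ.im
      rw [abs_sub_comm] at this
      linarith
    · have h1 := hwidth ρ hge
      have h2 : 1 / |ρ.im| ^ 2 ≤ 1 / 2 ^ 2 :=
        one_div_le_one_div_of_le (by norm_num) (by gcongr; linarith)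
      have h3 := abs_sub_le ρ.im u t
      rw [abs_sub_comm ρ.im u] at h3
      linarith

/-! ### Brackets as clusters of overlapping intervals -/

section Brackets

variable {A : ℝ}

lemma bracket_nonempty (b : ZetaBracket A) : ∃ ρ, ρ ∈ b.zeros := by
  obtain ⟨⟨ρ, hρ⟩, rfl⟩ := Quotient.exists_rep b
  exact ⟨ρ, hρ, rfl⟩

lemma bracket_eq_of_mem {b b' : ZetaBracket A} {ρ : ℂ} (h : ρ ∈ b.zeros) (h' : ρ ∈ b'.zeros) :
    b = b' := by
  obtain ⟨h1, rfl⟩ := h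
  obtain ⟨h2, rfl⟩ := h'
  rfl

lemma mem_bracket_of_linked {b : ZetaBracket A} {ρ ρ' : ℂ} (h : ρ ∈ b.zeros)
    (h' : ρ' ∈ zetaZeros) (hl : |ρ.im - ρ'.im| < bracketWidth A ρ + bracketWidth A ρ') :
    ρ' ∈ b.zeros := by
  obtain ⟨h1, rfl⟩ := h
  refine ⟨h', Quotient.sound ?_⟩
  exact Relation.EqvGen.symm _ _ (Relation.EqvGen.rel _ _ hl)

/-- A cut of the ordinates that respects links inside a bracket does not separate the bracket. -/
lemma bracket_not_separated {b : ZetaBracket A} (u : ℝ)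
    (hu : ∀ ρ₁ ∈ b.zeros, ∀ ρ₂ ∈ b.zeros,
      |ρ₁.im - ρ₂.im| < bracketWidth A ρ₁ + bracketWidth A ρ₂ → (ρ₁.im < u ↔ ρ₂.im < u))
    {ρ₁ ρ₂ : ℂ} (h₁ : ρ₁ ∈ b.zeros) (h₂ : ρ₂ ∈ b.zeros) : ρ₁.im < u ↔ ρ₂.im < u := by
  obtain ⟨z₁, e₁⟩ := h₁
  obtain ⟨z₂, e₂⟩ := h₂
  have hrel : Relation.EqvGen (fun ρ₁ ρ₂ : zetaZeros =>
      |(ρ₁ : ℂ).im - (ρ₂ : ℂ).im| < bracketWidth A ρ₁ + bracketWidth A ρ₂) ⟨ρ₁, z₁⟩ ⟨ρ₂, z₂⟩ :=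
    Quotient.exact (s := bracketSetoid A) (e₁.trans e₂.symm)
  have key : ∀ p q : zetaZeros, Relation.EqvGen (fun ρ₁ ρ₂ : zetaZeros =>
      |(ρ₁ : ℂ).im - (ρ₂ : ℂ).im| < bracketWidth A ρ₁ + bracketWidth A ρ₂) p q →
      Quotient.mk (bracketSetoid A) p = b → ((p : ℂ).im < u ↔ (q : ℂ).im < u) := by
    intro p q h
    induction h with
    | rel p q h =>
      intro hp
      refine hu p ⟨p.2, hp⟩ q ⟨q.2, ?_⟩ h
      rw [← hp]
      exact (Quotient.sound (s := bracketSetoid A) (Relation.EqvGen.rel _ _ h)).symm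
    | refl p => intro _; rfl
    | symm p q h ih =>
      intro hp
      refine (ih ?_).symm
      rw [← hp]
      exact Quotient.sound (s := bracketSetoid A) h
    | trans p q s h h' ih ih' =>
      intro hp
      refine (ih hp).trans (ih' ?_)
      rw [← hp]
      exact (Quotient.sound (s := bracketSetoid A) h).symm
  exact key _ _ hrel e₁

/-- Two zeros on opposite sides of u are each at least their own width away from u, so their
ordinates differ by at least the sum of the widths and they cannot be linked. -/
lemma bracket_not_separated_of_uncovered {b : ZetaBracket A} {u : ℝ} (hu : u ∈ uncovered A)
    {ρ₁ ρ₂ : ℂ} (h₁ : ρ₁ ∈ b.zeros) (h₂ : ρ₂ ∈ b.zeros) : ρ₁.im < u ↔ ρ₂.im < u := by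
  have aux : ∀ p ∈ b.zeros, ∀ q ∈ b.zeros,
      |p.im - q.im| < bracketWidth A p + bracketWidth A q → p.im < u → q.im < u := by
    intro p hp q hq hpq h
    by_contra hq'
    have h1 := hu p hp.1
    have h2 := hu q hq.1
    rw [abs_of_pos (by linarith)] at h1
    rw [abs_of_nonpos (by linarith)] at h2
    have := (abs_lt.1 hpq).1
    linarith
  refine bracket_not_separated u (fun p hp q hq hpq => ⟨aux p hp q hq hpq, aux q hq p hp ?_⟩) h₁ h₂
  rw [abs_sub_comm, add_comm]
  exact hpq

/-- If uncovered heights exist far out, then every bracket is finite. -/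
lemma bracket_finite {T : ℝ}
    (hT : ∀ t : ℝ, T ≤ |t| → ∃ u ∈ uncovered A, |u - t| ≤ 1 / 4) (b : ZetaBracket A) :
    b.zeros.Finite := by
  obtain ⟨ρ, hρ⟩ := bracket_nonempty b
  set t := |ρ.im| + |T| + 1 with ht
  have ht0 : 0 ≤ t := by positivity
  obtain ⟨u, hu, hut⟩ := hT t (by
    rw [abs_of_nonneg ht0, ht]; linarith [le_abs_self T, abs_nonneg ρ.im])
  have h1 := abs_le.1 hut
  refine (finite_zetaZeros_abs_im_le u).subset fun ρ' hρ' => ⟨hρ'.1, abs_le.2 ?_⟩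
  have h2 : ρ.im < u := by linarith [le_abs_self ρ.im, abs_nonneg T]
  have h3 : ¬ ρ.im < -u := by
    rw [not_lt]; linarith [neg_abs_le ρ.im, abs_nonneg T]
  have h4 := (bracket_not_separated_of_uncovered hu hρ hρ').1 h2
  have h5 := (bracket_not_separated_of_uncovered (neg_mem_uncovered hu) hρ hρ').not.1 h3
  exact ⟨not_lt.1 h5, h4.le⟩

/-- A bracket far from the origin is cut out by a short interval with uncovered end points. -/
theorem bracket_eq_strip {T : ℝ}
    (hT : ∀ t : ℝ, T ≤ |t| → ∃ u ∈ uncovered A, |u - t| ≤ 1 / 4) (b : ZetaBracket A) {ρ : ℂ}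
    (hρ : ρ ∈ b.zeros) (hρT : T + 1 ≤ |ρ.im|) :
    ∃ α ∈ uncovered A, ∃ β ∈ uncovered A, α < β ∧ |α - ρ.im| ≤ 1 ∧ |β - ρ.im| ≤ 1 ∧
      ∀ ρ' ∈ zetaZeros, (ρ' ∈ b.zeros ↔ α < ρ'.im ∧ ρ'.im < β) := by
  have hfin := bracket_finite hT b
  -- Attach to each zero the interval of radius `bracketWidth` around its ordinate; two zeros are
  -- linked exactly when their intervals overlap. The ends of the union of these intervals over the
  -- bracket are α and β.
  obtain ⟨ρ₀, h₀, hmin⟩ := Set.exists_min_image b.zeros (fun ρ => ρ.im - bracketWidth A ρ) hfin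
    ⟨ρ, hρ⟩
  obtain ⟨ρ₁, h₁, hmax⟩ := Set.exists_max_image b.zeros (fun ρ => ρ.im + bracketWidth A ρ) hfin
    ⟨ρ, hρ⟩
  have hw := bracketWidth_pos A
  set α := ρ₀.im - bracketWidth A ρ₀ with hα
  set β := ρ₁.im + bracketWidth A ρ₁ with hβ
  have hα0 : |ρ₀.im - α| = bracketWidth A ρ₀ := by
    rw [hα, sub_sub_cancel, abs_of_pos (hw _)]
  have hβ1 : |ρ₁.im - β| = bracketWidth A ρ₁ := by
    rw [hβ, sub_add_cancel_left, abs_neg, abs_of_pos (hw _)]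
  have hin : ∀ ρ' ∈ b.zeros, α < ρ'.im ∧ ρ'.im < β := fun ρ' h =>
    ⟨by have := hmin ρ' h; linarith [hw ρ'],
      by have := hmax ρ' h; linarith [hw ρ']⟩
  refine ⟨α, ?_, β, ?_, (hin ρ hρ).1.trans (hin ρ hρ).2, ?_, ?_, fun ρ' hρ' => ⟨hin ρ', ?_⟩⟩
  -- A zero whose interval covers α would be linked to ρ₀, hence belong to the bracket, and its
  -- interval would begin below the minimum α.
  · intro ρ' hρ'
    by_contra hlt
    rw [not_le] at hlt
    have hmem := mem_bracket_of_linked h₀ hρ' ((abs_sub_le _ α _).trans_lt (by linarith))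
    have := hmin ρ' hmem
    linarith [(abs_lt.1 hlt).1]
  · intro ρ' hρ'
    by_contra hlt
    rw [not_le] at hlt
    have hmem := mem_bracket_of_linked h₁ hρ' ((abs_sub_le _ β _).trans_lt (by linarith))
    have := hmax ρ' hmem
    linarith [(abs_lt.1 hlt).2]
  -- An uncovered height u at most 3/4 below ρ stops the bracket: all its ordinates are at least u,
  -- and even the interval of ρ₀ does not pass u.
  · obtain ⟨u, hu, hut⟩ := hT (ρ.im - 1 / 2) (by
      have := abs_sub_abs_le_abs_sub ρ.im (1 / 2)
      have h2 := abs_sub_abs_le_abs_sub ρ.im (ρ.im - 1 / 2)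
      rw [sub_sub_cancel, abs_of_pos (by norm_num : (0 : ℝ) < 1 / 2)] at h2
      linarith)
    have h2 := abs_le.1 hut
    have h3 : ¬ ρ.im < u := by rw [not_lt]; linarith
    have h4 := (bracket_not_separated_of_uncovered hu hρ h₀).not.1 h3
    have h5 := hu ρ₀ h₀.1
    rw [abs_of_nonpos (by linarith)] at h5
    exact abs_le.2 ⟨by linarith, by linarith [(hin ρ hρ).1]⟩
  · obtain ⟨u, hu, hut⟩ := hT (ρ.im + 1 / 2) (by
      have h2 := abs_sub_abs_le_abs_sub ρ.im (ρ.im + 1 / 2)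
      rw [sub_add_cancel_left, abs_neg, abs_of_pos (by norm_num : (0 : ℝ) < 1 / 2)] at h2
      linarith)
    have h2 := abs_le.1 hut
    have h3 : ρ.im < u := by linarith
    have h4 := (bracket_not_separated_of_uncovered hu hρ h₁).1 h3
    have h5 := hu ρ₁ h₁.1
    rw [abs_of_pos (by linarith)] at h5
    exact abs_le.2 ⟨by linarith [(hin ρ hρ).2], by linarith⟩
  -- The interval of a zero ρ' outside the bracket misses all intervals of the bracket, so a cut at
  -- Im ρ' separates no linked pair. The whole union then lies on one side of Im ρ', contrary to α <
  -- Im ρ' < β.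
  · rintro ⟨hαρ, hρβ⟩
    by_contra hmem
    have hnl : ∀ p ∈ b.zeros, bracketWidth A p + bracketWidth A ρ' ≤ |p.im - ρ'.im| :=
      fun p hp => not_lt.1 fun h => hmem (mem_bracket_of_linked hp hρ' h)
    have aux : ∀ p ∈ b.zeros, ∀ q ∈ b.zeros,
        |p.im - q.im| < bracketWidth A p + bracketWidth A q → p.im < ρ'.im → q.im < ρ'.im := by
      intro p hp q hq hpq h
      by_contra hq'
      have e1 := hnl p hp
      have e2 := hnl q hq
      rw [abs_of_neg (by linarith)] at e1
      rw [abs_of_nonneg (by linarith)] at e2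
      linarith [(abs_lt.1 hpq).1, hw ρ']
    have hsep := bracket_not_separated ρ'.im (fun p hp q hq hpq =>
      ⟨aux p hp q hq hpq, aux q hq p hp (by rw [abs_sub_comm, add_comm]; exact hpq)⟩) h₀ h₁
    have e0 := hnl ρ₀ h₀
    have e1 := hnl ρ₁ h₁
    by_cases hc : ρ₀.im < ρ'.im
    · have := hsep.1 hc
      rw [abs_of_neg (by linarith)] at e1
      linarith [hw ρ']
    · rw [abs_of_nonneg (by linarith)] at e0
      linarith [hw ρ']

end Brackets

/-! ### Growth of 1/ζ and of the kernel; summation over zeros -/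

lemma norm_cos_le_exp (z : ℂ) : ‖Complex.cos z‖ ≤ Real.exp |z.im| := by
  rw [Complex.cos, norm_div, Complex.norm_ofNat, div_le_iff₀ two_pos]
  refine (norm_add_le _ _).trans ?_
  rw [Complex.norm_exp, Complex.norm_exp]
  have h1 : (z * Complex.I).re = -z.im := by simp
  have h2 : (-z * Complex.I).re = z.im := by simp
  rw [h1, h2]
  have := Real.exp_le_exp.2 (neg_le_abs z.im)
  have := Real.exp_le_exp.2 (le_abs_self z.im)
  linarith

lemma cos_ne_zero_of_im_ne_zero {z : ℂ} (hz : z.im ≠ 0) : Complex.cos z ≠ 0 := by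
  intro h
  obtain ⟨k, hk⟩ := Complex.cos_eq_zero_iff.1 h
  refine hz ?_
  have : z = (((2 * k + 1) * Real.pi / 2 : ℝ) : ℂ) := by rw [hk]; push_cast; ring
  rw [this, Complex.ofReal_im]

lemma ne_neg_nat_of_im_ne_zero {z : ℂ} (hz : z.im ≠ 0) (n : ℕ) : z ≠ -n := by
  rintro rfl
  simp at hz

/-- `1 / ζ` is at most `C e^{3|t|/8}` on uncovered heights and outside the critical strip. -/
theorem exists_norm_zetaRecip_le_exp {A T : ℝ} (hT1 : 1 ≤ T)
    (hlow : ∀ t ∈ uncovered A, T ≤ |t| → ∀ u : ℝ, 1 / 2 ≤ u → u ≤ 2 →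
      Real.exp (-(|t| / 4)) ≤ ‖riemannZeta (u + t * Complex.I)‖) (a b : ℝ) :
    ∃ C : ℝ, 0 < C ∧ ∀ w : ℂ, a ≤ w.re → w.re ≤ b → T ≤ |w.im| →
      (w.im ∈ uncovered A ∨ 3 / 2 ≤ w.re ∨ w.re ≤ -1 / 2) →
      ‖zetaRecip w‖ ≤ C * Real.exp (3 / 8 * |w.im|) := by
  obtain ⟨B, hB1, hB⟩ := exists_norm_zetaRecip_le
  obtain ⟨CG, hCG, hG⟩ := exists_norm_Gamma_le_exp a b (ε := 1 / 8) (by norm_num)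
  have right : ∀ w : ℂ, 1 / 2 ≤ w.re → T ≤ |w.im| → (w.im ∈ uncovered A ∨ 3 / 2 ≤ w.re) →
      ‖zetaRecip w‖ ≤ B * Real.exp (1 / 4 * |w.im|) := by
    intro w h1 h2 h3
    have hone : 1 ≤ Real.exp (1 / 4 * |w.im|) := Real.one_le_exp (by positivity)
    rcases le_total (3 / 2) w.re with h | h
    · exact (hB w h).trans (le_mul_of_one_le_right (by linarith) hone)
    · have hw1 : w ≠ 1 := by
        rintro rfl
        simp at h2
        linarith
      rcases h3 with h3 | h3
      · have h4 := hlow w.im h3 h2 w.re h1 (by linarith)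
        rw [Complex.re_add_im] at h4
        have h5 : ‖zetaRecip w‖ ≤ Real.exp (1 / 4 * |w.im|) := by
          rw [zetaRecip, if_neg hw1, norm_div, norm_one]
          rw [div_le_iff₀ ((Real.exp_pos _).trans_le h4)]
          calc (1 : ℝ) = Real.exp (1 / 4 * |w.im|) * Real.exp (-(|w.im| / 4)) := by
                rw [← Real.exp_add, show 1 / 4 * |w.im| + -(|w.im| / 4) = 0 by ring, Real.exp_zero]
            _ ≤ _ := by gcongr
        exact h5.trans (le_mul_of_one_le_left (Real.exp_pos _).le hB1)
      · exact (hB w h3).trans (le_mul_of_one_le_right (by linarith) hone)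
  set P : ℝ := (2 * Real.pi) ^ (|a| + |b|) with hP
  have h2pi : 1 ≤ 2 * Real.pi := by linarith [Real.pi_gt_three]
  have hP1 : 1 ≤ P := Real.one_le_rpow h2pi (by positivity)
  refine ⟨B + 2 * P * CG * B, by positivity, fun w ha hb hw h => ?_⟩
  have h0 : (0 : ℝ) ≤ |w.im| := abs_nonneg _
  have hC : 0 ≤ 2 * P * CG * B := by positivity
  rcases le_or_gt (1 / 2) w.re with hre | hre
  · refine (right w hre hw ?_).trans ?_
    · rcases h with h | h | h
      · exact Or.inl h
      · exact Or.inr h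
      · linarith
    · exact mul_le_mul (by linarith) (Real.exp_le_exp.2 (by linarith)) (Real.exp_pos _).le
        (by positivity)
  · have him : w.im ≠ 0 := by
      intro h
      rw [h, abs_zero] at hw
      linarith
    have hw1 : w ≠ 1 := by rintro rfl; simp at him
    have hfe := zetaRecip_functional_equation (w := w) (ne_neg_nat_of_im_ne_zero him) hw1
      (cos_ne_zero_of_im_ne_zero (by
        rw [show (Real.pi : ℂ) * w / 2 = ((Real.pi / 2 : ℝ) : ℂ) * w by push_cast; ring,
          Complex.im_ofReal_mul]
        exact mul_ne_zero (by positivity) him))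
    have hr := right (1 - w) (by simp; linarith) (by simpa using hw) (by
      rcases h with h | h | h
      · left; simpa using neg_mem_uncovered h
      · linarith
      · right; simp; linarith)
    have e1 : |(1 - w).im| = |w.im| := by simp
    rw [e1] at hr
    have hcos := norm_cos_le_exp (Real.pi * w / 2)
    have e2 : |((Real.pi : ℂ) * w / 2).im| = Real.pi / 2 * |w.im| := by
      rw [show (Real.pi : ℂ) * w / 2 = ((Real.pi / 2 : ℝ) : ℂ) * w by push_cast; ring,
          Complex.im_ofReal_mul, abs_mul, abs_of_pos (by positivity)]
    rw [e2] at hcos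
    have hGw := hG w ha hb (hT1.trans hw)
    have hpow : ‖(2 * Real.pi : ℂ) ^ (-w)‖ ≤ P := by
      rw [show (2 * Real.pi : ℂ) = ((2 * Real.pi : ℝ) : ℂ) by push_cast; ring,
        Complex.norm_cpow_eq_rpow_re_of_pos (by positivity)]
      refine Real.rpow_le_rpow_of_exponent_le h2pi ?_
      rw [Complex.neg_re]
      linarith [neg_abs_le a, abs_nonneg b]
    rw [hfe]
    simp only [norm_mul, Complex.norm_ofNat]
    -- The growth π/2 of the cosine cancels the decay π/2 of Γ. What remains is ε = 1/8 plus the 1/4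
    -- of 1/ζ(1 - w), that is 3/8.
    calc 2 * ‖(2 * Real.pi : ℂ) ^ (-w)‖ * ‖Complex.cos (Real.pi * w / 2)‖ * ‖Complex.Gamma w‖ *
          ‖zetaRecip (1 - w)‖
        ≤ 2 * P * Real.exp (Real.pi / 2 * |w.im|) *
          (CG * Real.exp (-((Real.pi / 2 - 1 / 8) * |w.im|))) *
          (B * Real.exp (1 / 4 * |w.im|)) := by gcongr
      _ = 2 * P * CG * B * (Real.exp (Real.pi / 2 * |w.im|) *
          Real.exp (-((Real.pi / 2 - 1 / 8) * |w.im|)) * Real.exp (1 / 4 * |w.im|)) := by ring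
      _ = 2 * P * CG * B * Real.exp (3 / 8 * |w.im|) := by
          rw [← Real.exp_add, ← Real.exp_add]; congr 2; ring
      _ ≤ _ := by gcongr; linarith

/-- The integrand `Γ(k - w) x^(w - k) / (ζ(w) ζ(w - r))`. -/
def zetaKernel (r : ℕ) (k x : ℝ) (w : ℂ) : ℂ :=
  Complex.Gamma (k - w) * (x : ℂ) ^ (w - k) * (zetaRecip w * zetaRecip (w - r))

lemma norm_rpow_le {x : ℝ} (hx : 0 < x) (a b : ℝ) :
    ∃ C : ℝ, 0 < C ∧ ∀ s : ℂ, a ≤ s.re → s.re ≤ b → ‖(x : ℂ) ^ s‖ ≤ C := by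
  refine ⟨x ^ a + x ^ b, by positivity, fun s h1 h2 => ?_⟩
  rw [Complex.norm_cpow_eq_rpow_re_of_pos hx]
  have ha : 0 < x ^ a := by positivity
  have hb : 0 < x ^ b := by positivity
  rcases le_total 1 x with h | h
  · linarith [Real.rpow_le_rpow_of_exponent_le h h2]
  · linarith [Real.rpow_le_rpow_of_exponent_ge hx h h1]

theorem exists_norm_zetaKernel_le_exp {A T : ℝ} (hT1 : 1 ≤ T)
    (hlow : ∀ t ∈ uncovered A, T ≤ |t| → ∀ u : ℝ, 1 / 2 ≤ u → u ≤ 2 →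
      Real.exp (-(|t| / 4)) ≤ ‖riemannZeta (u + t * Complex.I)‖) (r : ℕ) (k : ℝ) {x : ℝ}
    (hx : 0 < x) (a b : ℝ) :
    ∃ C : ℝ, 0 < C ∧ ∀ w : ℂ, a ≤ w.re → w.re ≤ b → T ≤ |w.im| →
      (w.im ∈ uncovered A ∨ r + 3 / 2 ≤ w.re ∨ w.re ≤ -1 / 2) →
      ‖zetaKernel r k x w‖ ≤ C * Real.exp (-(1 / 2 * |w.im|)) := by
  obtain ⟨C₁, hC₁, h₁⟩ := exists_norm_zetaRecip_le_exp hT1 hlow a b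
  obtain ⟨C₂, hC₂, h₂⟩ := exists_norm_zetaRecip_le_exp hT1 hlow (a - r) (b - r)
  obtain ⟨C₃, hC₃, h₃⟩ := exists_norm_Gamma_le_exp (k - b) (k - a) (ε := 1 / 8) (by norm_num)
  obtain ⟨C₄, hC₄, h₄⟩ := norm_rpow_le hx (a - k) (b - k)
  have hr : (0 : ℝ) ≤ r := Nat.cast_nonneg r
  refine ⟨C₃ * C₄ * (C₁ * C₂), by positivity, fun w ha hb hw h => ?_⟩
  have g₁ := h₁ w ha hb hw (by
    rcases h with h | h | h
    · exact Or.inl h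
    · right; left; linarith
    · right; right; exact h)
  have g₂ := h₂ (w - r) (by simp; linarith) (by simp; linarith) (by simpa using hw) (by
    rcases h with h | h | h
    · left; simpa using h
    · right; left; simp; linarith
    · right; right; simp; linarith)
  have g₃ := h₃ (k - w) (by simp; linarith) (by simp; linarith) (by simpa using hT1.trans hw)
  have g₄ := h₄ (w - k) (by simp; linarith) (by simp; linarith)
  have e₂ : |(w - r).im| = |w.im| := by simp
  have e₃ : |((k : ℂ) - w).im| = |w.im| := by simp
  rw [e₂] at g₂
  rw [e₃] at g₃
  rw [zetaKernel]
  simp only [norm_mul]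
  -- The decay rate π/2 - 1/8 of Γ exceeds the two growth rates 3/8 by more than 1/2.
  calc ‖Complex.Gamma (k - w)‖ * ‖(x : ℂ) ^ (w - k)‖ * (‖zetaRecip w‖ * ‖zetaRecip (w - r)‖)
      ≤ C₃ * Real.exp (-((Real.pi / 2 - 1 / 8) * |w.im|)) * C₄ *
        (C₁ * Real.exp (3 / 8 * |w.im|) * (C₂ * Real.exp (3 / 8 * |w.im|))) := by gcongr
    _ = C₃ * C₄ * (C₁ * C₂) * (Real.exp (-((Real.pi / 2 - 1 / 8) * |w.im|)) *
        Real.exp (3 / 8 * |w.im|) * Real.exp (3 / 8 * |w.im|)) := by ring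
    _ ≤ _ := by
        rw [← Real.exp_add, ← Real.exp_add]
        gcongr
        nlinarith [Real.pi_gt_three, abs_nonneg w.im]

/-- Exponentially decaying functions of the ordinates are summable over the non-trivial zeros. -/
theorem summable_exp_neg_abs_im (hsimple : ∀ ρ ∈ zetaZeros, deriv riemannZeta ρ ≠ 0) :
    Summable fun ρ : zetaZeros => Real.exp (-(1 / 2 * |(ρ : ℂ).im|)) := by
  obtain ⟨C, hC, hcard⟩ := exists_card_nearbyZeros_le hsimple
  -- Zeros are sorted by the integer nearest to their ordinate; each class has O(log|n|) elements.
  set φ : zetaZeros → ℤ := fun ρ => round (ρ : ℂ).im with hφ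
  have hnear : ∀ ρ : zetaZeros, |(ρ : ℂ).im - φ ρ| ≤ 1 / 2 := fun ρ => abs_sub_round _
  set g : ℤ → ℝ := fun n => (nearbyZeros n).card * Real.exp (-(1 / 2 * (|(n : ℝ)| - 1 / 2))) with hg
  have hgsum : Summable g := by
    have hmaj : Summable fun n : ℤ => C * Real.exp (1 / 4) *
        (|(n : ℝ)| ^ 1 * Real.exp (-(1 / 2) * |(n : ℝ)|)) := by
      refine Summable.mul_left _ ?_
      have hnat := Real.summable_pow_mul_exp_neg_nat_mul 1 (r := 1 / 2) (by norm_num)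
      refine Summable.of_nat_of_neg ?_ ?_
      · simpa using hnat
      · simpa using hnat
    refine Summable.of_norm_bounded_eventually hmaj ?_
    have hfin : {n : ℤ | |n| < 4}.Finite := by
      refine (Set.finite_Icc (-4 : ℤ) 4).subset fun n hn => ?_
      have := abs_lt.1 (show |n| < 4 from hn)
      exact ⟨this.1.le, this.2.le⟩
    filter_upwards [hfin.compl_mem_cofinite] with n hn
    have hn4 : (4 : ℝ) ≤ |(n : ℝ)| := by
      have : (4 : ℤ) ≤ |n| := not_lt.1 hn
      exact_mod_cast this
    have h1 := hcard n hn4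
    have h2 : Real.log |(n : ℝ)| ≤ |(n : ℝ)| := by
      have := Real.log_le_sub_one_of_pos (show 0 < |(n : ℝ)| by linarith)
      linarith
    have h3 : ((nearbyZeros n).card : ℝ) ≤ C * |(n : ℝ)| := h1.trans (by gcongr)
    rw [Real.norm_of_nonneg (by positivity), hg]
    simp only
    rw [show -(1 / 2 * (|(n : ℝ)| - 1 / 2)) = 1 / 4 + -(1 / 2) * |(n : ℝ)| by ring, Real.exp_add,
      pow_one]
    calc ((nearbyZeros n).card : ℝ) * (Real.exp (1 / 4) * Real.exp (-(1 / 2) * |(n : ℝ)|))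
        ≤ C * |(n : ℝ)| * (Real.exp (1 / 4) * Real.exp (-(1 / 2) * |(n : ℝ)|)) := by gcongr
      _ = _ := by ring
  refine summable_of_sum_le (c := ∑' n, g n) (fun _ => (Real.exp_pos _).le) fun s => ?_
  rw [← Finset.sum_fiberwise_of_maps_to (t := s.image φ) (g := φ)
    (fun ρ hρ => Finset.mem_image_of_mem _ hρ)]
  refine le_trans (Finset.sum_le_sum fun n _ => ?_)
    (hgsum.sum_le_tsum (s.image φ) fun n _ => by positivity)
  have h1 : (s.filter fun ρ => φ ρ = n).card ≤ (nearbyZeros n).card := by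
    refine Finset.card_le_card_of_injOn (fun ρ => (ρ : ℂ)) (fun ρ hρ => ?_)
      (fun _ _ _ _ h => Subtype.ext h)
    have h2 := (Finset.mem_filter.1 hρ).2
    have h3 := hnear ρ
    rw [h2] at h3
    exact mem_nearbyZeros ρ.2 h3
  refine (Finset.sum_le_card_nsmul _ _ (Real.exp (-(1 / 2 * (|(n : ℝ)| - 1 / 2))))
    fun ρ hρ => ?_).trans ?_
  · have h2 := (Finset.mem_filter.1 hρ).2
    have h3 := hnear ρ
    rw [h2] at h3
    have h4 := abs_sub_abs_le_abs_sub (n : ℝ) (ρ : ℂ).im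
    rw [abs_sub_comm] at h4
    exact Real.exp_le_exp.2 (by linarith)
  · rw [nsmul_eq_mul, hg]
    simp only
    gcongr

/-! ### Residues of the kernel -/

lemma zetaRecip_of_ne_one {s : ℂ} (hs : s ≠ 1) : zetaRecip s = 1 / riemannZeta s := if_neg hs

/-- For Re w ≤ 0 neither Γ(1 - w) nor ζ(1 - w) vanishes, so the functional equation leaves only the
zeros of the cosine; w = 0 is ruled out by the value of ζ(0). -/
lemma riemannZeta_eq_zero_cases {w : ℂ} (h : riemannZeta w = 0) :
    w ∈ zetaZeros ∨ ∃ n : ℕ, w = -(2 * ((n : ℂ) + 1)) := by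
  by_cases hre : 0 < w.re
  · exact Or.inl (mem_zetaZeros_of_zero h hre)
  right
  have hw0 : w ≠ 0 := by
    rintro rfl
    rw [riemannZeta_zero] at h
    norm_num at h
  have hs1 : 1 ≤ (1 - w).re := by simp; linarith
  have hne : ∀ n : ℕ, 1 - w ≠ -n := by
    intro n hn
    rw [hn] at hs1
    simp at hs1
    linarith [(Nat.cast_nonneg n : (0 : ℝ) ≤ n)]
  have hfe := riemannZeta_one_sub hne (by simpa using hw0)
  rw [sub_sub_cancel, h] at hfe
  have hpi : (2 * Real.pi : ℂ) ≠ 0 := by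
    exact_mod_cast (by positivity : (2 * Real.pi : ℝ) ≠ 0)
  have hp : (2 * Real.pi : ℂ) ^ (-(1 - w)) ≠ 0 := by simp [Complex.cpow_eq_zero_iff, hpi]
  have hG := Complex.Gamma_ne_zero hne
  have hz := riemannZeta_ne_zero_of_one_le_re hs1
  have hcos : Complex.cos (Real.pi * (1 - w) / 2) = 0 := by
    by_contra hc
    exact (mul_ne_zero (mul_ne_zero (mul_ne_zero (mul_ne_zero two_ne_zero hp) hG) hc) hz) hfe.symm
  obtain ⟨j, hj⟩ := Complex.cos_eq_zero_iff.1 hcos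
  have hpi' : (Real.pi : ℂ) ≠ 0 := by exact_mod_cast Real.pi_ne_zero
  have hwj : w = -(2 * j) := by
    have : (1 - w) = 2 * j + 1 := by
      have h2 : (Real.pi : ℂ) * (1 - w) = Real.pi * (2 * j + 1) := by linear_combination 2 * hj
      exact mul_left_cancel₀ hpi' h2
    linear_combination -this
  have hj1 : 1 ≤ j := by
    have h1 : w.re = -(2 * j) := by
      have : w = ((-(2 * j) : ℝ) : ℂ) := by rw [hwj]; push_cast; ring
      rw [this, Complex.ofReal_re]
    have h2 : (0 : ℝ) ≤ j := by linarith
    have h3 : (0 : ℤ) ≤ j := by exact_mod_cast h2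
    have h4 : j ≠ 0 := by rintro rfl; simp at hwj; exact hw0 hwj
    omega
  obtain ⟨n, hn⟩ := Int.eq_ofNat_of_zero_le (show 0 ≤ j - 1 by omega)
  refine ⟨n, ?_⟩
  have : j = n + 1 := by omega
  rw [hwj, this]
  push_cast
  ring

/-- The real part of ρ - r is negative or zero, and if it were a trivial zero, Re ρ would be an
integer strictly between 0 and 1. -/
lemma riemannZeta_ne_zero_of_sub {ρ : ℂ} (hρ : ρ ∈ zetaZeros) {r : ℕ} (hr : 1 ≤ r) :
    riemannZeta (ρ - r) ≠ 0 := by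
  have hr' : (1 : ℝ) ≤ r := by exact_mod_cast hr
  intro h
  have hre : (ρ - r).re = ρ.re - r := by simp
  rcases riemannZeta_eq_zero_cases h with h1 | ⟨n, hn⟩
  · have := h1.2.1
    rw [hre] at this
    linarith [hρ.2.2]
  · have h2 : ρ.re = ((r : ℤ) - 2 * (n + 1) : ℤ) := by
      have : ρ.re = (ρ - r).re + r := by rw [hre]; ring
      rw [this, hn]
      simp
      ring
    have h3 := hρ.2.1
    have h4 := hρ.2.2
    rw [h2] at h3 h4
    have h5 : (0 : ℤ) < (r : ℤ) - 2 * (n + 1) := by exact_mod_cast h3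
    have h6 : (r : ℤ) - 2 * (n + 1) < 1 := by exact_mod_cast h4
    omega

lemma tendsto_mul_zetaRecip_of_zero {ρ : ℂ} (hρ : ρ ∈ zetaZeros)
    (hd : deriv riemannZeta ρ ≠ 0) :
    Tendsto (fun w => (w - ρ) * zetaRecip w) (𝓝[≠] ρ) (𝓝 (1 / deriv riemannZeta ρ)) := by
  have hρ1 : ρ ≠ 1 := by
    rintro rfl
    exact lt_irrefl _ hρ.2.2
  have h1 : HasDerivAt riemannZeta (deriv riemannZeta ρ) ρ :=
    (differentiableAt_riemannZeta hρ1).hasDerivAt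
  have h2 := (hasDerivAt_iff_tendsto_slope.1 h1).inv₀ hd
  rw [one_div]
  refine h2.congr' ?_
  filter_upwards [nhdsWithin_le_nhds (isOpen_ne.mem_nhds hρ1)] with w hw
  rw [slope_def_field, hρ.1, sub_zero, inv_div, zetaRecip_of_ne_one hw, mul_one_div]

/-- `w` is not an integer. -/
def NotInt (w : ℂ) : Prop := ∀ n : ℤ, w ≠ n

/-- The functional equation is applied only off the integers, where no Gamma factor or cosine
degenerates; this suffices for limits at the integers. -/
lemma eventually_notInt (n : ℤ) : ∀ᶠ w in 𝓝[≠] (n : ℂ), NotInt w := by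
  have h : Metric.ball (n : ℂ) 1 ∈ 𝓝 (n : ℂ) := Metric.ball_mem_nhds _ one_pos
  filter_upwards [nhdsWithin_le_nhds h, self_mem_nhdsWithin] with w hw hne m hm
  rw [hm, Metric.mem_ball, dist_eq_norm, ← Int.cast_sub, Complex.norm_intCast] at hw
  have h1 : |m - n| < 1 := by exact_mod_cast hw
  have h2 : m = n := by
    have := abs_lt.1 h1
    omega
  exact hne (by rw [hm, h2]; rfl)

lemma NotInt.sub_nat {w : ℂ} (h : NotInt w) (r : ℕ) : NotInt (w - r) := by
  intro n hn
  refine h (n + r) ?_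
  push_cast
  linear_combination hn

lemma NotInt.zetaRecip_eq {w : ℂ} (h : NotInt w) :
    zetaRecip w = 2 * (2 * Real.pi : ℂ) ^ (-w) * Complex.cos (Real.pi * w / 2) *
      Complex.Gamma w * zetaRecip (1 - w) := by
  refine zetaRecip_functional_equation (fun n hn => h (-n) (by rw [hn]; push_cast; rfl))
    (fun h1 => h 1 (by rw [h1]; norm_num)) fun hc => ?_
  obtain ⟨j, hj⟩ := Complex.cos_eq_zero_iff.1 hc
  have hpi' : (Real.pi : ℂ) ≠ 0 := by exact_mod_cast Real.pi_ne_zero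
  refine h (2 * j + 1) (mul_left_cancel₀ hpi' ?_)
  push_cast
  linear_combination 2 * hj

lemma NotInt.sin_ne_zero {w : ℂ} (h : NotInt w) : Complex.sin (Real.pi * w) ≠ 0 := by
  intro hs
  obtain ⟨j, hj⟩ := Complex.sin_eq_zero_iff.1 hs
  have hpi' : (Real.pi : ℂ) ≠ 0 := by exact_mod_cast Real.pi_ne_zero
  refine h j (mul_left_cancel₀ hpi' ?_)
  linear_combination hj

/-- `1 / (ζ(u) ζ(u - r))`. -/
def zetaPair (r : ℕ) (u : ℂ) : ℂ := zetaRecip u * zetaRecip (u - r)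

lemma continuousAt_zetaPair {r : ℕ} {u : ℂ} (hu : r + 1 ≤ u.re) :
    ContinuousAt (zetaPair r) u := by
  have hr : (0 : ℝ) ≤ r := Nat.cast_nonneg r
  have h1 := (differentiableAt_zetaRecip_of_one_le_re (s := u) (by linarith)).continuousAt
  have h2 := (differentiableAt_zetaRecip_of_one_le_re (s := u - r) (by simp; linarith)).continuousAt
  exact h1.mul (ContinuousAt.comp (f := fun u : ℂ => u - r) (g := zetaRecip) h2 (by fun_prop))

/-- The reflected form of the kernel, coming from the functional equation. -/
lemma zetaKernel_eq_reflected {q : ℕ} {r : ℕ} (hr : r = 2 * q + 1) (k x : ℝ) {w : ℂ}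
    (hw : NotInt w) :
    zetaKernel r k x w = (-1) ^ q * (2 * Real.pi : ℂ) ^ ((r : ℂ) + 1 - 2 * w) *
      Complex.Gamma (k - w) * Complex.Gamma (w - r) / Complex.Gamma (1 - w) *
      (x : ℂ) ^ (w - k) * zetaPair r (r + 1 - w) := by
  have hpi : (2 * Real.pi : ℂ) ≠ 0 := by
    exact_mod_cast (by positivity : (2 * Real.pi : ℝ) ≠ 0)
  have hpi' : (Real.pi : ℂ) ≠ 0 := by exact_mod_cast Real.pi_ne_zero
  have h1 := hw.zetaRecip_eq
  have h2 := (hw.sub_nat r).zetaRecip_eq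
  -- Oddness of r turns the second cosine into ± sin(πw/2). Together with cos(πw/2) it gives
  -- sin(πw)/2, which the reflection formula merges with Γ(w) into 1 / Γ(1 - w). Of the Gamma
  -- factors from the two functional equations only Γ(w - r) keeps poles, and these are simple.
  have hcos : Complex.cos (Real.pi * (w - r) / 2) = (-1) ^ q * Complex.sin (Real.pi * w / 2) := by
    have e1 : (Real.pi : ℂ) * (w - r) / 2 =
        (Real.pi * w / 2 - Real.pi / 2) - (q : ℕ) * Real.pi := by
      rw [hr]; push_cast; ring
    rw [e1, Complex.cos_antiperiodic.sub_nat_mul_eq, Complex.cos_sub_pi_div_two]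
  have hsin : Complex.sin (Real.pi * w) =
      2 * Complex.sin (Real.pi * w / 2) * Complex.cos (Real.pi * w / 2) := by
    rw [← Complex.sin_two_mul]; congr 1; ring
  have hG := Complex.Gamma_mul_Gamma_one_sub w
  have hs0 := hw.sin_ne_zero
  have hG1 : Complex.Gamma (1 - w) ≠ 0 := by
    intro h0
    rw [h0, mul_zero] at hG
    exact (div_ne_zero hpi' hs0) hG.symm
  have hGw : Complex.Gamma w * (2 * Complex.sin (Real.pi * w / 2) * Complex.cos (Real.pi * w / 2)) =
      Real.pi / Complex.Gamma (1 - w) := by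
    rw [← hsin, eq_div_iff hG1]
    rw [eq_div_iff hs0] at hG
    linear_combination hG
  have hpow : (2 * Real.pi : ℂ) ^ ((r : ℂ) + 1 - 2 * w) =
      (2 * Real.pi) * ((2 * Real.pi : ℂ) ^ (-w) * (2 * Real.pi : ℂ) ^ (-(w - r))) := by
    rw [← Complex.cpow_add _ _ hpi]
    nth_rewrite 2 [← Complex.cpow_one (2 * Real.pi : ℂ)]
    rw [← Complex.cpow_add _ _ hpi]
    congr 1
    ring
  rw [zetaKernel, zetaPair, h1, h2, hcos, hpow,
    show (r : ℂ) + 1 - w - r = 1 - w by ring, show 1 - (w - r) = (r : ℂ) + 1 - w by ring]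
  rw [div_eq_mul_inv] at hGw ⊢
  linear_combination ((-1) ^ q * 2 * (2 * Real.pi : ℂ) ^ (-w) * (2 * Real.pi : ℂ) ^ (-(w - r)) *
    Complex.Gamma (k - w) * Complex.Gamma (w - r) * (x : ℂ) ^ (w - k) * zetaRecip (1 - w) *
    zetaRecip ((r : ℂ) + 1 - w)) * hGw

lemma tendsto_punctured_of_continuousAt {f : ℂ → ℂ} {p : ℂ} (h : ContinuousAt f p) :
    Tendsto f (𝓝[≠] p) (𝓝 (f p)) := h.tendsto.mono_left nhdsWithin_le_nhds

lemma tendsto_punctured_sub_const (p c : ℂ) :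
    Tendsto (fun w : ℂ => w - c) (𝓝[≠] p) (𝓝[≠] (p - c)) := by
  refine tendsto_nhdsWithin_of_tendsto_nhds_of_eventually_within _
    (tendsto_punctured_of_continuousAt (f := fun w : ℂ => w - c) (by fun_prop)) ?_
  filter_upwards [self_mem_nhdsWithin] with w hw h
  exact hw (by simpa using h)

lemma tendsto_punctured_const_sub (p c : ℂ) :
    Tendsto (fun w : ℂ => c - w) (𝓝[≠] p) (𝓝[≠] (c - p)) := by
  refine tendsto_nhdsWithin_of_tendsto_nhds_of_eventually_within _
    (tendsto_punctured_of_continuousAt (f := fun w : ℂ => c - w) (by fun_prop)) ?_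
  filter_upwards [self_mem_nhdsWithin] with w hw h
  exact hw (by simpa using h)

lemma continuousAt_ofReal_cpow_sub {x : ℝ} (hx : 0 < x) (k w : ℂ) :
    ContinuousAt (fun w : ℂ => (x : ℂ) ^ (w - k)) w := by
  have hx' : (x : ℂ) ≠ 0 := by exact_mod_cast hx.ne'
  exact (continuousAt_const_cpow hx').comp (f := fun w : ℂ => w - k) (by fun_prop)

lemma continuousAt_Gamma_const_sub {k : ℝ} {p : ℂ} (hp : p.re < k) :
    ContinuousAt (fun w : ℂ => Complex.Gamma (k - w)) p := by
  refine ContinuousAt.comp (f := fun w : ℂ => (k : ℂ) - w) (g := Complex.Gamma) ?_ (by fun_prop)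
  refine Complex.continuousAt_Gamma _ fun m h => ?_
  have h1 : ((k : ℂ) - p).re = k - p.re := by simp
  rw [h] at h1
  simp at h1
  linarith [(Nat.cast_nonneg m : (0 : ℝ) ≤ m)]

/-- Residues at the poles of `Γ(k - w)`. -/
lemma tendsto_zetaKernel_right {r : ℕ} {k x : ℝ} (hk : r + 1 ≤ k) (hx : 0 < x) (j : ℕ) :
    Tendsto (fun w => (w - (k + j)) * zetaKernel r k x w) (𝓝[≠] (k + j : ℂ))
      (𝓝 (-((-x) ^ j / (j.factorial : ℂ) * zetaPair r (k + j)))) := by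
  have h1 := (tendsto_Gamma_residue j).comp (by
    have := tendsto_punctured_const_sub (k + j : ℂ) k
    rwa [sub_add_cancel_left] at this)
  have h2 := tendsto_punctured_of_continuousAt (continuousAt_ofReal_cpow_sub hx k (k + j))
  have h3 := tendsto_punctured_of_continuousAt (continuousAt_zetaPair (r := r) (u := k + j) (by
    simp; linarith [(Nat.cast_nonneg j : (0 : ℝ) ≤ j)]))
  have h4 := ((h1.mul h2).mul h3).neg
  rw [add_sub_cancel_left, Complex.cpow_natCast] at h4
  have e : -((-1) ^ j / (j.factorial : ℂ) * (x : ℂ) ^ j * zetaPair r (k + j)) =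
      -((-x) ^ j / (j.factorial : ℂ) * zetaPair r (k + j)) := by
    rw [neg_pow (x : ℂ)]; ring
  rw [e] at h4
  refine h4.congr fun w => ?_
  simp only [Function.comp_apply, zetaKernel, zetaPair]
  ring

/-- Residues at the non-positive integers. -/
lemma tendsto_zetaKernel_left {q r : ℕ} (hr : r = 2 * q + 1) {k x : ℝ} (hk : r + 1 ≤ k)
    (hx : 0 < x) (j : ℕ) :
    Tendsto (fun w => (w - (-j)) * zetaKernel r k x w) (𝓝[≠] (-j : ℂ))
      (𝓝 ((-1) ^ (q + 1) * (2 * Real.pi : ℂ) ^ (r + 1) / (x : ℂ) ^ (k : ℂ) *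
        (Complex.Gamma (k + j) / ((r + j).factorial * j.factorial : ℂ) *
          (-(4 * Real.pi ^ 2 / x)) ^ j) * zetaPair r (r + 1 + j))) := by
  have hr0 : (0 : ℝ) ≤ r := Nat.cast_nonneg r
  have hj0 : (0 : ℝ) ≤ j := Nat.cast_nonneg j
  have hpi : (2 * Real.pi : ℂ) ≠ 0 := by
    exact_mod_cast (by positivity : (2 * Real.pi : ℝ) ≠ 0)
  have hx' : (x : ℂ) ≠ 0 := by exact_mod_cast hx.ne'
  -- The pole comes from Γ(w - r), whose argument is -(j + r) at w = -j. For j = 0 the residue is 0,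
  -- because `zetaPair r (r + 1)` contains 1/ζ(1).
  have h1 := (tendsto_Gamma_residue (j + r)).comp (by
    have := tendsto_punctured_sub_const (-j : ℂ) r
    rwa [show (-j : ℂ) - r = -((j + r : ℕ) : ℂ) by push_cast; ring] at this)
  have h2 := tendsto_punctured_of_continuousAt (continuousAt_ofReal_cpow_sub hx k (-j))
  have h3 : Tendsto (fun w : ℂ => zetaPair r (r + 1 - w)) (𝓝[≠] (-j : ℂ))
      (𝓝 (zetaPair r (r + 1 - (-j)))) := by
    refine tendsto_punctured_of_continuousAt (ContinuousAt.comp (f := fun w : ℂ => (r : ℂ) + 1 - w)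
      (g := zetaPair r) (continuousAt_zetaPair ?_) (by fun_prop))
    simp
  have h4 := tendsto_punctured_of_continuousAt (continuousAt_Gamma_const_sub (k := k) (p := -j)
    (by simp; linarith))
  have h5 : Tendsto (fun w : ℂ => (Complex.Gamma (1 - w))⁻¹) (𝓝[≠] (-j : ℂ))
      (𝓝 (Complex.Gamma (1 - (-j)))⁻¹) := by
    refine tendsto_punctured_of_continuousAt (f := fun w : ℂ => (Complex.Gamma (1 - w))⁻¹) ?_
    exact (Complex.differentiable_one_div_Gamma _).continuousAt.comp
      (f := fun w : ℂ => 1 - w) (by fun_prop)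
  have h6 : Tendsto (fun w : ℂ => (2 * Real.pi : ℂ) ^ ((r : ℂ) + 1 - 2 * w)) (𝓝[≠] (-j : ℂ))
      (𝓝 ((2 * Real.pi : ℂ) ^ ((r : ℂ) + 1 - 2 * (-j)))) := by
    refine tendsto_punctured_of_continuousAt
      (f := fun w : ℂ => (2 * Real.pi : ℂ) ^ ((r : ℂ) + 1 - 2 * w)) ?_
    exact (continuousAt_const_cpow hpi).comp (f := fun w : ℂ => (r : ℂ) + 1 - 2 * w) (by fun_prop)
  have h7 := ((((h6.mul h4).mul h1).mul h5).mul h2).mul h3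
  have h8 := h7.const_mul ((-1 : ℂ) ^ q)
  have hG : Complex.Gamma (1 - (-j : ℂ)) = j.factorial := by
    rw [sub_neg_eq_add, add_comm, Complex.Gamma_nat_eq_factorial]
  have hp : (2 * Real.pi : ℂ) ^ ((r : ℂ) + 1 - 2 * (-j)) =
      (2 * Real.pi) ^ (r + 1) * (4 * Real.pi ^ 2) ^ j := by
    rw [show (r : ℂ) + 1 - 2 * (-j) = ((r + 1 + 2 * j : ℕ) : ℂ) by push_cast; ring,
      Complex.cpow_natCast, pow_add, pow_mul]
    congr 2
    ring
  have hxp : (x : ℂ) ^ ((-j : ℂ) - k) = ((x : ℂ) ^ j)⁻¹ / (x : ℂ) ^ (k : ℂ) := by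
    rw [Complex.cpow_sub _ _ hx', Complex.cpow_neg, Complex.cpow_natCast]
  have hsign : (-1 : ℂ) ^ (j + r) = -(-1) ^ j := by
    rw [hr, pow_add, pow_succ, pow_mul]
    norm_num
  have hval : (-1 : ℂ) ^ q * ((2 * Real.pi : ℂ) ^ ((r : ℂ) + 1 - 2 * (-j)) *
      Complex.Gamma (k - (-j)) * ((-1) ^ (j + r) / ((j + r).factorial : ℂ)) *
      (Complex.Gamma (1 - (-j)))⁻¹ * (x : ℂ) ^ ((-j : ℂ) - k) * zetaPair r (r + 1 - (-j))) =
      (-1) ^ (q + 1) * (2 * Real.pi : ℂ) ^ (r + 1) / (x : ℂ) ^ (k : ℂ) *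
        (Complex.Gamma (k + j) / ((r + j).factorial * j.factorial : ℂ) *
          (-(4 * Real.pi ^ 2 / x)) ^ j) * zetaPair r (r + 1 + j) := by
    rw [hG, hp, hxp, hsign, sub_neg_eq_add, sub_neg_eq_add, neg_pow (4 * (Real.pi : ℂ) ^ 2 / x),
      div_pow, pow_succ (-1 : ℂ) q, add_comm j r]
    simp only [div_eq_mul_inv, mul_inv]
    ring
  rw [hval] at h8
  refine h8.congr' ?_
  have hni : ∀ᶠ w in 𝓝[≠] (-j : ℂ), NotInt w := by simpa using eventually_notInt (-j)
  filter_upwards [hni] with w hw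
  rw [zetaKernel_eq_reflected hr k x hw]
  simp only [Function.comp_apply, div_eq_mul_inv]
  push_cast
  ring

/-- This is 1/ζ'(-2m), read off the functional equation: Γ supplies the pole and the cosine equals
(-1)^m. -/
lemma tendsto_mul_zetaRecip_neg_even {m : ℕ} (hm : 1 ≤ m) :
    Tendsto (fun v => (v + (2 * m : ℕ)) * zetaRecip v) (𝓝[≠] (-(2 * m : ℕ) : ℂ))
      (𝓝 ((-1) ^ m * 2 * (2 * Real.pi : ℂ) ^ (2 * m) / ((2 * m).factorial : ℂ) *
        (1 / riemannZeta (2 * m + 1)))) := by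
  have hpi : (2 * Real.pi : ℂ) ≠ 0 := by
    exact_mod_cast (by positivity : (2 * Real.pi : ℝ) ≠ 0)
  have hm0 : (1 : ℝ) ≤ m := by exact_mod_cast hm
  have h1 := tendsto_Gamma_residue (2 * m)
  have h2 : Tendsto (fun v : ℂ => 2 * (2 * Real.pi : ℂ) ^ (-v) * Complex.cos (Real.pi * v / 2) *
      zetaRecip (1 - v)) (𝓝[≠] (-(2 * m : ℕ) : ℂ))
      (𝓝 (2 * (2 * Real.pi : ℂ) ^ (-(-(2 * m : ℕ) : ℂ)) *
        Complex.cos (Real.pi * (-(2 * m : ℕ)) / 2) * zetaRecip (1 - (-(2 * m : ℕ))))) := by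
    refine tendsto_punctured_of_continuousAt (f := fun v : ℂ => 2 * (2 * Real.pi : ℂ) ^ (-v) *
      Complex.cos (Real.pi * v / 2) * zetaRecip (1 - v)) ?_
    have c1 : ContinuousAt (fun v : ℂ => (2 * Real.pi : ℂ) ^ (-v)) (-(2 * m : ℕ) : ℂ) :=
      (continuousAt_const_cpow hpi).comp (f := fun v : ℂ => -v) (by fun_prop)
    have c2 : ContinuousAt (fun v : ℂ => Complex.cos (Real.pi * v / 2)) (-(2 * m : ℕ) : ℂ) := by
      fun_prop
    have c3 : ContinuousAt (fun v : ℂ => zetaRecip (1 - v)) (-(2 * m : ℕ) : ℂ) := by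
      refine ContinuousAt.comp (f := fun v : ℂ => 1 - v) (g := zetaRecip)
        (differentiableAt_zetaRecip_of_one_le_re ?_).continuousAt (by fun_prop)
      simp
    exact ((c1.const_mul 2).mul c2).mul c3
  have h3 := h1.mul h2
  have hcos : Complex.cos (Real.pi * (-(2 * m : ℕ)) / 2) = (-1) ^ m := by
    rw [show (Real.pi : ℂ) * (-(2 * m : ℕ)) / 2 = -(m * Real.pi) by push_cast; ring,
      Complex.cos_neg, ← Complex.ofReal_natCast, ← Complex.ofReal_mul, ← Complex.ofReal_cos,
      Real.cos_nat_mul_pi]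
    push_cast
    rfl
  have hz : zetaRecip (1 - (-(2 * m : ℕ) : ℂ)) = 1 / riemannZeta (2 * m + 1) := by
    rw [show (1 : ℂ) - (-(2 * m : ℕ)) = 2 * m + 1 by push_cast; ring]
    refine zetaRecip_of_ne_one fun h => ?_
    have : (2 * m : ℂ) = 0 := by linear_combination h
    have h' : ((2 * m : ℕ) : ℂ) = 0 := by exact_mod_cast this
    rw [Nat.cast_eq_zero] at h'
    omega
  have heven : (-1 : ℂ) ^ (2 * m) = 1 := by rw [pow_mul]; norm_num
  rw [hcos, hz, neg_neg, Complex.cpow_natCast, heven] at h3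
  have hval : (1 : ℂ) / ((2 * m).factorial : ℂ) * (2 * (2 * Real.pi : ℂ) ^ (2 * m) * (-1) ^ m *
      (1 / riemannZeta (2 * m + 1))) = (-1) ^ m * 2 * (2 * Real.pi : ℂ) ^ (2 * m) /
      ((2 * m).factorial : ℂ) * (1 / riemannZeta (2 * m + 1)) := by ring
  rw [hval] at h3
  refine h3.congr' ?_
  have hni : ∀ᶠ w in 𝓝[≠] (-(2 * m : ℕ) : ℂ), NotInt w := by
    simpa using eventually_notInt (-(2 * m : ℕ))
  filter_upwards [hni] with w hw
  rw [hw.zetaRecip_eq]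
  ring

/-- Residues at `r - 2 m`, `1 ≤ m ≤ r / 2`. -/
lemma tendsto_zetaKernel_mid {r : ℕ} {k x : ℝ} (hk : r + 1 ≤ k) (hx : 0 < x) {m : ℕ}
    (hm : 1 ≤ m) (hmr : 2 * m + 1 ≤ r) :
    Tendsto (fun w => (w - (r - 2 * m)) * zetaKernel r k x w) (𝓝[≠] (r - 2 * m : ℂ))
      (𝓝 (Complex.Gamma (k - r + 2 * m) * (zetaRecip (r - 2 * m) * (1 / riemannZeta (2 * m + 1))) *
        ((-1) ^ m * 2 * (2 * (Real.pi : ℂ)) ^ (2 * m) / ((2 * m).factorial : ℂ)) *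
        (x : ℂ) ^ ((r : ℂ) - k - 2 * m))) := by
  have hm0 : (1 : ℝ) ≤ m := by exact_mod_cast hm
  have hmr' : (2 * m + 1 : ℝ) ≤ r := by exact_mod_cast hmr
  have h1 := (tendsto_mul_zetaRecip_neg_even hm).comp (by
    have := tendsto_punctured_sub_const (r - 2 * m : ℂ) r
    rwa [show (r - 2 * m : ℂ) - r = -((2 * m : ℕ) : ℂ) by push_cast; ring] at this)
  have h2 := tendsto_punctured_of_continuousAt (continuousAt_ofReal_cpow_sub hx k (r - 2 * m))
  have h3 := tendsto_punctured_of_continuousAt (differentiableAt_zetaRecip_of_one_le_re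
    (s := r - 2 * m) (by simp; linarith)).continuousAt
  have h4 := tendsto_punctured_of_continuousAt (continuousAt_Gamma_const_sub (k := k)
    (p := r - 2 * m) (by simp; linarith))
  have h5 := ((h4.mul h2).mul h3).mul h1
  rw [show (k : ℂ) - (r - 2 * m) = k - r + 2 * m by ring,
    show (r : ℂ) - 2 * m - k = r - k - 2 * m by ring] at h5
  refine (h5.congr fun w => ?_).trans (le_of_eq ?_)
  · simp only [Function.comp_apply, zetaKernel]
    push_cast
    ring
  · congr 1
    ring

/-- The summand of the series over the non-trivial zeros. -/
def zeroSummand (r : ℕ) (k x : ℝ) (ρ : ℂ) : ℂ :=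
  (x : ℂ) ^ (ρ - k) / deriv riemannZeta ρ *
    (Complex.Gamma (k - ρ) / riemannZeta (ρ - r) +
      (x : ℂ) ^ r * Complex.Gamma (k - r - ρ) / riemannZeta (r + ρ))

lemma tendsto_zetaKernel_zero {r : ℕ} (hr : 1 ≤ r) {k x : ℝ} (hk : r + 1 ≤ k) (hx : 0 < x)
    {ρ : ℂ} (hρ : ρ ∈ zetaZeros) (hd : deriv riemannZeta ρ ≠ 0) :
    Tendsto (fun w => (w - ρ) * zetaKernel r k x w) (𝓝[≠] ρ)
      (𝓝 ((x : ℂ) ^ (ρ - k) / deriv riemannZeta ρ *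
        (Complex.Gamma (k - ρ) / riemannZeta (ρ - r)))) := by
  have hr' : (1 : ℝ) ≤ r := by exact_mod_cast hr
  have h1 := tendsto_mul_zetaRecip_of_zero hρ hd
  have h2 := tendsto_punctured_of_continuousAt (continuousAt_ofReal_cpow_sub hx k ρ)
  have h3 : Tendsto (fun w : ℂ => zetaRecip (w - r)) (𝓝[≠] ρ) (𝓝 (zetaRecip (ρ - r))) :=
    tendsto_punctured_of_continuousAt (ContinuousAt.comp (f := fun w : ℂ => w - r) (g := zetaRecip)
      (differentiableAt_zetaRecip (Or.inr (riemannZeta_ne_zero_of_sub hρ hr))).continuousAt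
      (by fun_prop))
  have h4 := tendsto_punctured_of_continuousAt (continuousAt_Gamma_const_sub (k := k)
    (p := ρ) (by linarith [hρ.2.2]))
  have h5 := ((h4.mul h2).mul h1).mul h3
  have hne : ρ - r ≠ 1 := by
    intro h
    have h6 : (ρ - r).re = ρ.re - r := by simp
    rw [h] at h6
    simp at h6
    linarith [hρ.2.2]
  rw [zetaRecip_of_ne_one hne] at h5
  refine (h5.congr fun w => ?_).trans (le_of_eq ?_)
  · simp only [zetaKernel]
    ring
  · congr 1
    ring

lemma tendsto_zetaKernel_zero_add {r : ℕ} (hr : 1 ≤ r) {k x : ℝ} (hk : r + 1 ≤ k) (hx : 0 < x)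
    {ρ : ℂ} (hρ : ρ ∈ zetaZeros) (hd : deriv riemannZeta ρ ≠ 0) :
    Tendsto (fun w => (w - (ρ + r)) * zetaKernel r k x w) (𝓝[≠] (ρ + r))
      (𝓝 ((x : ℂ) ^ (ρ - k) / deriv riemannZeta ρ *
        ((x : ℂ) ^ r * Complex.Gamma (k - r - ρ) / riemannZeta (r + ρ)))) := by
  have hr' : (1 : ℝ) ≤ r := by exact_mod_cast hr
  have hx' : (x : ℂ) ≠ 0 := by exact_mod_cast hx.ne'
  have h1 := (tendsto_mul_zetaRecip_of_zero hρ hd).comp (by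
    have := tendsto_punctured_sub_const (ρ + r) r
    rwa [add_sub_cancel_right] at this)
  have h2 := tendsto_punctured_of_continuousAt (continuousAt_ofReal_cpow_sub hx k (ρ + r))
  have h3 := tendsto_punctured_of_continuousAt (differentiableAt_zetaRecip_of_one_le_re
    (s := ρ + r) (by simp; linarith [hρ.2.1])).continuousAt
  have h4 := tendsto_punctured_of_continuousAt (continuousAt_Gamma_const_sub (k := k)
    (p := ρ + r) (by simp; linarith [hρ.2.2]))
  have h5 := ((h4.mul h2).mul h3).mul h1
  have hne : ρ + r ≠ 1 := by
    intro h
    have h6 : (ρ + r).re = ρ.re + r := by simp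
    rw [h] at h6
    simp at h6
    linarith [hρ.2.1]
  have hpow : (x : ℂ) ^ (ρ + r - k) = (x : ℂ) ^ (ρ - k) * (x : ℂ) ^ r := by
    rw [← Complex.cpow_natCast, ← Complex.cpow_add _ _ hx']
    congr 1
    ring
  rw [zetaRecip_of_ne_one hne, hpow, show (k : ℂ) - (ρ + r) = k - r - ρ by ring,
    add_comm ρ (r : ℂ)] at h5
  rw [add_comm ρ (r : ℂ)]
  refine (h5.congr fun w => ?_).trans (le_of_eq ?_)
  · simp only [Function.comp_apply, zetaKernel]
    ring
  · congr 1
    ring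

/-! ### The residue theorem for the kernel and the decay of bracket sums -/

lemma differentiableAt_zetaKernel {r : ℕ} {k x : ℝ} (hx : 0 < x) {w : ℂ}
    (hG : ∀ n : ℕ, w ≠ k + n) (h1 : riemannZeta w ≠ 0) (h2 : riemannZeta (w - r) ≠ 0) :
    DifferentiableAt ℂ (zetaKernel r k x) w := by
  have hx' : (x : ℂ) ≠ 0 := by exact_mod_cast hx.ne'
  have d1 : DifferentiableAt ℂ (fun w : ℂ => Complex.Gamma (k - w)) w := by
    refine DifferentiableAt.comp (g := Complex.Gamma) w (Complex.differentiableAt_Gamma _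
      fun m h => hG m ?_) (by fun_prop)
    linear_combination -h
  have d2 : DifferentiableAt ℂ (fun w : ℂ => (x : ℂ) ^ (w - k)) w :=
    (by fun_prop : DifferentiableAt ℂ (fun w : ℂ => w - (k : ℂ)) w).const_cpow (Or.inl hx')
  have d3 := differentiableAt_zetaRecip (Or.inr h1)
  have d4 : DifferentiableAt ℂ (fun w : ℂ => zetaRecip (w - r)) w :=
    DifferentiableAt.comp (g := zetaRecip) w (differentiableAt_zetaRecip (Or.inr h2)) (by fun_prop)
  exact (d1.mul d2).mul (d3.mul d4)

/-- The residue of a function at a simple pole. -/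
def simpleResidue (F : ℂ → ℂ) (p : ℂ) : ℂ := limUnder (𝓝[≠] p) fun w => (w - p) * F w

lemma simpleResidue_eq {F : ℂ → ℂ} {p c : ℂ}
    (h : Tendsto (fun w => (w - p) * F w) (𝓝[≠] p) (𝓝 c)) : simpleResidue F p = c :=
  h.limUnder_eq

/-- The residue theorem for the kernel; `P` lists the poles outside the two critical strips. -/
theorem rectIntegral_zetaKernel (hsimple : ∀ ρ ∈ zetaZeros, deriv riemannZeta ρ ≠ 0) {r : ℕ}
    (hr : 1 ≤ r) {k x : ℝ} (hk : r + 1 ≤ k) (hx : 0 < x) {a b α β : ℝ} (ha : a < 0)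
    (hb : r + 1 < b) (hαβ : α < β) (Z : Finset ℂ)
    (hZ : ∀ ρ, ρ ∈ Z ↔ ρ ∈ zetaZeros ∧ α < ρ.im ∧ ρ.im < β)
    (hedge : ∀ ρ ∈ zetaZeros, ρ.im ≠ α ∧ ρ.im ≠ β) (P : Finset ℂ)
    (hPint : ∀ p ∈ P, (a < p.re ∧ p.re < b) ∧ (α < p.im ∧ p.im < β))
    (hPres : ∀ p ∈ P, ∃ c, Tendsto (fun w => (w - p) * zetaKernel r k x w) (𝓝[≠] p) (𝓝 c))
    (hPstrip : ∀ p ∈ P, ¬ (0 < p.re ∧ p.re < 1) ∧ ¬ (r < p.re ∧ p.re < r + 1))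
    (hP : ∀ z ∈ Set.uIcc a b ×ℂ Set.uIcc α β, ((∃ n : ℕ, z = k + n) ∨
      (∃ n : ℕ, z = -(2 * ((n : ℂ) + 1))) ∨ ∃ n : ℕ, z = r - 2 * ((n : ℂ) + 1)) → z ∈ P) :
    rectIntegral (zetaKernel r k x) a b α β = 2 * Real.pi * Complex.I *
      (∑ p ∈ P, simpleResidue (zetaKernel r k x) p + ∑ ρ ∈ Z, zeroSummand r k x ρ) := by
  classical
  have hr' : (1 : ℝ) ≤ r := by exact_mod_cast hr
  -- The translates ρ + r are the poles coming from 1/ζ(w - r). Since r ≥ 1, the two critical strips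
  -- are disjoint, and the residues at ρ and ρ + r pair up to `zeroSummand`.
  set Z' : Finset ℂ := Z.image (fun ρ => ρ + r) with hZ'
  have hinj : Set.InjOn (fun ρ : ℂ => ρ + r) Z := fun _ _ _ _ h => by simpa using h
  have hZ'mem : ∀ p ∈ Z', ∃ ρ ∈ Z, p = ρ + r := fun p hp => by
    obtain ⟨ρ, h1, h2⟩ := Finset.mem_image.1 hp
    exact ⟨ρ, h1, h2.symm⟩
  have hdisj1 : Disjoint Z Z' := by
    rw [Finset.disjoint_left]
    intro ρ h1 h2
    obtain ⟨ρ', h3, rfl⟩ := hZ'mem ρ h2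
    have h4 := ((hZ _).1 h1).1.2.2
    have h5 := ((hZ _).1 h3).1.2.1
    simp at h4
    linarith
  have hdisj2 : Disjoint P (Z ∪ Z') := by
    rw [Finset.disjoint_left]
    intro p h1 h2
    rcases Finset.mem_union.1 h2 with h3 | h3
    · exact (hPstrip p h1).1 ((hZ p).1 h3).1.2
    · obtain ⟨ρ, h4, rfl⟩ := hZ'mem p h3
      have h5 := ((hZ _).1 h4).1.2
      exact (hPstrip _ h1).2 ⟨by simp; exact h5.1, by simp; linarith [h5.2]⟩
  have tZ : ∀ ρ ∈ Z, _ := fun ρ hρ =>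
    tendsto_zetaKernel_zero hr hk hx ((hZ ρ).1 hρ).1 (hsimple ρ ((hZ ρ).1 hρ).1)
  have tZ' : ∀ ρ ∈ Z, _ := fun ρ hρ =>
    tendsto_zetaKernel_zero_add hr hk hx ((hZ ρ).1 hρ).1 (hsimple ρ ((hZ ρ).1 hρ).1)
  rw [rectIntegral_eq_sum_residues (by linarith) hαβ (P ∪ (Z ∪ Z'))
    (simpleResidue (zetaKernel r k x)) ?_ (zetaKernel r k x) ?_ ?_]
  · rw [Finset.sum_union hdisj2, Finset.sum_union hdisj1, hZ', Finset.sum_image hinj,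
      ← Finset.sum_add_distrib]
    congr 2
    refine Finset.sum_congr rfl fun ρ hρ => ?_
    rw [simpleResidue_eq (tZ ρ hρ), simpleResidue_eq (tZ' ρ hρ), zeroSummand]
    ring
  · intro p hp
    rcases Finset.mem_union.1 hp with h | h
    · exact hPint p h
    rcases Finset.mem_union.1 h with h | h
    · obtain ⟨h1, h2⟩ := (hZ p).1 h
      exact ⟨⟨by linarith [h1.2.1], by linarith [h1.2.2]⟩, h2⟩
    · obtain ⟨ρ, h4, rfl⟩ := hZ'mem p h
      obtain ⟨h1, h2⟩ := (hZ ρ).1 h4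
      exact ⟨⟨by simp; linarith [h1.2.1], by simp; linarith [h1.2.2]⟩, by simpa using h2⟩
  · intro z hz hzS
    simp only [Finset.mem_union, not_or] at hzS
    obtain ⟨hzP, hzZ, hzZ'⟩ := hzS
    have him := hz.2
    rw [Set.mem_preimage, Set.uIcc_of_le hαβ.le] at him
    have hnZ : ∀ ρ : ℂ, ρ ∈ zetaZeros → ρ.im = z.im → ρ ∈ Z := by
      intro ρ hρ h
      have h2 := hedge ρ hρ
      refine (hZ ρ).2 ⟨hρ, ?_, ?_⟩
      · exact lt_of_le_of_ne (h ▸ him.1) (Ne.symm h2.1)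
      · exact lt_of_le_of_ne (h ▸ him.2) h2.2
    refine differentiableAt_zetaKernel hx (fun n hn => hzP (hP z hz (Or.inl ⟨n, hn⟩))) ?_ ?_
    · intro h
      rcases riemannZeta_eq_zero_cases h with h1 | h1
      · exact hzZ (hnZ z h1 rfl)
      · exact hzP (hP z hz (Or.inr (Or.inl h1)))
    · intro h
      rcases riemannZeta_eq_zero_cases h with h1 | ⟨n, h1⟩
      · refine hzZ' (Finset.mem_image.2 ⟨z - r, hnZ _ h1 (by simp), by ring⟩)
      · exact hzP (hP z hz (Or.inr (Or.inr ⟨n, by linear_combination h1⟩)))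
  · intro p hp
    rcases Finset.mem_union.1 hp with h | h
    · obtain ⟨c, hc⟩ := hPres p h
      rwa [simpleResidue_eq hc]
    rcases Finset.mem_union.1 h with h | h
    · rw [simpleResidue_eq (tZ p h)]
      exact tZ p h
    · obtain ⟨ρ, h4, rfl⟩ := hZ'mem p h
      rw [simpleResidue_eq (tZ' ρ h4)]
      exact tZ' ρ h4

lemma norm_rectIntegral_le {F : ℂ → ℂ} {a b c d H V : ℝ} (hab : a ≤ b)
    (hH : ∀ z : ℂ, a ≤ z.re → z.re ≤ b → (z.im = c ∨ z.im = d) → ‖F z‖ ≤ H)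
    (hV₁ : ‖∫ y : ℝ in c..d, F (a + y * Complex.I)‖ ≤ V)
    (hV₂ : ‖∫ y : ℝ in c..d, F (b + y * Complex.I)‖ ≤ V) :
    ‖rectIntegral F a b c d‖ ≤ 2 * H * (b - a) + 2 * V := by
  have h1 : ∀ e : ℝ, (e = c ∨ e = d) →
      ‖∫ x : ℝ in a..b, F (x + e * Complex.I)‖ ≤ H * (b - a) := by
    intro e he
    rw [← abs_of_nonneg (sub_nonneg.2 hab)]
    refine intervalIntegral.norm_integral_le_of_norm_le_const fun x hx => ?_
    rw [Set.uIoc_of_le hab] at hx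
    exact hH _ (by simpa using hx.1.le) (by simpa using hx.2) (by simpa using he)
  rw [rectIntegral]
  refine (norm_sub_le _ _).trans ?_
  refine (add_le_add_left (norm_add_le _ _) _).trans ?_
  refine (add_le_add_left (add_le_add_left (norm_sub_le _ _) _) _).trans ?_
  rw [norm_mul, norm_mul, Complex.norm_I, one_mul, one_mul]
  linarith [h1 c (Or.inl rfl), h1 d (Or.inr rfl)]

lemma ne_im_of_uncovered {A u : ℝ} (hu : u ∈ uncovered A) {ρ : ℂ} (hρ : ρ ∈ zetaZeros) :
    ρ.im ≠ u := by
  intro h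
  have h1 := hu ρ hρ
  rw [h, sub_self, abs_zero] at h1
  linarith [bracketWidth_pos A ρ]

/-- The heights supplied by the zero-free regions around uncovered ordinates. -/
structure GoodHeights (A T : ℝ) : Prop where
  pos : 0 < A
  one_le : 1 ≤ T
  lower : ∀ t ∈ uncovered A, T ≤ |t| → ∀ u : ℝ, 1 / 2 ≤ u → u ≤ 2 →
      Real.exp (-(|t| / 4)) ≤ ‖riemannZeta (u + t * Complex.I)‖
  exists_uncovered : ∀ t : ℝ, T ≤ |t| → ∃ u ∈ uncovered A, |u - t| ≤ 1 / 4

theorem exists_goodHeights (hsimple : ∀ ρ ∈ zetaZeros, deriv riemannZeta ρ ≠ 0) :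
    ∃ A T : ℝ, GoodHeights A T := by
  obtain ⟨A, T, hA, hT, h⟩ := exists_riemannZeta_lower_bound hsimple
  obtain ⟨T', hT', h'⟩ := exists_uncovered hsimple hA
  exact ⟨A, max T T', hA, hT.trans (le_max_left _ _),
    fun t ht hTt => h t ht ((le_max_left _ _).trans hTt),
    fun t hTt => h' t ((le_max_right _ _).trans hTt)⟩

/-- The bracket sums decay exponentially. -/
theorem exists_norm_bracket_sum_le (hsimple : ∀ ρ ∈ zetaZeros, deriv riemannZeta ρ ≠ 0)
    {A T : ℝ} (hgood : GoodHeights A T) {r : ℕ} (hr : 1 ≤ r) {k x : ℝ} (hk : r + 1 ≤ k)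
    (hx : 0 < x) :
    ∃ C : ℝ, 0 < C ∧ ∀ b : ZetaBracket A, ∀ ρ ∈ b.zeros, T + 2 ≤ |ρ.im| →
      ‖∑ᶠ ρ ∈ b.zeros, zeroSummand r k x ρ‖ ≤ C * Real.exp (-(1 / 2 * |ρ.im|)) := by
  -- At the abscissae -1/2 and k + 1/2 ≥ r + 3/2 the kernel decays at all large heights, so only the
  -- horizontal sides have to be uncovered.
  obtain ⟨C, hC, hF⟩ := exists_norm_zetaKernel_le_exp hgood.one_le hgood.lower r k hx (-1 / 2)
    (k + 1 / 2)
  have hr' : (1 : ℝ) ≤ r := by exact_mod_cast hr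
  have hT1 := hgood.one_le
  have hk0 : 0 < k := by linarith
  refine ⟨C * Real.exp (1 / 2) * (2 * (k + 1) + 4), by positivity, fun b ρ hρ hρT => ?_⟩
  obtain ⟨α, hα, β, hβ, hαβ, h1, h2, hstrip⟩ :=
    bracket_eq_strip hgood.exists_uncovered b hρ (by linarith)
  have hfin := bracket_finite hgood.exists_uncovered b
  rw [finsum_mem_eq_finite_toFinset_sum _ hfin]
  have hαβ2 : β - α ≤ 2 := by linarith [(abs_le.1 h1).1, (abs_le.1 h2).2]
  have hfar : ∀ y : ℝ, α ≤ y → y ≤ β → |ρ.im| - 1 ≤ |y| := by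
    intro y hy1 hy2
    have h3 : |ρ.im - y| ≤ 1 := abs_le.2
      ⟨by linarith [(abs_le.1 h2).2], by linarith [(abs_le.1 h1).1]⟩
    linarith [abs_sub_abs_le_abs_sub ρ.im y]
  -- The rectangle stays away from the real axis, so besides the zeros and their translates it
  -- contains no pole.
  have hres := rectIntegral_zetaKernel hsimple hr hk hx (a := -1 / 2) (b := k + 1 / 2)
    (by norm_num) (by linarith) hαβ hfin.toFinset (fun p => by
      rw [Set.Finite.mem_toFinset]
      exact ⟨fun h => ⟨h.1, (hstrip p h.1).1 h⟩, fun h => (hstrip p h.1).2 h.2⟩)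
    (fun p hp => ⟨ne_im_of_uncovered hα hp, ne_im_of_uncovered hβ hp⟩) ∅ (by simp) (by simp)
    (by simp) (fun z hz h => by
      exfalso
      have him := hz.2
      rw [Set.mem_preimage, Set.uIcc_of_le hαβ.le] at him
      have h3 := hfar z.im him.1 him.2
      have h4 : z.im = 0 := by
        rcases h with ⟨n, rfl⟩ | ⟨n, rfl⟩ | ⟨n, rfl⟩ <;> simp
      rw [h4, abs_zero] at h3
      linarith)
  rw [Finset.sum_empty, zero_add] at hres
  set M : ℝ := C * Real.exp (1 / 2) * Real.exp (-(1 / 2 * |ρ.im|)) with hM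
  have hFM : ∀ z : ℂ, -1 / 2 ≤ z.re → z.re ≤ k + 1 / 2 → α ≤ z.im → z.im ≤ β →
      (z.im ∈ uncovered A ∨ r + 3 / 2 ≤ z.re ∨ z.re ≤ -1 / 2) → ‖zetaKernel r k x z‖ ≤ M := by
    intro z z1 z2 z3 z4 z5
    have h3 := hfar z.im z3 z4
    refine (hF z z1 z2 (by linarith) z5).trans ?_
    rw [hM, mul_assoc, ← Real.exp_add]
    gcongr
    linarith
  have hvert : ∀ e : ℝ, (e = -1 / 2 ∨ e = k + 1 / 2) →
      ‖∫ y : ℝ in α..β, zetaKernel r k x (e + y * Complex.I)‖ ≤ M * 2 := by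
    intro e he
    refine (intervalIntegral.norm_integral_le_of_norm_le_const (C := M) fun y hy => ?_).trans ?_
    · rw [Set.uIoc_of_le hαβ.le] at hy
      refine hFM _ ?_ ?_ (by simpa using hy.1.le) (by simpa using hy.2) ?_
      · rcases he with rfl | rfl
        · simp
        · simp; linarith
      · rcases he with rfl | rfl
        · simp; linarith
        · simp
      · right
        rcases he with rfl | rfl
        · right; simp
        · left; simp; linarith
    · rw [abs_of_pos (by linarith)]
      have : 0 ≤ M := by positivity
      gcongr
  have hnorm := norm_rectIntegral_le (F := zetaKernel r k x) (a := -1 / 2) (b := k + 1 / 2)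
    (c := α) (d := β) (H := M) (V := M * 2) (by linarith) (fun z z1 z2 z3 => by
      refine hFM z z1 z2 ?_ ?_ (Or.inl ?_) <;> rcases z3 with h | h <;> rw [h]
      · exact hαβ.le
      · exact hαβ.le
      · exact hα
      · exact hβ) (hvert _ (Or.inl rfl)) (hvert _ (Or.inr rfl))
  rw [hres, norm_mul] at hnorm
  have h2pi : 1 ≤ ‖(2 * Real.pi * Complex.I : ℂ)‖ := by
    simp [abs_of_pos Real.pi_pos]
    linarith [Real.pi_gt_three]
  refine (le_mul_of_one_le_left (norm_nonneg _) h2pi).trans (hnorm.trans (le_of_eq ?_))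
  rw [hM]
  ring

/-- Choosing one zero in each bracket injects the brackets into the zeros, so the exponential bound
is dominated by the convergent sum over all zeros. -/
theorem summable_bracket_sum (hsimple : ∀ ρ ∈ zetaZeros, deriv riemannZeta ρ ≠ 0)
    {A T : ℝ} (hgood : GoodHeights A T) {r : ℕ} (hr : 1 ≤ r) {k x : ℝ} (hk : r + 1 ≤ k)
    (hx : 0 < x) :
    Summable fun b : ZetaBracket A => ∑ᶠ ρ ∈ b.zeros, zeroSummand r k x ρ := by
  obtain ⟨C, hC, h⟩ := exists_norm_bracket_sum_le hsimple hgood hr hk hx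
  choose φ hφ using fun b : ZetaBracket A => bracket_nonempty b
  have hinj : Function.Injective (fun b : ZetaBracket A => (⟨φ b, (hφ b).1⟩ : zetaZeros)) := by
    intro b b' hbb
    have h1 : φ b = φ b' := congrArg Subtype.val hbb
    exact bracket_eq_of_mem (hφ b) (h1 ▸ hφ b')
  have hs := ((summable_exp_neg_abs_im hsimple).comp_injective hinj).mul_left C
  refine Summable.of_norm_bounded_eventually hs ?_
  have hfin : {b : ZetaBracket A | |(φ b).im| ≤ T + 2}.Finite := by
    refine Set.Finite.of_finite_image (f := φ) ((finite_zetaZeros_abs_im_le (T + 2)).subset ?_) ?_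
    · rintro _ ⟨b, hb, rfl⟩
      exact ⟨(hφ b).1, hb⟩
    · intro b _ b' _ hbb
      exact hinj (Subtype.ext hbb)
  filter_upwards [hfin.compl_mem_cofinite] with b hb
  exact h b (φ b) (hφ b) (not_le.1 (show ¬ |(φ b).im| ≤ T + 2 from hb)).le

/-! ### Integrals along the vertical sides -/

/-- With ε = π/2 - 1 the decay on this line is e^(-|y|), which beats every power. The majorant 1 /
(1 + y²) bounds integrals over all intervals by the same constant K π. -/
lemma exists_norm_Gamma_mul_pow_le (N : ℕ) :
    ∃ K : ℝ, 0 < K ∧ ∀ y : ℝ,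
      ‖Complex.Gamma (-1 / 2 + y * Complex.I)‖ * (1 + |y|) ^ N ≤ K * (1 + y ^ 2)⁻¹ := by
  have hpi := Real.pi_gt_three
  obtain ⟨C, hC, h⟩ := exists_norm_Gamma_le_exp (-1 / 2) (-1 / 2) (ε := Real.pi / 2 - 1)
    (by linarith)
  have hcont : ContinuousOn (fun y : ℝ => ‖Complex.Gamma (-1 / 2 + y * Complex.I)‖)
      (Set.Icc (-1) 1) := by
    intro y _
    refine ContinuousAt.continuousWithinAt (ContinuousAt.norm ?_)
    refine ContinuousAt.comp (g := Complex.Gamma) (Complex.differentiableAt_Gamma _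
      fun m hm => ?_).continuousAt (by fun_prop)
    have h1 : ((-1 / 2 : ℝ) : ℝ) = -m := by simpa using congrArg Complex.re hm
    have h2 : (2 * m : ℝ) = 1 := by linarith
    have h3 : 2 * m = 1 := by exact_mod_cast h2
    omega
  obtain ⟨B, hB⟩ := isCompact_Icc.bddAbove_image hcont
  have hB0 : 0 ≤ B :=
    (norm_nonneg _).trans (hB ⟨0, ⟨by norm_num, by norm_num⟩, rfl⟩)
  have hb : ∀ y : ℝ, ‖Complex.Gamma (-1 / 2 + y * Complex.I)‖ ≤
      (C + B * Real.exp 1) * Real.exp (-|y|) := by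
    intro y
    rcases le_total 1 |y| with hy | hy
    · have h1 := h (-1 / 2 + y * Complex.I) (by simp) (by simp) (by simpa using hy)
      have h2 : (-1 / 2 + y * Complex.I : ℂ).im = y := by simp
      rw [h2] at h1
      refine h1.trans ?_
      have h3 : -((Real.pi / 2 - (Real.pi / 2 - 1)) * |y|) = -|y| := by ring
      rw [h3]
      gcongr
      have := Real.exp_pos 1
      nlinarith
    · have h1 : ‖Complex.Gamma (-1 / 2 + y * Complex.I)‖ ≤ B :=
        hB ⟨y, ⟨(abs_le.1 hy).1, (abs_le.1 hy).2⟩, rfl⟩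
      have h2 : (1 : ℝ) ≤ Real.exp 1 * Real.exp (-|y|) := by
        rw [← Real.exp_add]
        exact Real.one_le_exp (by linarith)
      have h3 := Real.exp_pos (-|y|)
      nlinarith [mul_le_mul_of_nonneg_left h2 hB0, mul_pos hC h3]
  refine ⟨(C + B * Real.exp 1) * ((N + 2).factorial * Real.exp 1), by positivity, fun y => ?_⟩
  rw [← div_eq_mul_inv, le_div_iff₀ (by positivity)]
  have h4 : (1 + |y|) ^ (N + 2) ≤ (N + 2).factorial * (Real.exp 1 * Real.exp |y|) := by
    have := pow_le_factorial_mul_exp (ε := 1) (x := 1 + |y|) one_pos (by positivity) (N + 2)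
    rwa [one_pow, div_one, one_mul, Real.exp_add] at this
  have h5 : 1 + y ^ 2 ≤ (1 + |y|) ^ 2 := by nlinarith [abs_nonneg y, sq_abs y]
  calc ‖Complex.Gamma (-1 / 2 + y * Complex.I)‖ * (1 + |y|) ^ N * (1 + y ^ 2)
      ≤ (C + B * Real.exp 1) * Real.exp (-|y|) * (1 + |y|) ^ N * (1 + |y|) ^ 2 := by
        gcongr; exact hb y
    _ = (C + B * Real.exp 1) * Real.exp (-|y|) * (1 + |y|) ^ (N + 2) := by ring
    _ ≤ (C + B * Real.exp 1) * Real.exp (-|y|) *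
        ((N + 2).factorial * (Real.exp 1 * Real.exp |y|)) := by gcongr
    _ = (C + B * Real.exp 1) * ((N + 2).factorial * Real.exp 1) *
        (Real.exp (-|y|) * Real.exp |y|) := by ring
    _ = _ := by rw [← Real.exp_add]; simp

lemma norm_integral_le_pi_mul {F : ℝ → ℂ} {M a b : ℝ} (hab : a ≤ b)
    (hF : ∀ y, ‖F y‖ ≤ M * (1 + y ^ 2)⁻¹) : ‖∫ y in a..b, F y‖ ≤ M * Real.pi := by
  have hM : 0 ≤ M := by simpa using (norm_nonneg _).trans (hF 0)
  have h1 : Continuous fun y : ℝ => M * (1 + y ^ 2)⁻¹ :=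
    continuous_const.mul (Continuous.inv₀ (by fun_prop) fun y => by positivity)
  refine (intervalIntegral.norm_integral_le_of_norm_le hab (Eventually.of_forall fun y _ => hF y)
    (h1.intervalIntegrable _ _)).trans ?_
  rw [intervalIntegral.integral_const_mul, integral_inv_one_add_sq]
  gcongr
  linarith [Real.arctan_lt_pi_div_two b, Real.neg_pi_div_two_lt_arctan a]

lemma norm_zetaPair_le {B : ℝ} (hB1 : 1 ≤ B) (hB : ∀ s : ℂ, 3 / 2 ≤ s.re → ‖zetaRecip s‖ ≤ B)
    {r : ℕ} {u : ℂ}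
    (hu : r + 3 / 2 ≤ u.re) : ‖zetaPair r u‖ ≤ B ^ 2 := by
  rw [zetaPair, norm_mul, sq]
  have hr : (0 : ℝ) ≤ r := by positivity
  exact mul_le_mul (hB _ (by linarith)) (hB _ (by simp; linarith)) (norm_nonneg _) (by linarith)

/-- On this line the Gamma factor is Γ(-1/2 - iy - J), smaller by at least J! than Γ(-1/2 - iy),
while 1/(ζ(w) ζ(w - r)) stays bounded. -/
lemma exists_norm_integral_zetaKernel_right_le {r : ℕ} {k x : ℝ} (hk : r + 1 ≤ k)
    (hx : 0 < x) : ∃ C : ℝ, 0 < C ∧ ∀ J : ℕ, ∀ a b : ℝ, a ≤ b →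
      ‖∫ y in a..b, zetaKernel r k x ((k + J + 1 / 2 : ℝ) + y * Complex.I)‖ ≤
        C * (x ^ J / J.factorial) := by
  obtain ⟨K, hK, hΓ⟩ := exists_norm_Gamma_mul_pow_le 0
  obtain ⟨B, hB1, hB⟩ := exists_norm_zetaRecip_le
  refine ⟨K * x ^ (1 / 2 : ℝ) * B ^ 2 * Real.pi, by have := Real.pi_pos; positivity,
    fun J a b hab => ?_⟩
  refine (norm_integral_le_pi_mul (M := K * x ^ (1 / 2 : ℝ) * B ^ 2 * (x ^ J / J.factorial)) hab
    fun y => ?_).trans (le_of_eq (by ring))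
  have h1 : (k : ℂ) - ((k + J + 1 / 2 : ℝ) + y * Complex.I) =
      (-1 / 2 + (-y : ℝ) * Complex.I) - J := by push_cast; ring
  have h2 := norm_Gamma_sub_nat_le (z := -1 / 2 + (-y : ℝ) * Complex.I) (by simp; norm_num) J
  have h3 := hΓ (-y)
  rw [pow_zero, mul_one, neg_sq] at h3
  have h4 := norm_zetaPair_le hB1 hB (r := r) (u := (k + J + 1 / 2 : ℝ) + y * Complex.I)
    (by simp; linarith [(Nat.cast_nonneg J : (0 : ℝ) ≤ J)])
  have h5 : ‖(x : ℂ) ^ (((k + J + 1 / 2 : ℝ) + y * Complex.I : ℂ) - k)‖ =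
      x ^ J * x ^ (1 / 2 : ℝ) := by
    rw [Complex.norm_cpow_eq_rpow_re_of_pos hx, ← Real.rpow_natCast, ← Real.rpow_add hx]
    congr 1
    simp
    ring
  rw [zetaPair] at h4
  rw [zetaKernel, norm_mul, norm_mul, h1, h5]
  calc _ ≤ K * (1 + y ^ 2)⁻¹ / J.factorial * (x ^ J * x ^ (1 / 2 : ℝ)) * B ^ 2 := by
        refine mul_le_mul (mul_le_mul_of_nonneg_right ?_ (by positivity)) h4 (norm_nonneg _)
          (by positivity)
        exact h2.trans (by gcongr)
    _ = _ := by ring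

/-- In the reflected form Γ(w - r) yields 1 / J!, and Γ(k - w) / Γ(1 - w) costs a power ⌈k⌉ of a
quantity linear in J and |y|. The J-part of it is absorbed by e^J, whence the factor e in the base;
(2π)² and 1/x come from the two power functions. -/
lemma exists_norm_integral_zetaKernel_left_le {q r : ℕ} (hr : r = 2 * q + 1) {k x : ℝ}
    (hk : r + 1 ≤ k) (hx : 0 < x) : ∃ C : ℝ, 0 < C ∧ ∀ J : ℕ, ∀ a b : ℝ, a ≤ b →
      ‖∫ y in a..b, zetaKernel r k x ((-J - 1 / 2 : ℝ) + y * Complex.I)‖ ≤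
        C * (((2 * Real.pi) ^ 2 * Real.exp 1 / x) ^ J / J.factorial) := by
  set n := ⌈k⌉₊ with hn
  have hkn : k ≤ n := Nat.le_ceil k
  have hpi := Real.pi_pos
  have hr1 : (1 : ℝ) ≤ r := by
    have : 1 ≤ r := by omega
    exact_mod_cast this
  obtain ⟨K, hK, hΓ⟩ := exists_norm_Gamma_mul_pow_le n
  obtain ⟨B, hB1, hB⟩ := exists_norm_zetaRecip_le
  set M₀ := (2 * Real.pi) ^ (r + 2) * (n.factorial * Real.exp (3 / 2 + n)) * K *
    x ^ (-1 / 2 - k : ℝ) * B ^ 2 with hM₀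
  refine ⟨M₀ * Real.pi, by positivity, fun J a b hab => ?_⟩
  refine (norm_integral_le_pi_mul
    (M := M₀ * (((2 * Real.pi) ^ 2 * Real.exp 1 / x) ^ J / J.factorial)) hab
    fun y => ?_).trans (le_of_eq (by ring))
  set w : ℂ := (-J - 1 / 2 : ℝ) + y * Complex.I with hw
  have hJ : (0 : ℝ) ≤ J := Nat.cast_nonneg J
  have hre : w.re = -J - 1 / 2 := by simp [hw]
  have hnot : NotInt w := by
    intro m hm
    have h1 : (-J - 1 / 2 : ℝ) = m := by simpa [hre] using congrArg Complex.re hm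
    have h2 : (-2 * J - 1 : ℝ) = 2 * m := by linarith
    have h3 : (-2 * J - 1 : ℤ) = 2 * m := by exact_mod_cast h2
    omega
  have e1 : (k : ℂ) - w = (1 - w) + (k - 1 : ℝ) := by push_cast; ring
  have e2 : w - r = (-1 / 2 + y * Complex.I) - (J + r : ℕ) := by
    rw [hw]; push_cast; ring
  have b1 : ‖Complex.Gamma (k - w)‖ ≤
      (n.factorial * Real.exp (3 / 2 + n) * Real.exp 1 ^ J * (1 + |y|) ^ n) *
        ‖Complex.Gamma (1 - w)‖ := by
    rw [e1]
    refine (norm_Gamma_add_le (n := n) (by simp [hre]; linarith) (by simp [hre]; linarith)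
      (by linarith)).trans ?_
    gcongr
    have h1 : ‖1 - w‖ ≤ J + 3 / 2 + |y| := by
      refine (Complex.norm_le_abs_re_add_abs_im _).trans (add_le_add (le_of_eq ?_) (le_of_eq ?_))
      · rw [Complex.sub_re, hre, abs_of_pos] <;> simp <;> linarith
      · simp [hw]
    have h2 := pow_le_factorial_mul_exp (ε := 1) (x := J + 3 / 2 + n) one_pos (by positivity) n
    rw [one_pow, div_one, one_mul] at h2
    calc (‖1 - w‖ + n) ^ n ≤ ((J + 3 / 2 + n) * (1 + |y|)) ^ n := by
          gcongr
          have : (0 : ℝ) ≤ n := Nat.cast_nonneg n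
          nlinarith [abs_nonneg y]
      _ = (J + 3 / 2 + n) ^ n * (1 + |y|) ^ n := mul_pow _ _ _
      _ ≤ (n.factorial * Real.exp (J + 3 / 2 + n)) * (1 + |y|) ^ n := by gcongr
      _ = _ := by
        rw [← Real.exp_nat_mul, mul_one, show (J : ℝ) + 3 / 2 + n = (3 / 2 + n) + J by ring,
          Real.exp_add]
        ring
  have b2 : ‖Complex.Gamma (w - r)‖ ≤
      ‖Complex.Gamma (-1 / 2 + y * Complex.I)‖ / J.factorial := by
    rw [e2]
    refine (norm_Gamma_sub_nat_le (by simp; norm_num) _).trans ?_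
    gcongr
    omega
  have b3 := hΓ y
  have b4 := norm_zetaPair_le hB1 hB (r := r) (u := (r + 1 - w))
    (by simp [hre]; linarith)
  have b5 : ‖(2 * Real.pi : ℂ) ^ ((r : ℂ) + 1 - 2 * w)‖ =
      (2 * Real.pi) ^ (r + 2) * ((2 * Real.pi) ^ 2) ^ J := by
    have : (2 * Real.pi : ℂ) = ((2 * Real.pi : ℝ) : ℂ) := by push_cast; ring
    rw [this, Complex.norm_cpow_eq_rpow_re_of_pos (by positivity), ← pow_mul, ← pow_add,
      ← Real.rpow_natCast]
    congr 1
    simp [hre]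
    ring
  have b6 : ‖(x : ℂ) ^ (w - k)‖ = x ^ (-1 / 2 - k : ℝ) / x ^ J := by
    rw [Complex.norm_cpow_eq_rpow_re_of_pos hx, ← Real.rpow_natCast, ← Real.rpow_sub hx]
    congr 1
    simp [hre]
    ring
  have b7 : 0 < ‖Complex.Gamma (1 - w)‖ :=
    norm_pos_iff.2 (Complex.Gamma_ne_zero_of_re_pos (by simp [hre]; linarith))
  rw [zetaKernel_eq_reflected hr k x hnot]
  simp only [norm_mul, norm_div, norm_pow, norm_neg, norm_one, one_pow, one_mul]
  rw [b5, b6]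
  calc _ ≤ (2 * Real.pi) ^ (r + 2) * ((2 * Real.pi) ^ 2) ^ J *
        ((n.factorial * Real.exp (3 / 2 + n) * Real.exp 1 ^ J * (1 + |y|) ^ n) *
        ‖Complex.Gamma (1 - w)‖) * (‖Complex.Gamma (-1 / 2 + y * Complex.I)‖ / J.factorial) /
        ‖Complex.Gamma (1 - w)‖ * (x ^ (-1 / 2 - k : ℝ) / x ^ J) * B ^ 2 := by gcongr
    _ = (2 * Real.pi) ^ (r + 2) * ((2 * Real.pi) ^ 2) ^ J *
        (n.factorial * Real.exp (3 / 2 + n) * Real.exp 1 ^ J) *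
        (‖Complex.Gamma (-1 / 2 + y * Complex.I)‖ * (1 + |y|) ^ n) / J.factorial *
        (x ^ (-1 / 2 - k : ℝ) / x ^ J) * B ^ 2 := by
        field_simp
    _ ≤ (2 * Real.pi) ^ (r + 2) * ((2 * Real.pi) ^ 2) ^ J *
        (n.factorial * Real.exp (3 / 2 + n) * Real.exp 1 ^ J) *
        (K * (1 + y ^ 2)⁻¹) / J.factorial *
        (x ^ (-1 / 2 - k : ℝ) / x ^ J) * B ^ 2 := by gcongr
    _ = _ := by
        rw [hM₀, div_pow, mul_pow]
        ring

/-! ### The sum of all residues -/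

/-- Minus the residue of the kernel at `k + j`. -/
def rightTerm (r : ℕ) (k x : ℝ) (j : ℕ) : ℂ :=
  (-x : ℂ) ^ j / (j.factorial : ℂ) * zetaPair r (k + j)

/-- The residue of the kernel at `-j`. -/
def leftTerm (r : ℕ) (k x : ℝ) (j : ℕ) : ℂ :=
  (-1) ^ ((r + 1) / 2) * (2 * Real.pi : ℂ) ^ (r + 1) / (x : ℂ) ^ (k : ℂ) *
    (Complex.Gamma (k + j) / ((r + j).factorial * j.factorial : ℂ) *
      (-(4 * Real.pi ^ 2 / x)) ^ j) * zetaPair r (r + 1 + j)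

/-- The residue of the kernel at `r - 2 m`. -/
def midTerm (r : ℕ) (k x : ℝ) (m : ℕ) : ℂ :=
  Complex.Gamma (k - r + 2 * m) * (zetaRecip (r - 2 * m) * (1 / riemannZeta (2 * m + 1))) *
    ((-1) ^ m * 2 * (2 * (Real.pi : ℂ)) ^ (2 * m) / ((2 * m).factorial : ℂ)) *
    (x : ℂ) ^ ((r : ℂ) - k - 2 * m)

/-- The real poles are among the points -j, r - 2m > 0 and k + j. The offsets 1/2 of the sides
select exactly the indices j ≤ J and keep poles off the contour. Some listed points, such as 0, are
regular and carry residue 0. -/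
lemma exists_poles {r : ℕ} (hr : Odd r) {k x : ℝ} (hk : r + 1 ≤ k) (hx : 0 < x) (J : ℕ) :
    ∃ P : Finset ℂ, (∀ p ∈ P, p.im = 0 ∧ -J ≤ p.re ∧ p.re ≤ k + J) ∧
      (∀ p ∈ P, ∃ c, Tendsto (fun w => (w - p) * zetaKernel r k x w) (𝓝[≠] p) (𝓝 c)) ∧
      (∀ p ∈ P, ¬ (0 < p.re ∧ p.re < 1) ∧ ¬ (r < p.re ∧ p.re < r + 1)) ∧
      (∀ z : ℂ, -J - 1 / 2 ≤ z.re → z.re ≤ k + J + 1 / 2 → ((∃ n : ℕ, z = k + n) ∨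
        (∃ n : ℕ, z = -(2 * ((n : ℂ) + 1))) ∨ ∃ n : ℕ, z = r - 2 * ((n : ℂ) + 1)) → z ∈ P) ∧
      ∑ p ∈ P, simpleResidue (zetaKernel r k x) p =
        ∑ j ∈ Finset.range (J + 1), leftTerm r k x j + ∑ m ∈ Finset.Icc 1 (r / 2), midTerm r k x m -
          ∑ j ∈ Finset.range (J + 1), rightTerm r k x j := by
  classical
  obtain ⟨q, hq⟩ := hr
  have hq' : (r + 1) / 2 = q + 1 := by omega
  have hr1 : (1 : ℝ) ≤ r := by
    have : 1 ≤ r := by omega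
    exact_mod_cast this
  have hJ : (0 : ℝ) ≤ J := Nat.cast_nonneg J
  have tR := tendsto_zetaKernel_right hk hx
  have tL := tendsto_zetaKernel_left hq hk hx
  have tM : ∀ m ∈ Finset.Icc 1 (r / 2), _ := fun m hm => tendsto_zetaKernel_mid hk hx
    (m := m) (Finset.mem_Icc.1 hm).1 (by have := (Finset.mem_Icc.1 hm).2; omega)
  set PR : Finset ℂ := (Finset.range (J + 1)).image (fun j : ℕ => (k + j : ℂ)) with hPR
  set PL : Finset ℂ := (Finset.range (J + 1)).image (fun j : ℕ => (-j : ℂ)) with hPL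
  set PM : Finset ℂ := (Finset.Icc 1 (r / 2)).image (fun m : ℕ => (r - 2 * m : ℂ)) with hPM
  have mR : ∀ p ∈ PR, ∃ j : ℕ, j ≤ J ∧ p = k + j := fun p hp => by
    obtain ⟨j, h1, h2⟩ := Finset.mem_image.1 hp
    exact ⟨j, by simpa [Nat.lt_succ_iff] using h1, h2.symm⟩
  have mL : ∀ p ∈ PL, ∃ j : ℕ, j ≤ J ∧ p = -j := fun p hp => by
    obtain ⟨j, h1, h2⟩ := Finset.mem_image.1 hp
    exact ⟨j, by simpa [Nat.lt_succ_iff] using h1, h2.symm⟩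
  have mM : ∀ p ∈ PM, ∃ m : ℕ, 1 ≤ m ∧ 2 * m + 1 ≤ r ∧ p = r - 2 * m := fun p hp => by
    obtain ⟨m, h1, h2⟩ := Finset.mem_image.1 hp
    have h3 := Finset.mem_Icc.1 h1
    exact ⟨m, h3.1, by omega, h2.symm⟩
  have bR : ∀ p ∈ PR, p.im = 0 ∧ r + 1 ≤ p.re ∧ p.re ≤ k + J := fun p hp => by
    obtain ⟨j, h1, rfl⟩ := mR p hp
    have h2 : (j : ℝ) ≤ J := by exact_mod_cast h1
    have h3 : (0 : ℝ) ≤ j := Nat.cast_nonneg j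
    refine ⟨by simp, ?_, ?_⟩ <;> simp <;> linarith
  have bL : ∀ p ∈ PL, p.im = 0 ∧ -J ≤ p.re ∧ p.re ≤ 0 := fun p hp => by
    obtain ⟨j, h1, rfl⟩ := mL p hp
    have h2 : (j : ℝ) ≤ J := by exact_mod_cast h1
    have h3 : (0 : ℝ) ≤ j := Nat.cast_nonneg j
    refine ⟨by simp, ?_, ?_⟩ <;> simp
    linarith
  have bM : ∀ p ∈ PM, p.im = 0 ∧ 1 ≤ p.re ∧ p.re ≤ r - 2 := fun p hp => by
    obtain ⟨m, h1, h2, rfl⟩ := mM p hp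
    have h3 : (1 : ℝ) ≤ m := by exact_mod_cast h1
    have h4 : (2 * m + 1 : ℝ) ≤ r := by exact_mod_cast h2
    refine ⟨by simp, ?_, ?_⟩ <;> simp <;> linarith
  have d1 : Disjoint PL PM := Finset.disjoint_left.2 fun p h1 h2 => by
    linarith [(bL p h1).2.2, (bM p h2).2.1]
  have d2 : Disjoint (PL ∪ PM) PR := Finset.disjoint_left.2 fun p h1 h2 => by
    rcases Finset.mem_union.1 h1 with h | h
    · linarith [(bL p h).2.2, (bR p h2).2.1]
    · linarith [(bM p h).2.2, (bR p h2).2.1]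
  refine ⟨(PL ∪ PM) ∪ PR, ?_, ?_, ?_, ?_, ?_⟩
  · intro p hp
    rcases Finset.mem_union.1 hp with h | h
    · rcases Finset.mem_union.1 h with h | h
      · exact ⟨(bL p h).1, (bL p h).2.1, by linarith [(bL p h).2.2]⟩
      · exact ⟨(bM p h).1, by linarith [(bM p h).2.1], by linarith [(bM p h).2.2]⟩
    · exact ⟨(bR p h).1, by linarith [(bR p h).2.1], (bR p h).2.2⟩
  · intro p hp
    rcases Finset.mem_union.1 hp with h | h
    · rcases Finset.mem_union.1 h with h | h
      · obtain ⟨j, _, rfl⟩ := mL p h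
        exact ⟨_, tL j⟩
      · obtain ⟨m, h1, h2, rfl⟩ := mM p h
        exact ⟨_, tendsto_zetaKernel_mid hk hx h1 h2⟩
    · obtain ⟨j, _, rfl⟩ := mR p h
      exact ⟨_, tR j⟩
  · intro p hp
    rcases Finset.mem_union.1 hp with h | h
    · rcases Finset.mem_union.1 h with h | h
      · have := (bL p h).2.2
        exact ⟨fun h => by linarith [h.1], fun h => by linarith [h.1]⟩
      · have := (bM p h).2
        exact ⟨fun h => by linarith [h.2], fun h => by linarith [h.1]⟩
    · have := (bR p h).2.1
      exact ⟨fun h => by linarith [h.2], fun h => by linarith [h.2]⟩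
  · have hL : ∀ n : ℕ, (-J - 1 / 2 : ℝ) ≤ -n → (-n : ℂ) ∈ PL := fun n hn => by
      have h1 : (2 * n : ℝ) ≤ 2 * J + 1 := by linarith
      have h2 : 2 * n ≤ 2 * J + 1 := by exact_mod_cast h1
      exact Finset.mem_image.2 ⟨n, Finset.mem_range.2 (by omega), rfl⟩
    rintro z hz1 hz2 (⟨n, rfl⟩ | ⟨n, rfl⟩ | ⟨n, rfl⟩)
    · have h1 : (2 * n : ℝ) ≤ 2 * J + 1 := by
        simp at hz2
        linarith
      have h2 : 2 * n ≤ 2 * J + 1 := by exact_mod_cast h1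
      exact Finset.mem_union_right _
        (Finset.mem_image.2 ⟨n, Finset.mem_range.2 (by omega), rfl⟩)
    · refine Finset.mem_union_left _ (Finset.mem_union_left _ ?_)
      have e : (-(2 * ((n : ℂ) + 1)) : ℂ) = -((2 * (n + 1) : ℕ) : ℂ) := by push_cast; ring
      rw [e] at hz1 ⊢
      exact hL _ (by simpa using hz1)
    · refine Finset.mem_union_left _ ?_
      rcases le_or_gt (n + 1) (r / 2) with h | h
      · refine Finset.mem_union_right _ (Finset.mem_image.2 ⟨n + 1, Finset.mem_Icc.2 ⟨by omega, h⟩,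
          ?_⟩)
        push_cast
        ring
      · refine Finset.mem_union_left _ ?_
        have e : ((r : ℂ) - 2 * ((n : ℂ) + 1)) = -((2 * (n + 1) - r : ℕ) : ℂ) := by
          rw [Nat.cast_sub (by omega)]
          push_cast
          ring
        rw [e] at hz1 ⊢
        exact hL _ (by simpa using hz1)
  · rw [Finset.sum_union d2, Finset.sum_union d1, hPL, hPM, hPR,
      Finset.sum_image (fun a _ b _ h => by simpa using h),
      Finset.sum_image (fun a _ b _ h => by simpa using h),
      Finset.sum_image (fun a _ b _ h => by simpa using h), sub_eq_add_neg,
      ← Finset.sum_neg_distrib]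
    congr 1
    · congr 1
      · refine Finset.sum_congr rfl fun j _ => ?_
        rw [simpleResidue_eq (tL j), leftTerm, hq']
      · exact Finset.sum_congr rfl fun m hm => simpleResidue_eq (tM m hm)
    · exact Finset.sum_congr rfl fun j _ => simpleResidue_eq (tR j)

/-- The zeros between two symmetric uncovered ordinates form a finite union of brackets. -/
lemma exists_finset_brackets {A T₀ : ℝ}
    (hT : ∀ t : ℝ, T₀ ≤ |t| → ∃ u ∈ uncovered A, |u - t| ≤ 1 / 4) {u : ℝ}
    (hu : u ∈ uncovered A) (f : ℂ → ℂ) :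
    ∃ (𝓑 : Finset (ZetaBracket A)) (Z : Finset ℂ),
      (∀ b : ZetaBracket A, ∀ ρ ∈ b.zeros, |ρ.im| < u → b ∈ 𝓑) ∧
      (∀ ρ, ρ ∈ Z ↔ ρ ∈ zetaZeros ∧ -u < ρ.im ∧ ρ.im < u) ∧
      ∑ ρ ∈ Z, f ρ = ∑ b ∈ 𝓑, ∑ᶠ ρ ∈ b.zeros, f ρ := by
  classical
  have hnu := neg_mem_uncovered hu
  have hsep : ∀ b : ZetaBracket A, ∀ ρ₁ ∈ b.zeros, ∀ ρ₂ ∈ b.zeros,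
      |ρ₁.im| < u → |ρ₂.im| < u := by
    intro b ρ₁ h₁ ρ₂ h₂ h
    rw [abs_lt] at h ⊢
    have h3 := (bracket_not_separated_of_uncovered hnu h₁ h₂).not.1 (not_lt.2 h.1.le)
    exact ⟨lt_of_le_of_ne (not_lt.1 h3) (ne_im_of_uncovered hnu h₂.1).symm,
      (bracket_not_separated_of_uncovered hu h₁ h₂).1 h.2⟩
  choose φ hφ using fun b : ZetaBracket A => bracket_nonempty b
  have hfin : {b : ZetaBracket A | |(φ b).im| < u}.Finite := by
    refine Set.Finite.of_finite_image (f := φ) ((finite_zetaZeros_abs_im_le u).subset ?_) ?_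
    · rintro _ ⟨b, hb, rfl⟩
      exact ⟨(hφ b).1, le_of_lt hb⟩
    · intro b _ b' _ hbb
      exact bracket_eq_of_mem (hφ b) (hbb ▸ hφ b')
  refine ⟨hfin.toFinset, hfin.toFinset.biUnion fun b => (bracket_finite hT b).toFinset, ?_, ?_, ?_⟩
  · intro b ρ hρ h
    exact hfin.mem_toFinset.2 (hsep b ρ hρ _ (hφ b) h)
  · intro ρ
    rw [Finset.mem_biUnion, ← abs_lt]
    constructor
    · rintro ⟨b, hb, hρ⟩
      rw [Set.Finite.mem_toFinset] at hρ hb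
      exact ⟨hρ.1, hsep b _ (hφ b) _ hρ hb⟩
    · rintro ⟨h1, h2⟩
      have hρ : ρ ∈ ZetaBracket.zeros (Quotient.mk (bracketSetoid A) ⟨ρ, h1⟩) := ⟨h1, rfl⟩
      exact ⟨_, hfin.mem_toFinset.2 (hsep _ ρ hρ _ (hφ _) h2),
        (bracket_finite hT _).mem_toFinset.2 hρ⟩
  · rw [Finset.sum_biUnion]
    · exact Finset.sum_congr rfl fun b _ =>
        (finsum_mem_eq_finite_toFinset_sum _ (bracket_finite hT b)).symm
    · intro b _ b' _ hne
      rw [Function.onFun, Finset.disjoint_left]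
      intro ρ h1 h2
      rw [Set.Finite.mem_toFinset] at h1 h2
      exact hne (bracket_eq_of_mem h1 h2)

theorem tendsto_residue_sums (hsimple : ∀ ρ ∈ zetaZeros, deriv riemannZeta ρ ≠ 0)
    {A T : ℝ} (hgood : GoodHeights A T) {r : ℕ} (hr : Odd r) {k x : ℝ} (hk : r + 1 ≤ k)
    (hx : 0 < x) :
    Tendsto (fun J : ℕ => ∑ j ∈ Finset.range (J + 1), leftTerm r k x j +
      ∑ m ∈ Finset.Icc 1 (r / 2), midTerm r k x m -
      ∑ j ∈ Finset.range (J + 1), rightTerm r k x j) atTop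
      (𝓝 (-∑' b : ZetaBracket A, ∑ᶠ ρ ∈ b.zeros, zeroSummand r k x ρ)) := by
  have hr1 : 1 ≤ r := hr.pos
  have hr1' : (1 : ℝ) ≤ r := by exact_mod_cast hr1
  obtain ⟨q, hq⟩ := id hr
  have hsum := (summable_bracket_sum hsimple hgood hr1 hk hx).hasSum
  set Z := ∑' b : ZetaBracket A, ∑ᶠ ρ ∈ b.zeros, zeroSummand r k x ρ with hZ
  have hT1 := hgood.one_le
  choose u hu hut using fun n : ℕ => hgood.exists_uncovered (T + 1 + n) (by
    rw [abs_of_nonneg (by positivity)]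
    linarith [(Nat.cast_nonneg n : (0 : ℝ) ≤ n)])
  have hun : ∀ n : ℕ, T + n ≤ u n := fun n => by linarith [(abs_le.1 (hut n)).1]
  have hutop : Tendsto u atTop atTop :=
    tendsto_atTop_mono hun (tendsto_atTop_add_const_left _ _ tendsto_natCast_atTop_atTop)
  choose 𝓑 ZF h𝓑 hZF hsumZF using fun n =>
    exists_finset_brackets hgood.exists_uncovered (hu n) (zeroSummand r k x)
  -- The brackets below the heights u n exhaust all brackets, so the unconditional sum may be taken
  -- along them.
  have h𝓑top : Tendsto 𝓑 atTop atTop := by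
    rw [tendsto_atTop]
    intro s
    have h1 : ∀ b ∈ s, ∀ᶠ n in atTop, b ∈ 𝓑 n := by
      intro b _
      obtain ⟨ρ, hρ⟩ := bracket_nonempty b
      filter_upwards [hutop.eventually_gt_atTop |ρ.im|] with n hn
      exact h𝓑 n b ρ hρ hn
    filter_upwards [(Finset.eventually_all s).2 h1] with n hn b hb
    exact hn b hb
  have hlim := hsum.comp h𝓑top
  obtain ⟨C₁, hC₁, hR⟩ := exists_norm_integral_zetaKernel_right_le hk hx
  obtain ⟨C₂, hC₂, hL⟩ := exists_norm_integral_zetaKernel_left_le hq hk hx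
  set Y := (2 * Real.pi) ^ 2 * Real.exp 1 / x with hY
  have hY0 : 0 ≤ Y := by positivity
  -- J is fixed while the height tends to infinity: the horizontal sides vanish, the zeros
  -- contribute Z in the limit, and only the vertical sides are left as error.
  have hkey : ∀ J : ℕ, ‖(∑ j ∈ Finset.range (J + 1), leftTerm r k x j +
      ∑ m ∈ Finset.Icc 1 (r / 2), midTerm r k x m -
      ∑ j ∈ Finset.range (J + 1), rightTerm r k x j) - -Z‖ ≤
      2 * (C₁ * (x ^ J / J.factorial) + C₂ * (Y ^ J / J.factorial)) := by
    intro J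
    have hJ : (0 : ℝ) ≤ J := Nat.cast_nonneg J
    obtain ⟨P, hP1, hP2, hP3, hP4, hP5⟩ := exists_poles hr hk hx J
    rw [← hP5, sub_neg_eq_add]
    obtain ⟨C, hC, hF⟩ := exists_norm_zetaKernel_le_exp hgood.one_le hgood.lower r k hx
      (-J - 1 / 2) (k + J + 1 / 2)
    have hab : (-J - 1 / 2 : ℝ) ≤ k + J + 1 / 2 := by linarith
    have hle : ∀ n, ‖∑ p ∈ P, simpleResidue (zetaKernel r k x) p +
        ∑ b ∈ 𝓑 n, ∑ᶠ ρ ∈ b.zeros, zeroSummand r k x ρ‖ ≤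
        2 * (C * Real.exp (-(1 / 2 * u n))) * (k + J + 1 / 2 - (-J - 1 / 2)) +
          2 * (C₁ * (x ^ J / J.factorial) + C₂ * (Y ^ J / J.factorial)) := by
      intro n
      have hu0 : 1 ≤ u n := by linarith [hun n, (Nat.cast_nonneg n : (0 : ℝ) ≤ n)]
      have hneg : -u n < u n := by linarith
      have hres := rectIntegral_zetaKernel hsimple hr1 hk hx (a := -J - 1 / 2)
        (b := k + J + 1 / 2) (by linarith) (by linarith) hneg (ZF n) (hZF n)
        (fun ρ hρ => ⟨ne_im_of_uncovered (neg_mem_uncovered (hu n)) hρ,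
          ne_im_of_uncovered (hu n) hρ⟩) P
        (fun p hp => by
          obtain ⟨h1, h2, h3⟩ := hP1 p hp
          rw [h1]
          exact ⟨⟨by linarith, by linarith⟩, by linarith, by linarith⟩) hP2 hP3
        (fun z hz h => by
          have h1 := hz.1
          rw [Set.mem_preimage, Set.uIcc_of_le hab] at h1
          exact hP4 z h1.1 h1.2 h)
      have hnorm := norm_rectIntegral_le (F := zetaKernel r k x) (a := -J - 1 / 2)
        (b := k + J + 1 / 2) (c := -u n) (d := u n) (H := C * Real.exp (-(1 / 2 * u n)))
        (V := C₁ * (x ^ J / J.factorial) + C₂ * (Y ^ J / J.factorial)) hab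
        (fun z z1 z2 z3 => by
          have habs : |z.im| = u n := by
            rcases z3 with h | h <;> rw [h]
            · rw [abs_neg, abs_of_pos (by linarith)]
            · rw [abs_of_pos (by linarith)]
          rw [← habs]
          refine hF z z1 z2 ?_ (Or.inl ?_)
          · rw [habs]
            linarith [hun n, (Nat.cast_nonneg n : (0 : ℝ) ≤ n)]
          · rcases z3 with h | h <;> rw [h]
            · exact neg_mem_uncovered (hu n)
            · exact hu n)
        ((hL J _ _ hneg.le).trans (le_add_of_nonneg_left (by positivity)))
        ((hR J _ _ hneg.le).trans (le_add_of_nonneg_right (by positivity)))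
      rw [hres, norm_mul, hsumZF n] at hnorm
      have h2pi : 1 ≤ ‖(2 * Real.pi * Complex.I : ℂ)‖ := by
        simp [abs_of_pos Real.pi_pos]
        linarith [Real.pi_gt_three]
      exact (le_mul_of_one_le_left (norm_nonneg _) h2pi).trans hnorm
    refine le_of_tendsto_of_tendsto' (hlim.const_add _).norm ?_ hle
    have hexp : Tendsto (fun n => Real.exp (-(1 / 2 * u n))) atTop (𝓝 0) :=
      Real.tendsto_exp_neg_atTop_nhds_zero.comp (hutop.const_mul_atTop (by norm_num))
    have := ((hexp.const_mul C).const_mul 2).mul_const (k + J + 1 / 2 - (-J - 1 / 2))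
    have := this.add_const (2 * (C₁ * (x ^ J / J.factorial) + C₂ * (Y ^ J / J.factorial)))
    simpa using this
  rw [tendsto_iff_norm_sub_tendsto_zero]
  refine squeeze_zero (fun _ => norm_nonneg _) hkey ?_
  have h1 := (FloorSemiring.tendsto_pow_div_factorial_atTop x).const_mul C₁
  have h2 := (FloorSemiring.tendsto_pow_div_factorial_atTop Y).const_mul C₂
  simpa using (h1.add h2).const_mul 2

/-! ### A Tauberian theorem -/

open scoped FourierTransform in
/-- Averages of a bounded function against a band-limited kernel tend to zero when its Laplace
transform extends continuously to the closed half-plane. -/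
lemma tendsto_integral_mul_fourier_of_laplace {s : ℝ → ℂ} (hs : Measurable s) {B : ℝ}
    (hB : ∀ u, ‖s u‖ ≤ B) (hneg : ∀ u < 0, s u = 0) {G : ℂ → ℂ}
    (hG : ContinuousOn G {z | 0 ≤ z.re})
    (hL : ∀ ε : ℝ, 0 < ε → ∀ ξ : ℝ,
      𝓕 (fun u : ℝ => Real.exp (-ε * u) • s u) ξ = G (ε + 2 * Real.pi * ξ * Complex.I))
    (φ : SchwartzMap ℝ ℂ) (hφ : HasCompactSupport φ) :
    Tendsto (fun v : ℝ => ∫ u : ℝ, s (u + v) * 𝓕 φ u) atTop (𝓝 0) := by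
  have hB0 : 0 ≤ B := (norm_nonneg _).trans (hB 0)
  have hsε : ∀ ε : ℝ, 0 ≤ ε → ∀ u, ‖Real.exp (-ε * u) • s u‖ ≤ B := by
    intro ε hε u
    rcases lt_or_ge u 0 with h | h
    · simpa [hneg u h] using hB0
    · rw [norm_smul, Real.norm_eq_abs, Real.abs_exp]
      have : Real.exp (-ε * u) ≤ 1 := Real.exp_le_one_iff.2 (by nlinarith)
      nlinarith [hB u, norm_nonneg (s u), Real.exp_pos (-ε * u)]
  have hmeas : ∀ ε : ℝ, Measurable fun u => Real.exp (-ε * u) • s u := fun ε =>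
    (by fun_prop : Measurable fun u : ℝ => Real.exp (-ε * u)).smul hs
  have hint : ∀ ε : ℝ, 0 < ε → MeasureTheory.Integrable fun u => Real.exp (-ε * u) • s u := by
    intro ε hε
    have h1 : MeasureTheory.IntegrableOn (fun u : ℝ => B * Real.exp (-ε * u)) (Set.Ioi 0) :=
      (exp_neg_integrableOn_Ioi 0 hε).const_mul B
    have h2 : MeasureTheory.IntegrableOn (fun u => Real.exp (-ε * u) • s u) (Set.Ioi 0) := by
      refine MeasureTheory.Integrable.mono' h1 (hmeas ε).aestronglyMeasurable
        (Eventually.of_forall fun u => ?_)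
      rw [norm_smul, Real.norm_eq_abs, Real.abs_exp, mul_comm]
      gcongr
      exact hB u
    have h3 : MeasureTheory.IntegrableOn (fun u => Real.exp (-ε * u) • s u) (Set.Ici 0) :=
      (integrableOn_Ici_iff_integrableOn_Ioi (by simp)).2 h2
    refine h3.integrable_of_forall_notMem_eq_zero fun u hu => ?_
    rw [hneg u (not_le.1 hu), smul_zero]
  -- This is ∫ f̂ φ = ∫ f φ̂ for the damped translate of s; the translation appears as a character
  -- on the transform side.
  have hswap : ∀ ε : ℝ, 0 < ε → ∀ v : ℝ,
      ∫ ξ : ℝ, (Real.fourierChar (v * ξ) • G (ε + 2 * Real.pi * ξ * Complex.I)) * φ ξ =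
        ∫ u : ℝ, (Real.exp (-ε * (u + v)) • s (u + v)) * 𝓕 φ u := by
    intro ε hε v
    have h1 := VectorFourier.integral_fourierIntegral_smul_eq_flip (L := innerₗ ℝ)
      Real.continuous_fourierChar continuous_inner ((hint ε hε).comp_add_right v)
      (φ.integrable (μ := MeasureTheory.volume))
    have h2 := VectorFourier.fourierIntegral_comp_add_right Real.fourierChar
      (MeasureTheory.volume (α := ℝ)) (innerₗ ℝ) (fun u => Real.exp (-ε * u) • s u) v
    simp only [Function.comp_def] at h2
    rw [h2] at h1
    simp only [smul_eq_mul, flip_innerₗ] at h1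
    refine Eq.trans ?_ h1
    refine MeasureTheory.integral_congr_ae (Eventually.of_forall fun ξ => ?_)
    simp only
    rw [← hL ε hε ξ, show (innerₗ ℝ) v ξ = v * ξ by simp [mul_comm]]
    rfl
  -- G is continuous only on Re z ≥ 0; the absolute value gives a function continuous on the whole
  -- plane, so compactness bounds it near ε = 0.
  have hline : Continuous fun p : ℝ × ℝ => ((|p.1| : ℝ) + 2 * Real.pi * p.2 * Complex.I : ℂ) := by
    fun_prop
  have hGc : Continuous fun p : ℝ × ℝ => G ((|p.1| : ℝ) + 2 * Real.pi * p.2 * Complex.I) := by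
    refine hG.comp_continuous hline fun p => ?_
    simp
  have hlim : ∀ v : ℝ, ∫ ξ : ℝ, (Real.fourierChar (v * ξ) • G (2 * Real.pi * ξ * Complex.I)) * φ ξ =
      ∫ u : ℝ, s (u + v) * 𝓕 φ u := by
    intro v
    obtain ⟨M, hM⟩ := ((isCompact_Icc (a := (0 : ℝ)) (b := 1)).prod hφ.isCompact).bddAbove_image
      (f := fun p => ‖G ((|p.1| : ℝ) + 2 * Real.pi * p.2 * Complex.I)‖) hGc.norm.continuousOn
    have hev : ∀ᶠ ε : ℝ in 𝓝[>] 0, 0 < ε ∧ ε ≤ 1 := by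
      filter_upwards [Ioc_mem_nhdsGT (one_pos : (0 : ℝ) < 1)] with ε hε using hε
    have t1 : Tendsto (fun ε : ℝ => ∫ ξ : ℝ,
        (Real.fourierChar (v * ξ) • G (ε + 2 * Real.pi * ξ * Complex.I)) * φ ξ) (𝓝[>] 0)
        (𝓝 (∫ ξ : ℝ, (Real.fourierChar (v * ξ) • G (2 * Real.pi * ξ * Complex.I)) * φ ξ)) := by
      refine MeasureTheory.tendsto_integral_filter_of_dominated_convergence
        (fun ξ => M * ‖φ ξ‖) ?_ ?_ (φ.integrable.norm.const_mul M) ?_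
      · filter_upwards [hev] with ε hε
        have hc : Continuous fun ξ : ℝ => G (ε + 2 * Real.pi * ξ * Complex.I) := by
          have := hGc.comp (by fun_prop : Continuous fun ξ : ℝ => (ε, ξ))
          simpa [Function.comp_def, abs_of_pos hε.1] using this
        refine Continuous.aestronglyMeasurable (Continuous.mul ?_ φ.continuous)
        exact (Real.continuous_fourierChar.comp (by fun_prop)).smul hc
      · filter_upwards [hev] with ε hε
        refine Eventually.of_forall fun ξ => ?_
        rw [norm_mul, Circle.norm_smul]
        by_cases hξ : ξ ∈ tsupport φ
        · gcongr
          have := hM ⟨(ε, ξ), ⟨⟨hε.1.le, hε.2⟩, hξ⟩, rfl⟩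
          simpa [abs_of_pos hε.1] using this
        · simp [image_eq_zero_of_notMem_tsupport hξ]
      · refine Eventually.of_forall fun ξ => ?_
        have h1 : Tendsto (fun ε : ℝ => G (ε + 2 * Real.pi * ξ * Complex.I)) (𝓝[>] 0)
            (𝓝 (G (2 * Real.pi * ξ * Complex.I))) := by
          have h2 := (hGc.comp (by fun_prop : Continuous fun ε : ℝ => (ε, ξ))).tendsto 0
          simp only [Function.comp_def, abs_zero, Complex.ofReal_zero, zero_add] at h2
          refine (h2.mono_left nhdsWithin_le_nhds).congr' ?_
          filter_upwards [hev] with ε hε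
          rw [abs_of_pos hε.1]
        exact (h1.const_smul _).mul_const _
    have t2 : Tendsto (fun ε : ℝ => ∫ u : ℝ, (Real.exp (-ε * (u + v)) • s (u + v)) * 𝓕 φ u)
        (𝓝[>] 0) (𝓝 (∫ u : ℝ, s (u + v) * 𝓕 φ u)) := by
      refine MeasureTheory.tendsto_integral_filter_of_dominated_convergence
        (fun ξ => B * ‖𝓕 φ ξ‖) ?_ ?_ ((𝓕 φ).integrable.norm.const_mul B) ?_
      · refine Eventually.of_forall fun ε => ?_
        exact (((hmeas ε).comp (measurable_add_const v)).aestronglyMeasurable).mul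
          (𝓕 φ).continuous.aestronglyMeasurable
      · filter_upwards [hev] with ε hε
        refine Eventually.of_forall fun u => ?_
        rw [norm_mul]
        gcongr
        exact hsε ε hε.1.le (u + v)
      · refine Eventually.of_forall fun u => ?_
        have h1 : Tendsto (fun ε : ℝ => Real.exp (-ε * (u + v))) (𝓝[>] 0) (𝓝 1) := by
          have h2 : Continuous fun ε : ℝ => Real.exp (-ε * (u + v)) := by fun_prop
          simpa using (h2.tendsto 0).mono_left nhdsWithin_le_nhds
        simpa using (h1.smul_const (s (u + v))).mul_const (𝓕 φ u)
    refine tendsto_nhds_unique (t1.congr' ?_) t2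
    filter_upwards [hev] with ε hε using hswap ε hε.1 v
  -- After ε → 0 the average of s around v is a Fourier integral at frequency v up to sign, and
  -- Riemann–Lebesgue applies.
  have hRL := (Real.tendsto_integral_exp_smul_cocompact
    (fun ξ : ℝ => G (2 * Real.pi * ξ * Complex.I) * φ ξ)).comp
    (tendsto_neg_atTop_atBot.mono_right atBot_le_cocompact)
  refine hRL.congr fun v => ?_
  rw [← hlim v, Function.comp_apply]
  refine MeasureTheory.integral_congr_ae (Eventually.of_forall fun ξ => ?_)
  simp only
  rw [smul_mul_assoc]
  congr 3
  ring

open scoped FourierTransform in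
/-- A Tauberian theorem for bounded slowly oscillating functions. -/
theorem tendsto_zero_of_laplace {s : ℝ → ℂ} (hs : Measurable s) {B : ℝ}
    (hB : ∀ u, ‖s u‖ ≤ B) (hneg : ∀ u < 0, s u = 0) {G : ℂ → ℂ}
    (hG : ContinuousOn G {z | 0 ≤ z.re})
    (hL : ∀ ε : ℝ, 0 < ε → ∀ ξ : ℝ,
      𝓕 (fun u : ℝ => Real.exp (-ε * u) • s u) ξ = G (ε + 2 * Real.pi * ξ * Complex.I))
    {C : ℝ} (hosc : ∀ v ≥ 1, ∀ h, ‖s v - s (v + h)‖ ≤ C * (|h| + Real.exp (-(v / 2)))) :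
    Tendsto s atTop (𝓝 0) := by
  have hC : 0 ≤ C := by
    have h1 := (norm_nonneg _).trans (hosc 1 le_rfl 0)
    rw [abs_zero, zero_add] at h1
    exact nonneg_of_mul_nonneg_left h1 (Real.exp_pos _)
  -- The bump satisfies φ(0) = 1, so its Fourier transform is an averaging kernel of integral 1 with
  -- finite first absolute moment.
  obtain ⟨b⟩ : Nonempty (ContDiffBump (0 : ℝ)) := inferInstance
  have hcs : HasCompactSupport fun x : ℝ => ((b x : ℝ) : ℂ) :=
    b.hasCompactSupport.comp_left Complex.ofReal_zero
  have hsm : ContDiff ℝ (⊤ : ℕ∞) fun x : ℝ => ((b x : ℝ) : ℂ) :=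
    Complex.ofRealCLM.contDiff.comp b.contDiff
  set φ : SchwartzMap ℝ ℂ := hcs.toSchwartzMap hsm with hφdef
  have hφ : HasCompactSupport φ := hcs
  have hφ1 : ∫ u, 𝓕 φ u = 1 := by
    have h1 : 𝓕⁻ (𝓕 φ) = φ := FourierTransform.fourierInv_fourier_eq φ
    have h2 := congrArg (fun f : SchwartzMap ℝ ℂ => f 0) h1
    have h3 : φ 0 = 1 := by
      have : b 0 = 1 := b.one_of_mem_closedBall (Metric.mem_closedBall_self b.rIn_pos.le)
      show ((b 0 : ℝ) : ℂ) = 1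
      rw [this, Complex.ofReal_one]
    simp only [h3] at h2
    rw [← h2, SchwartzMap.fourierInv_coe, Real.fourierInv_eq]
    simp
  set I₀ := ∫ u, ‖𝓕 φ u‖ with hI₀
  set I₁ := ∫ u : ℝ, |u| * ‖𝓕 φ u‖ with hI₁
  have hi₀ : MeasureTheory.Integrable fun u => ‖𝓕 φ u‖ := (𝓕 φ).integrable.norm
  have hi₁ : MeasureTheory.Integrable fun u : ℝ => |u| * ‖𝓕 φ u‖ := by
    refine ((𝓕 φ).integrable_pow_mul MeasureTheory.volume 1).congr
      (Eventually.of_forall fun u => ?_)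
    simp only [pow_one, Real.norm_eq_abs]
  have hI₁0 : 0 ≤ I₁ := MeasureTheory.integral_nonneg fun u => by positivity
  rw [tendsto_zero_iff_norm_tendsto_zero]
  -- Rescaling s by l narrows the averaging kernel to width 1 / l and preserves the hypotheses of
  -- the preceding lemma.
  have hmain : ∀ l : ℝ, 0 < l → Tendsto (fun v : ℝ => ∫ u : ℝ, s (v + u / l) * 𝓕 φ u) atTop
      (𝓝 0) := by
    intro l hl
    have h := tendsto_integral_mul_fourier_of_laplace (s := fun u => s (u / l))
      (G := fun z => l * G (l * z)) (hs.comp (measurable_id.div_const l)) (fun u => hB _)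
      (fun u hu => hneg _ (div_neg_of_neg_of_pos hu hl)) ?_ ?_ φ hφ
    · refine (h.comp (tendsto_id.const_mul_atTop hl)).congr fun v => ?_
      refine MeasureTheory.integral_congr_ae (Eventually.of_forall fun u => ?_)
      simp only [id]
      rw [show (u + l * v) / l = v + u / l by field_simp; ring]
    · refine continuousOn_const.mul (hG.comp (by fun_prop) fun z hz => ?_)
      have : 0 ≤ l * z.re := mul_nonneg hl.le hz
      simpa using this
    · intro ε hε ξ
      have h1 := hL (l * ε) (by positivity) (l * ξ)
      rw [Real.fourier_real_eq] at h1 ⊢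
      have h2 := MeasureTheory.Measure.integral_comp_div (fun u : ℝ =>
        Real.fourierChar (-(u * (l * ξ))) • (Real.exp (-(l * ε) * u) • s u)) l
      rw [h1, abs_of_pos hl] at h2
      convert h2 using 1
      · refine MeasureTheory.integral_congr_ae (Eventually.of_forall fun u => ?_)
        simp only
        rw [show u / l * (l * ξ) = u * ξ by field_simp,
          show -(l * ε) * (u / l) = -ε * u by field_simp]
      · rw [Complex.real_smul]
        congr 2
        push_cast
        ring
  -- Slow oscillation compares s(v) with its average at width 1 / l; the error is O(1 / l) plus a
  -- term that vanishes as v → ∞.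
  have hbound : ∀ l : ℝ, 0 < l → ∀ v ≥ 1, ‖s v‖ ≤ ‖∫ u : ℝ, s (v + u / l) * 𝓕 φ u‖ +
      C * (I₁ / l + Real.exp (-(v / 2)) * I₀) := by
    intro l hl v hv
    have hint : ∀ f : ℝ → ℂ, Measurable f → (∀ u, ‖f u‖ ≤ B) →
        MeasureTheory.Integrable fun u => f u * 𝓕 φ u := fun f hf hfB =>
      (𝓕 φ).integrable.bdd_mul hf.aestronglyMeasurable (Eventually.of_forall hfB)
    have i1 := hint (fun _ => s v) measurable_const (fun _ => hB v)
    have i2 := hint (fun u => s (v + u / l)) (hs.comp (by fun_prop)) (fun u => hB _)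
    have h1 : s v = (∫ u : ℝ, s (v + u / l) * 𝓕 φ u) +
        ∫ u : ℝ, (s v - s (v + u / l)) * 𝓕 φ u := by
      simp_rw [sub_mul]
      rw [MeasureTheory.integral_sub i1 i2, MeasureTheory.integral_const_mul, hφ1]
      ring
    have h2 : ‖∫ u : ℝ, (s v - s (v + u / l)) * 𝓕 φ u‖ ≤
        ∫ u : ℝ, C * (|u| * ‖𝓕 φ u‖ / l + Real.exp (-(v / 2)) * ‖𝓕 φ u‖) := by
      refine MeasureTheory.norm_integral_le_of_norm_le
        (((hi₁.div_const l).add (hi₀.const_mul _)).const_mul C)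
        (Eventually.of_forall fun u => ?_)
      rw [norm_mul]
      refine (mul_le_mul_of_nonneg_right (hosc v hv _) (norm_nonneg _)).trans (le_of_eq ?_)
      rw [abs_div, abs_of_pos hl]
      ring
    rw [MeasureTheory.integral_const_mul, MeasureTheory.integral_add (hi₁.div_const l)
      (hi₀.const_mul _), MeasureTheory.integral_div, MeasureTheory.integral_const_mul] at h2
    have h3 := norm_add_le (∫ u : ℝ, s (v + u / l) * 𝓕 φ u)
      (∫ u : ℝ, (s v - s (v + u / l)) * 𝓕 φ u)
    rw [← h1] at h3
    exact h3.trans (add_le_add le_rfl h2)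
  rw [Metric.tendsto_atTop]
  intro δ hδ
  obtain ⟨l, hl, hlδ⟩ : ∃ l : ℝ, 0 < l ∧ C * (I₁ / l) < δ / 2 := by
    refine ⟨(C * I₁ + 1) * 2 / δ, by positivity, ?_⟩
    have : 0 ≤ C * I₁ := by positivity
    rw [div_div_eq_mul_div, ← mul_div_assoc, div_lt_iff₀ (by positivity)]
    nlinarith
  have hexp : Tendsto (fun v : ℝ => Real.exp (-(v / 2))) atTop (𝓝 0) :=
    Real.tendsto_exp_neg_atTop_nhds_zero.comp (tendsto_id.atTop_div_const (by norm_num))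
  have hT := (hmain l hl).norm.add (((hexp.mul_const I₀).const_add (I₁ / l)).const_mul C)
  rw [norm_zero, zero_mul, add_zero, zero_add] at hT
  have := hT.eventually (gt_mem_nhds (show C * (I₁ / l) < δ by linarith))
  obtain ⟨N, hN⟩ := (this.and (eventually_ge_atTop 1)).exists_forall_of_atTop
  refine ⟨N, fun v hv => ?_⟩
  obtain ⟨h1, h2⟩ := hN v hv
  rw [Real.dist_0_eq_abs, abs_norm]
  exact (hbound l hl v h2).trans_lt h1

/-! ### The prime number theorem for ∑ μ(n)/n -/

/-- The summatory function of `μ(n) / n`. -/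
def moebiusSum (t : ℝ) : ℂ :=
  ∑ k ∈ Finset.Icc 1 ⌊t⌋₊, ((ArithmeticFunction.moebius k : ℤ) : ℂ) / k

lemma measurable_moebiusSum : Measurable moebiusSum :=
  (measurable_from_nat (f := fun n : ℕ =>
    ∑ k ∈ Finset.Icc 1 n, ((ArithmeticFunction.moebius k : ℤ) : ℂ) / k)).comp Nat.measurable_floor

lemma moebiusSum_of_lt_one {t : ℝ} (ht : t < 1) : moebiusSum t = 0 := by
  rw [moebiusSum, Nat.floor_eq_zero.2 ht]
  simp

lemma norm_moebius_le_one (n : ℕ) : ‖((ArithmeticFunction.moebius n : ℤ) : ℂ)‖ ≤ 1 := by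
  rw [Complex.norm_intCast]
  exact_mod_cast ArithmeticFunction.abs_moebius_le_one

/-- From ∑ μ(n) ⌊N/n⌋ = 1, dropping the floors changes the sum by at most N, so N times the sum is
at most N + 1 ≤ 2N in modulus. -/
lemma norm_sum_moebius_div_le (N : ℕ) :
    ‖∑ k ∈ Finset.Icc 1 N, ((ArithmeticFunction.moebius k : ℤ) : ℂ) / k‖ ≤ 2 := by
  rcases Nat.eq_zero_or_pos N with rfl | hN
  · simp
  have hN' : (1 : ℝ) ≤ N := by exact_mod_cast hN
  have h1 : ∑ n ∈ Finset.Icc 1 N, ((ArithmeticFunction.moebius n : ℤ) : ℂ) * ((N / n : ℕ) : ℂ) =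
      1 := by
    have h := ArithmeticFunction.sum_Ioc_mul_zeta_eq_sum
      (ArithmeticFunction.moebius : ArithmeticFunction ℤ) N
    rw [ArithmeticFunction.moebius_mul_coe_zeta,
      Finset.sum_eq_single_of_mem 1 (Finset.mem_Ioc.2 ⟨one_pos, hN⟩) (fun b _ hb =>
        ArithmeticFunction.one_apply_ne hb), ArithmeticFunction.one_one] at h
    have h2 := congrArg (Int.cast : ℤ → ℂ) h.symm
    rw [show Finset.Ioc 0 N = Finset.Icc 1 N by ext; simp [Nat.succ_le_iff]] at h2
    rw [← Int.cast_one, ← h2, Int.cast_sum]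
    refine Finset.sum_congr rfl fun n _ => ?_
    rw [Int.cast_mul]
    congr 1
  have h2 : (N : ℂ) * ∑ k ∈ Finset.Icc 1 N, ((ArithmeticFunction.moebius k : ℤ) : ℂ) / k =
      1 + ∑ k ∈ Finset.Icc 1 N,
        ((ArithmeticFunction.moebius k : ℤ) : ℂ) * ((((N : ℝ) / k - (N / k : ℕ) : ℝ)) : ℂ) := by
    rw [← h1, ← Finset.sum_add_distrib, Finset.mul_sum]
    refine Finset.sum_congr rfl fun k _ => ?_
    push_cast
    ring
  have h3 : ‖∑ k ∈ Finset.Icc 1 N,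
      ((ArithmeticFunction.moebius k : ℤ) : ℂ) * ((((N : ℝ) / k - (N / k : ℕ) : ℝ)) : ℂ)‖ ≤ N := by
    refine (norm_sum_le _ _).trans ?_
    refine (Finset.sum_le_card_nsmul _ _ 1 fun k hk => ?_).trans (by simp)
    have hk : (0 : ℝ) < k := by exact_mod_cast (Finset.mem_Icc.1 hk).1
    rw [norm_mul, Complex.norm_real, Real.norm_eq_abs]
    refine mul_le_one₀ (norm_moebius_le_one k) (abs_nonneg _) (abs_le.2 ⟨?_, ?_⟩)
    · have : ((N / k : ℕ) : ℝ) ≤ (N : ℝ) / k := Nat.cast_div_le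
      linarith
    · have : (N : ℝ) / k < (N / k : ℕ) + 1 := by
        rw [← Nat.floor_div_eq_div (K := ℝ)]
        exact Nat.lt_floor_add_one _
      linarith
  have h4 := norm_add_le (1 : ℂ) (∑ k ∈ Finset.Icc 1 N,
      ((ArithmeticFunction.moebius k : ℤ) : ℂ) * ((((N : ℝ) / k - (N / k : ℕ) : ℝ)) : ℂ))
  rw [← h2, norm_mul, Complex.norm_natCast, norm_one] at h4
  nlinarith [norm_nonneg (∑ k ∈ Finset.Icc 1 N, ((ArithmeticFunction.moebius k : ℤ) : ℂ) / k)]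

lemma sum_one_div_le_log {m : ℕ} (hm : 1 ≤ m) {M : ℕ} (hM : m ≤ M) :
    ∑ k ∈ Finset.Ioc m M, 1 / (k : ℝ) ≤ Real.log M - Real.log m := by
  induction M, hM using Nat.le_induction with
  | base => simp
  | succ M hM ih =>
    rw [← Finset.insert_Ioc_right_eq_Ioc_add_one hM, Finset.sum_insert (by simp)]
    have hM0 : (0 : ℝ) < M := by exact_mod_cast (by omega : 0 < M)
    have h1 := Real.log_le_sub_one_of_pos (show 0 < (M : ℝ) / (M + 1) by positivity)
    rw [Real.log_div hM0.ne' (by positivity)] at h1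
    have h2 : (M : ℝ) / (M + 1) - 1 = -(1 / (M + 1)) := by field_simp; ring
    push_cast
    linarith

/-- The increment is bounded by a harmonic sum; the term 2 / a pays for passing from log⌊a⌋ to log
a. -/
lemma norm_moebiusSum_sub_le {a b : ℝ} (ha : 1 ≤ a) (hab : a ≤ b) :
    ‖moebiusSum a - moebiusSum b‖ ≤ Real.log b - Real.log a + 2 / a := by
  set m := ⌊a⌋₊ with hm
  set M := ⌊b⌋₊ with hM
  have hm1 : 1 ≤ m := Nat.le_floor (by simpa using ha)
  have hmM : m ≤ M := Nat.floor_le_floor hab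
  have hm1' : (1 : ℝ) ≤ m := by exact_mod_cast hm1
  have hM1' : (1 : ℝ) ≤ M := by exact_mod_cast hm1.trans hmM
  have hMb : (M : ℝ) ≤ b := Nat.floor_le (by linarith)
  have ham : a < m + 1 := Nat.lt_floor_add_one a
  have h1 : moebiusSum b = moebiusSum a +
      ∑ k ∈ Finset.Ioc m M, ((ArithmeticFunction.moebius k : ℤ) : ℂ) / k := by
    rw [moebiusSum, moebiusSum, ← Finset.sum_union]
    · congr 1
      ext k
      simp only [Finset.mem_union, Finset.mem_Icc, Finset.mem_Ioc]
      omega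
    · rw [Finset.disjoint_left]
      intro k
      simp only [Finset.mem_Icc, Finset.mem_Ioc]
      omega
  rw [h1, sub_add_cancel_left, norm_neg]
  have h2 : ‖∑ k ∈ Finset.Ioc m M, ((ArithmeticFunction.moebius k : ℤ) : ℂ) / k‖ ≤
      ∑ k ∈ Finset.Ioc m M, 1 / (k : ℝ) := by
    refine norm_sum_le_of_le _ fun k _ => ?_
    rw [norm_div, Complex.norm_natCast]
    gcongr
    exact norm_moebius_le_one k
  have h3 := sum_one_div_le_log hm1 hmM
  have h4 : Real.log M ≤ Real.log b := Real.log_le_log (by linarith) hMb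
  have h5 := Real.log_le_sub_one_of_pos (show 0 < a / m by positivity)
  rw [Real.log_div (by linarith) (by linarith)] at h5
  have h6 : a / m - 1 ≤ 2 / a := by
    rw [div_sub_one (by linarith), div_le_div_iff₀ (by linarith) (by linarith)]
    nlinarith
  linarith

/-- If |h| ≤ v / 2, both arguments are at least e^(v/2), which gives the error e^(-v/2). Otherwise
|h| > 1/2, and the trivial bound 4 is below 8 |h|. -/
lemma norm_moebiusSum_exp_sub_le {v : ℝ} (hv : 1 ≤ v) (h : ℝ) :
    ‖moebiusSum (Real.exp v) - moebiusSum (Real.exp (v + h))‖ ≤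
      8 * (|h| + Real.exp (-(v / 2))) := by
  have hexp := Real.exp_pos (-(v / 2))
  rcases le_or_gt |h| (v / 2) with hh | hh
  · have key : ∀ a b : ℝ, v / 2 ≤ a → a ≤ b →
        ‖moebiusSum (Real.exp a) - moebiusSum (Real.exp b)‖ ≤
          (b - a) + 2 * Real.exp (-(v / 2)) := by
      intro a b ha hab
      refine (norm_moebiusSum_sub_le (Real.one_le_exp (by linarith))
        (Real.exp_le_exp.2 hab)).trans ?_
      rw [Real.log_exp, Real.log_exp, div_eq_mul_inv, ← Real.exp_neg]
      gcongr
    have h1 := abs_le.1 hh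
    rcases le_total 0 h with h0 | h0
    · have := key v (v + h) (by linarith) (by linarith)
      rw [abs_of_nonneg h0]
      linarith
    · have := key (v + h) v (by linarith) (by linarith)
      rw [norm_sub_rev, abs_of_nonpos h0]
      linarith
  · refine (norm_sub_le _ _).trans ?_
    have h1 := norm_sum_moebius_div_le ⌊Real.exp v⌋₊
    have h2 := norm_sum_moebius_div_le ⌊Real.exp (v + h)⌋₊
    rw [moebiusSum, moebiusSum]
    linarith

/-- Abel summation of ∑ μ(n) / n · n^(-s). On the logarithmic scale it is the Laplace transform
needed by the Tauberian theorem. -/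
lemma mellin_moebiusSum {s : ℂ} (hs : 0 < s.re) :
    mellin (fun t => moebiusSum t⁻¹) s = zetaRecip (1 + s) / s := by
  have hs0 : s ≠ 0 := by rintro rfl; simp at hs
  have hs1 : 1 < (1 + s).re := by simpa using hs
  set f : ℕ → ℂ := fun n => ((ArithmeticFunction.moebius n : ℤ) : ℂ) / n with hf
  have hterm : ∀ n, LSeries.term f s n =
      LSeries.term (fun n => ((ArithmeticFunction.moebius n : ℤ) : ℂ)) (1 + s) n := by
    intro n
    rcases Nat.eq_zero_or_pos n with rfl | hn
    · simp
    · have hn0 : (n : ℂ) ≠ 0 := by exact_mod_cast hn.ne'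
      rw [LSeries.term_of_ne_zero hn.ne', LSeries.term_of_ne_zero hn.ne', Complex.cpow_add _ _ hn0,
        Complex.cpow_one, hf, div_div]
  have hL : LSeries f s = zetaRecip (1 + s) := by
    rw [LSeries, tsum_congr hterm, ← LSeries, zetaRecip_of_ne_one (by
      intro h; rw [h] at hs1; simp at hs1), ← ArithmeticFunction.LSeries_zeta_eq_riemannZeta hs1]
    exact eq_one_div_of_mul_eq_one_right (ArithmeticFunction.LSeries_zeta_mul_Lseries_moebius hs1)
  have hsumm : LSeriesSummable f s :=
    ((ArithmeticFunction.LSeriesSummable_moebius_iff).2 hs1).congr fun n => (hterm n).symm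
  have h1 := LSeries_eq_mul_integral f le_rfl hs hsumm (by
    simp only [Real.rpow_zero]
    exact Asymptotics.isBigO_of_le' (c := 2) _ fun n => by
      simpa using norm_sum_moebius_div_le n)
  rw [hL] at h1
  rw [mellin_comp_inv, mellin, h1, mul_div_cancel_left₀ _ hs0]
  have h2 : ∫ t in Set.Ioi (0 : ℝ), (t : ℂ) ^ (-s - 1) • moebiusSum t =
      ∫ t in Set.Ioi (1 : ℝ), (t : ℂ) ^ (-s - 1) • moebiusSum t := by
    rw [MeasureTheory.setIntegral_congr_set (MeasureTheory.Ioi_ae_eq_Ici (a := (1 : ℝ)))]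
    refine (MeasureTheory.setIntegral_eq_of_subset_of_forall_sdiff_eq_zero measurableSet_Ioi
      (fun t ht => ?_) fun t ht => ?_)
    · exact Set.mem_Ioi.2 (lt_of_lt_of_le one_pos (Set.mem_Ici.1 ht))
    · rw [moebiusSum_of_lt_one (not_le.1 ht.2), smul_zero]
  rw [h2]
  refine MeasureTheory.setIntegral_congr_fun measurableSet_Ioi fun t _ => ?_
  simp only [smul_eq_mul]
  rw [mul_comm, show -s - 1 = -(s + 1) by ring]
  rfl

/-- The prime number theorem in the form `∑ μ(n) / n = 0`. -/
theorem tendsto_sum_moebius_div :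
    Tendsto (fun N : ℕ => ∑ k ∈ Finset.Icc 1 N, ((ArithmeticFunction.moebius k : ℤ) : ℂ) / k)
      atTop (𝓝 0) := by
  -- The transform 1 / (z ζ(1 + z)) extends continuously to Re z ≥ 0: ζ has no zeros on Re s = 1,
  -- and the zero of 1/ζ at 1 cancels 1 / z, which `dslope` expresses.
  have hmain := tendsto_zero_of_laplace (s := fun u => moebiusSum (Real.exp u))
    (G := fun z => dslope zetaRecip 1 (1 + z))
    (measurable_moebiusSum.comp Real.measurable_exp) (fun u => norm_sum_moebius_div_le _)
    (fun u hu => moebiusSum_of_lt_one (Real.exp_lt_one_iff.2 hu)) ?_ ?_ (C := 8)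
    (fun v hv h => norm_moebiusSum_exp_sub_le hv h)
  · refine (hmain.comp (Real.tendsto_log_atTop.comp tendsto_natCast_atTop_atTop)).congr' ?_
    filter_upwards [eventually_ge_atTop 1] with N hN
    have hN' : (0 : ℝ) < N := by exact_mod_cast hN
    simp [moebiusSum, Real.exp_log hN']
  · intro z hz
    have hz' : 0 ≤ z.re := hz
    refine ContinuousAt.continuousWithinAt (ContinuousAt.comp (g := dslope zetaRecip 1) ?_
      (by fun_prop))
    by_cases h : (1 + z) = 1
    · rw [h]
      exact continuousAt_dslope_same.2 (differentiableAt_zetaRecip_of_one_le_re (by simp))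
    · exact (continuousAt_dslope_of_ne h).2
        (differentiableAt_zetaRecip_of_one_le_re (by simpa using hz')).continuousAt
  · intro ε hε ξ
    set z : ℂ := ε + 2 * Real.pi * ξ * Complex.I with hz
    have hre : z.re = ε := by simp [hz]
    have him : z.im / (2 * Real.pi) = ξ := by
      simp [hz]
    have hz0 : z ≠ 0 := by
      intro h
      rw [h] at hre
      simp at hre
      exact hε.ne hre
    have h1 := mellin_moebiusSum (s := z) (by rw [hre]; exact hε)
    rw [mellin_eq_fourier, hre, him] at h1
    have h2 : zetaRecip 1 = 0 := by simp [zetaRecip]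
    rw [dslope_of_ne _ (by simpa using hz0), slope, h2, vsub_eq_sub, sub_zero, smul_eq_mul,
      add_sub_cancel_left, ← div_eq_inv_mul, ← h1]
    simp [Real.exp_neg]

/-! ### The Dirichlet series of σ_r⁻¹ up to its boundary point -/

/-- The pointwise product of the Möbius function with `h`. -/
def moebiusTwist (h : ℕ → ℂ) : ArithmeticFunction ℂ :=
  ⟨fun n => ((ArithmeticFunction.moebius n : ℤ) : ℂ) * h n, by simp⟩

lemma moebiusTwist_apply (h : ℕ → ℂ) (n : ℕ) :
    moebiusTwist h n = ((ArithmeticFunction.moebius n : ℤ) : ℂ) * h n := rfl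

lemma moebiusTwist_mul_apply_mul {h : ℕ → ℂ} (hh : ∀ a b, h (a * b) = h a * h b) (f g : ℕ → ℂ)
    (n : ℕ) : (moebiusTwist f * moebiusTwist g) n * h n =
      (moebiusTwist (fun m => f m * h m) * moebiusTwist (fun m => g m * h m)) n := by
  rw [ArithmeticFunction.mul_apply, ArithmeticFunction.mul_apply, Finset.sum_mul]
  refine Finset.sum_congr rfl fun p hp => ?_
  rw [← (Nat.mem_divisorsAntidiagonal.1 hp).1, hh]
  simp only [moebiusTwist_apply]
  ring

lemma coe_pow_mul_moebiusTwist {r : ℕ} (hr : r ≠ 0) :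
    ((ArithmeticFunction.pow r : ArithmeticFunction ℕ) : ArithmeticFunction ℂ) *
      moebiusTwist (fun n => (n : ℂ) ^ r) = 1 := by
  ext n
  have h1 := congrArg (fun f : ArithmeticFunction ℂ => f n)
    (ArithmeticFunction.coe_zeta_mul_coe_moebius (R := ℂ))
  simp only [ArithmeticFunction.mul_apply] at h1 ⊢
  have h2 : ∀ p ∈ n.divisorsAntidiagonal,
      ((ArithmeticFunction.pow r : ArithmeticFunction ℕ) : ArithmeticFunction ℂ) p.1 *
        moebiusTwist (fun n => (n : ℂ) ^ r) p.2 =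
      (n : ℂ) ^ r * (((ArithmeticFunction.zeta : ArithmeticFunction ℕ) : ArithmeticFunction ℂ) p.1 *
        ((ArithmeticFunction.moebius : ArithmeticFunction ℤ) : ArithmeticFunction ℂ) p.2) := by
    intro p hp
    obtain ⟨h3, h4⟩ := Nat.mem_divisorsAntidiagonal.1 hp
    have h5 : p.1 ≠ 0 := by
      rintro h
      rw [h, zero_mul] at h3
      exact h4 h3.symm
    rw [← h3]
    simp [ArithmeticFunction.pow_apply, hr, moebiusTwist_apply,
      ArithmeticFunction.zeta_apply, h5]
    ring
  rw [Finset.sum_congr rfl h2, ← Finset.mul_sum, h1]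
  by_cases hn : n = 1
  · simp [hn]
  · simp [ArithmeticFunction.one_apply_ne hn]

/-- σ_r is the convolution of 1 and n^r, both completely multiplicative, and the inverse of such a
function is its product with μ. -/
lemma sigmaInv_eq {r : ℕ} (hr : r ≠ 0) :
    sigmaInv r = moebiusTwist (fun _ => 1) * moebiusTwist (fun n => (n : ℂ) ^ r) := by
  have h1 : ((σ r : ArithmeticFunction ℕ) : ArithmeticFunction ℂ) * sigmaInv r = 1 :=
    ArithmeticFunction.self_mul_dirichletInverse _ _
  rw [← ArithmeticFunction.zeta_mul_pow_eq_sigma, ArithmeticFunction.natCoe_mul] at h1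
  have h2 := coe_pow_mul_moebiusTwist hr
  have h3 : moebiusTwist (fun _ => 1) *
      ((ArithmeticFunction.zeta : ArithmeticFunction ℕ) : ArithmeticFunction ℂ) = 1 := by
    rw [← ArithmeticFunction.coe_moebius_mul_coe_zeta]
    congr 1
    ext n
    simp [moebiusTwist_apply]
  set ζ' := ((ArithmeticFunction.zeta : ArithmeticFunction ℕ) : ArithmeticFunction ℂ)
  set p := ((ArithmeticFunction.pow r : ArithmeticFunction ℕ) : ArithmeticFunction ℂ)
  set m := moebiusTwist (fun n => (n : ℂ) ^ r)
  set m₁ := moebiusTwist (fun _ => 1)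
  calc sigmaInv r = (m₁ * ζ') * (p * m) * sigmaInv r := by rw [h3, h2]; ring
    _ = m₁ * m * (ζ' * p * sigmaInv r) := by ring
    _ = _ := by rw [h1, mul_one]

lemma lseriesHasSum_moebius {u : ℂ} (hu : 1 < u.re) :
    LSeriesHasSum (fun n => ((ArithmeticFunction.moebius n : ℤ) : ℂ)) u (zetaRecip u) := by
  have h1 := (ArithmeticFunction.LSeriesSummable_moebius_iff.2 hu).LSeriesHasSum
  have h2 : LSeries (fun n => ((ArithmeticFunction.moebius n : ℤ) : ℂ)) u = zetaRecip u := by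
    rw [zetaRecip_of_ne_one (by rintro rfl; simp at hu),
      ← ArithmeticFunction.LSeries_zeta_eq_riemannZeta hu]
    exact eq_one_div_of_mul_eq_one_right (ArithmeticFunction.LSeries_zeta_mul_Lseries_moebius hu)
  rwa [h2] at h1

lemma hasSum_of_forall_eq {f g : ℕ → ℂ} {a : ℂ} (h : ∀ n, f n = g n) (hf : HasSum f a) :
    HasSum g a := by
  rwa [← funext h]

lemma lseriesHasSum_sigmaInv {r : ℕ} (hr : r ≠ 0) {u : ℂ} (hu : r + 1 < u.re) :
    LSeriesHasSum (sigmaInv r) u (zetaPair r u) := by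
  have hr0 : (0 : ℝ) ≤ r := Nat.cast_nonneg r
  rw [sigmaInv_eq hr, zetaPair]
  refine ArithmeticFunction.LSeriesHasSum_mul ?_ ?_
  · refine hasSum_of_forall_eq (fun n => ?_) (lseriesHasSum_moebius (u := u) (by linarith))
    simp [LSeries.term, moebiusTwist_apply]
  · refine hasSum_of_forall_eq (fun n => ?_)
      (lseriesHasSum_moebius (u := u - r) (by simp; linarith))
    rcases Nat.eq_zero_or_pos n with rfl | hn
    · simp
    · have hn0 : (n : ℂ) ≠ 0 := by exact_mod_cast hn.ne'
      rw [LSeries.term_of_ne_zero hn.ne', LSeries.term_of_ne_zero hn.ne',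
        Complex.cpow_sub _ _ hn0, Complex.cpow_natCast, moebiusTwist_apply]
      field_simp

/-- The partial sums of the Dirichlet series of `σ_r⁻¹`. -/
def sigmaInvSum (r N : ℕ) (u : ℂ) : ℂ := ∑ n ∈ Finset.Icc 1 N, sigmaInv r n / (n : ℂ) ^ u

lemma sigmaInvSum_eq_sum_range (r N : ℕ) (u : ℂ) :
    sigmaInvSum r N u = ∑ n ∈ Finset.range (N + 1), LSeries.term (sigmaInv r) u n := by
  rw [Finset.sum_range_succ', LSeries.term_zero, add_zero, sigmaInvSum,
    Finset.sum_bij' (fun n _ => n - 1) (fun n _ => n + 1)]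
  · intro n hn
    have := Finset.mem_Icc.1 hn
    exact Finset.mem_range.2 (by omega)
  · intro n hn
    have := Finset.mem_range.1 hn
    exact Finset.mem_Icc.2 ⟨by omega, by omega⟩
  · intro n hn
    have := Finset.mem_Icc.1 hn
    omega
  · intro n _
    omega
  · intro n hn
    have := Finset.mem_Icc.1 hn
    rw [show n - 1 + 1 = n by omega, LSeries.term_of_ne_zero (by omega)]

/-- At u = r + 1 the partial sum is ∑ μ(n) n^(-r-1) times the partial sum of ∑ μ(m)/m up to N/n. The
inner sums are bounded by 2 and tend to 0 by the prime number theorem, so dominated convergence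
applies. -/
lemma tendsto_sigmaInvSum_boundary {r : ℕ} (hr : r ≠ 0) :
    Tendsto (fun N => sigmaInvSum r N (r + 1)) atTop (𝓝 0) := by
  have h1 : ∀ N, sigmaInvSum r N (r + 1) = ∑' n : ℕ, (if n ∈ Finset.Ioc 0 N then
      moebiusTwist (fun m => 1 * ((m : ℂ) ^ (r + 1))⁻¹) n *
        ∑ m ∈ Finset.Icc 1 (N / n), ((ArithmeticFunction.moebius m : ℤ) : ℂ) / m else 0) := by
    intro N
    have h2 := ArithmeticFunction.sum_Ioc_mul_eq_sum_sum
      (moebiusTwist (fun m => 1 * ((m : ℂ) ^ (r + 1))⁻¹))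
      (moebiusTwist (fun m => (m : ℂ) ^ r * ((m : ℂ) ^ (r + 1))⁻¹)) N
    rw [tsum_eq_sum (s := Finset.Ioc 0 N) (fun n hn => if_neg hn), Finset.sum_ite_mem,
      Finset.inter_self]
    have h3 : ∀ M, Finset.Ioc 0 M = Finset.Icc 1 M := fun M => by ext; simp [Nat.succ_le_iff]
    have h4 : ∀ M, ∑ m ∈ Finset.Icc 1 M, ((ArithmeticFunction.moebius m : ℤ) : ℂ) / m =
        ∑ m ∈ Finset.Ioc 0 M, moebiusTwist (fun m => (m : ℂ) ^ r * ((m : ℂ) ^ (r + 1))⁻¹) m := by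
      intro M
      rw [h3]
      refine Finset.sum_congr rfl fun m hm => ?_
      have hm0 : (m : ℂ) ≠ 0 := by
        have := (Finset.mem_Icc.1 hm).1
        exact_mod_cast (by omega : m ≠ 0)
      rw [moebiusTwist_apply]
      field_simp
      ring
    simp_rw [h4]
    rw [← h2, sigmaInvSum, h3]
    refine Finset.sum_congr rfl fun n _ => ?_
    rw [← moebiusTwist_mul_apply_mul (fun a b => by push_cast; rw [mul_pow, mul_inv]),
      ← sigmaInv_eq hr, ← div_eq_mul_inv]
    norm_cast
  simp_rw [h1]
  have hsum : Summable fun n : ℕ => 1 / (n : ℝ) ^ (r + 1) * 2 :=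
    (Real.summable_one_div_nat_pow.2 (by omega)).mul_right 2
  suffices h : Tendsto _ _ (𝓝 (∑' _ : ℕ, (0 : ℂ))) by rwa [tsum_zero] at h
  refine tendsto_tsum_of_dominated_convergence hsum (fun n => ?_)
    (Eventually.of_forall fun N n => ?_)
  · rcases Nat.eq_zero_or_pos n with rfl | hn
    · simp
    have h2 := (tendsto_sum_moebius_div.comp (Nat.tendsto_div_const_atTop hn.ne')).const_mul
      (moebiusTwist (fun m => 1 * ((m : ℂ) ^ (r + 1))⁻¹) n)
    rw [mul_zero] at h2
    refine h2.congr' ?_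
    filter_upwards [eventually_ge_atTop n] with N hN
    rw [if_pos (Finset.mem_Ioc.2 ⟨hn, hN⟩)]
    rfl
  · split_ifs with h
    · rw [norm_mul]
      refine mul_le_mul ?_ (norm_sum_moebius_div_le _) (norm_nonneg _) (by positivity)
      rw [moebiusTwist_apply, norm_mul, one_mul, norm_inv, norm_pow, Complex.norm_natCast, one_div]
      exact mul_le_of_le_one_left (by positivity) (norm_moebius_le_one n)
    · rw [norm_zero]
      positivity

lemma tendsto_sigmaInvSum {r : ℕ} (hr : r ≠ 0) {u : ℝ} (hu : r + 1 ≤ u) :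
    Tendsto (fun N => sigmaInvSum r N u) atTop (𝓝 (zetaPair r u)) := by
  rcases hu.eq_or_lt with rfl | h
  · have h1 : zetaPair r ((r + 1 : ℝ) : ℂ) = 0 := by simp [zetaPair, zetaRecip]
    rw [h1]
    simpa using tendsto_sigmaInvSum_boundary hr
  · have h1 := (lseriesHasSum_sigmaInv hr (u := (u : ℂ)) (by simpa using h)).tendsto_sum_nat
    simp_rw [sigmaInvSum_eq_sum_range]
    exact h1.comp (tendsto_add_atTop_nat 1)

/-- For j = 0 the bound follows from convergence; for j ≥ 1 the terms are dominated by those of the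
absolutely convergent series at u + 1. -/
lemma exists_norm_sigmaInvSum_le {r : ℕ} (hr : r ≠ 0) {u : ℝ} (hu : r + 1 ≤ u) :
    ∃ M : ℝ, ∀ N j : ℕ, ‖sigmaInvSum r N (u + j)‖ ≤ M := by
  obtain ⟨M₀, hM₀⟩ := (tendsto_sigmaInvSum hr hu).norm.bddAbove_range
  have hs : Summable fun n => ‖LSeries.term (sigmaInv r) ((u + 1 : ℝ) : ℂ) n‖ :=
    (lseriesHasSum_sigmaInv hr (u := ((u + 1 : ℝ) : ℂ))
      (by rw [Complex.ofReal_re]; linarith)).summable.norm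
  refine ⟨max M₀ (∑' n, ‖LSeries.term (sigmaInv r) ((u + 1 : ℝ) : ℂ) n‖), fun N j => ?_⟩
  rcases Nat.eq_zero_or_pos j with rfl | hj
  · refine le_trans ?_ (le_max_left _ _)
    simpa using hM₀ ⟨N, rfl⟩
  · refine le_trans ?_ (le_max_right _ _)
    rw [sigmaInvSum_eq_sum_range]
    refine (norm_sum_le_of_le _ fun n _ => ?_).trans
      (hs.sum_le_tsum (Finset.range (N + 1)) fun n _ => norm_nonneg _)
    refine LSeries.norm_term_le_of_re_le_re (sigmaInv r) ?_ n
    have : (1 : ℝ) ≤ j := by exact_mod_cast hj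
    simpa using this

/-! ### Interchange of summations for the exponential and for ₁F₁ -/

/-- Summation of a power series in `1 / n` against the coefficients `σ_r⁻¹(n) / n ^ u`. -/
theorem tendsto_sum_sigmaInv_mul {r : ℕ} (hr : r ≠ 0) {u : ℝ} (hu : r + 1 ≤ u) {c : ℕ → ℂ}
    (hc : Summable fun j => ‖c j‖) :
    Summable (fun j : ℕ => c j * zetaPair r (u + j)) ∧
      Tendsto (fun N : ℕ => ∑ n ∈ Finset.Icc 1 N,
        sigmaInv r n / (n : ℂ) ^ (u : ℂ) * ∑' j : ℕ, c j / (n : ℂ) ^ j) atTop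
        (𝓝 (∑' j : ℕ, c j * zetaPair r (u + j))) := by
  obtain ⟨M, hM⟩ := exists_norm_sigmaInvSum_le hr hu
  have hlim : ∀ j : ℕ, Tendsto (fun N => sigmaInvSum r N (u + j)) atTop
      (𝓝 (zetaPair r (u + j))) := fun j => by
    have := tendsto_sigmaInvSum hr (u := u + j) (by linarith [(Nat.cast_nonneg j : (0 : ℝ) ≤ j)])
    push_cast at this
    exact this
  have hbd : ∀ N j : ℕ, ‖c j * sigmaInvSum r N (u + j)‖ ≤ ‖c j‖ * M := fun N j => by
    rw [norm_mul]
    gcongr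
    exact hM N j
  refine ⟨Summable.of_norm_bounded (hc.mul_right M) fun j => ?_, ?_⟩
  · exact le_of_tendsto' ((hlim j).const_mul (c j)).norm fun N => hbd N j
  · have h1 := tendsto_tsum_of_dominated_convergence (hc.mul_right M)
      (fun j => (hlim j).const_mul (c j)) (Eventually.of_forall hbd)
    refine h1.congr fun N => ?_
    simp_rw [sigmaInvSum, Finset.mul_sum]
    rw [Summable.tsum_finsetSum]
    · refine Finset.sum_congr rfl fun n hn => ?_
      have hn0 : (n : ℂ) ≠ 0 := by
        have := (Finset.mem_Icc.1 hn).1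
        exact_mod_cast (by omega : n ≠ 0)
      rw [← tsum_mul_left]
      refine tsum_congr fun j => ?_
      rw [Complex.cpow_add _ _ hn0, Complex.cpow_natCast]
      ring
    · intro n hn
      have hn1 : (1 : ℝ) ≤ n := by exact_mod_cast (Finset.mem_Icc.1 hn).1
      have hn0 : (n : ℂ) ≠ 0 := by
        have := (Finset.mem_Icc.1 hn).1
        exact_mod_cast (by omega : n ≠ 0)
      refine Summable.of_norm_bounded (hc.mul_right ‖sigmaInv r n / (n : ℂ) ^ (u : ℂ)‖) fun j => ?_
      rw [Complex.cpow_add _ _ hn0, Complex.cpow_natCast, ← div_div, norm_mul,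
        norm_div _ ((n : ℂ) ^ j), norm_pow, Complex.norm_natCast]
      gcongr
      exact div_le_self (norm_nonneg _) (one_le_pow₀ hn1)

lemma tendsto_sum_sigmaInv_mul_exp {r : ℕ} (hr : r ≠ 0) {k x : ℝ} (hk : r + 1 ≤ k) :
    Summable (rightTerm r k x) ∧
      Tendsto (fun N : ℕ => ∑ n ∈ Finset.Icc 1 N,
        sigmaInv r n / (n : ℂ) ^ (k : ℂ) * Complex.exp (-(x / n))) atTop
        (𝓝 (∑' j, rightTerm r k x j)) := by
  have hc : Summable fun j : ℕ => ‖(-x : ℂ) ^ j / (j.factorial : ℂ)‖ := by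
    refine (Real.summable_pow_div_factorial |x|).congr fun j => ?_
    simp
  obtain ⟨h1, h2⟩ := tendsto_sum_sigmaInv_mul hr hk hc
  refine ⟨h1, h2.congr fun N => ?_⟩
  refine Finset.sum_congr rfl fun n _ => ?_
  rw [Complex.exp_eq_exp_ℂ, NormedSpace.exp_eq_tsum_div]
  simp only
  congr 1
  refine tsum_congr fun j => ?_
  rw [← neg_div, div_pow]
  ring

/-- The coefficients of `₁F₁(k; r + 1; -4π² y / x)` as a power series in `y`. -/
def kummerCoeff (r : ℕ) (k x : ℝ) (j : ℕ) : ℂ :=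
  (ascPochhammer ℂ j).eval (k : ℂ) / (ascPochhammer ℂ j).eval ((r : ℂ) + 1) *
    ((-(4 * Real.pi ^ 2 / x)) ^ j / (j.factorial : ℂ))

lemma ascPochhammer_eval_eq {z : ℂ} (hz : 0 < z.re) (j : ℕ) :
    Complex.Gamma (z + j) = Complex.Gamma z * (ascPochhammer ℂ j).eval z := by
  rw [← Complex.Gamma_add_nat_div_Gamma_eq z fun m hm => ?_,
    mul_div_cancel₀ _ (Complex.Gamma_ne_zero_of_re_pos hz)]
  rw [hm] at hz
  simp at hz
  linarith [(Nat.cast_nonneg m : (0 : ℝ) ≤ m)]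

/-- Each quotient (k + i) / (r + 1 + i) is at most k because k ≥ 1; this crude bound already gives a
summable majorant. -/
lemma norm_kummerCoeff_le {r : ℕ} {k : ℝ} (hk : r + 1 ≤ k) (x : ℝ) (j : ℕ) :
    ‖kummerCoeff r k x j‖ ≤ (k * |4 * Real.pi ^ 2 / x|) ^ j / j.factorial := by
  have hr0 : (0 : ℝ) ≤ r := Nat.cast_nonneg r
  have hk0 : 0 ≤ k := by linarith
  have h1 : ‖(ascPochhammer ℂ j).eval (k : ℂ) / (ascPochhammer ℂ j).eval ((r : ℂ) + 1)‖ ≤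
      k ^ j := by
    induction j with
    | zero => simp
    | succ j ih =>
      rw [ascPochhammer_succ_eval, ascPochhammer_succ_eval, mul_div_mul_comm, norm_mul, pow_succ]
      refine mul_le_mul ih ?_ (norm_nonneg _) (by positivity)
      have hj : (0 : ℝ) ≤ j := Nat.cast_nonneg j
      have h2 : ((k : ℂ) + j) / ((r : ℂ) + 1 + j) = (((k + j) / (r + 1 + j) : ℝ) : ℂ) := by
        push_cast; ring
      rw [h2, Complex.norm_real, Real.norm_eq_abs, abs_of_nonneg (by positivity),
        div_le_iff₀ (by positivity)]
      nlinarith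
  have h2 : ‖(-(4 * Real.pi ^ 2 / x) : ℂ) ^ j / (j.factorial : ℂ)‖ =
      |4 * Real.pi ^ 2 / x| ^ j / j.factorial := by
    rw [norm_div, norm_pow, norm_neg, Complex.norm_natCast]
    congr 2
    rw [← Real.norm_eq_abs, ← Complex.norm_real]
    push_cast
    rfl
  rw [kummerCoeff, norm_mul, h2, mul_pow, mul_div_assoc (k ^ j)]
  exact mul_le_mul_of_nonneg_right h1 (by positivity)

lemma tendsto_sum_sigmaInv_mul_kummerF {r : ℕ} (hr : r ≠ 0) {k x : ℝ} (hk : r + 1 ≤ k) :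
    Summable (fun j : ℕ => kummerCoeff r k x j * zetaPair r (r + 1 + j)) ∧
      Tendsto (fun N : ℕ => ∑ n ∈ Finset.Icc 1 N, sigmaInv r n / (n : ℂ) ^ (r + 1) *
        kummerF k (r + 1) (-(4 * (Real.pi : ℂ) ^ 2 / (n * x)))) atTop
        (𝓝 (∑' j : ℕ, kummerCoeff r k x j * zetaPair r (r + 1 + j))) := by
  have hc : Summable fun j : ℕ => ‖kummerCoeff r k x j‖ :=
    Summable.of_norm_bounded (Real.summable_pow_div_factorial (k * |4 * Real.pi ^ 2 / x|))
      fun j => by simpa using norm_kummerCoeff_le hk x j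
  obtain ⟨h1, h2⟩ := tendsto_sum_sigmaInv_mul hr (u := r + 1) le_rfl hc
  push_cast at h1 h2
  refine ⟨h1, h2.congr fun N => ?_⟩
  refine Finset.sum_congr rfl fun n _ => ?_
  rw [kummerF]
  congr 1
  · congr 1
    norm_cast
  · refine tsum_congr fun j => ?_
    rw [kummerCoeff, mul_comm (n : ℂ), ← div_div _ (x : ℂ), ← neg_div, div_pow]
    ring

/-- Γ(k + j) and (r + j)! = Γ(r + 1 + j) are Γ(k) and Γ(r + 1) times Pochhammer symbols, which
splits off the factor in front of ₁F₁. -/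
lemma leftTerm_eq {r : ℕ} {k : ℝ} (hk : r + 1 ≤ k) (x : ℝ) (j : ℕ) :
    leftTerm r k x j = (-1) ^ ((r + 1) / 2) * (2 * (Real.pi : ℂ)) ^ (r + 1) / (x : ℂ) ^ (k : ℂ) *
      (Complex.Gamma k / Complex.Gamma (r + 1)) *
        (kummerCoeff r k x j * zetaPair r (r + 1 + j)) := by
  have hr0 : (0 : ℝ) ≤ r := Nat.cast_nonneg r
  have h1 := ascPochhammer_eval_eq (z := (k : ℂ)) (by simp; linarith) j
  have h2 := ascPochhammer_eval_eq (z := (r : ℂ) + 1) (by simp; linarith) j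
  have h3 : Complex.Gamma ((r : ℂ) + 1 + j) = ((r + j).factorial : ℂ) := by
    rw [← Complex.Gamma_nat_eq_factorial]
    congr 1
    push_cast
    ring
  rw [leftTerm, h1, ← h3, h2, kummerCoeff]
  simp only [div_eq_mul_inv, mul_inv]
  ring

/-! ### The identity -/

theorem mainTheorem5
    (hsimple : ∀ ρ ∈ zetaZeros, deriv riemannZeta ρ ≠ 0) :
    ∃ A₀ : ℝ, 0 < A₀ ∧
      ∀ r : ℕ, Odd r → ∀ k : ℝ, (r : ℝ) + 1 ≤ k → ∀ x : ℝ, 0 < x →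
        ∃ H Z : ℂ,
          Tendsto
            (fun N : ℕ => ∑ n ∈ Finset.Icc 1 N,
              sigmaInv r n / (n : ℂ) ^ (r + 1) *
                kummerF k (r + 1) (-(4 * (Real.pi : ℂ) ^ 2 / (n * x))))
            atTop (𝓝 H) ∧
          BracketedHasSum A₀
            (fun ρ : ℂ => (x : ℂ) ^ (ρ - k) / deriv riemannZeta ρ *
              (Complex.Gamma (k - ρ) / riemannZeta (ρ - r) +
                (x : ℂ) ^ r * Complex.Gamma (k - r - ρ) / riemannZeta (r + ρ)))
            Z ∧
          Tendsto
            (fun N : ℕ => ∑ n ∈ Finset.Icc 1 N,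
              sigmaInv r n / (n : ℂ) ^ (k : ℂ) * Complex.exp (-(x / n)))
            atTop
            (𝓝 ((-1) ^ ((r + 1) / 2) * (2 * (Real.pi : ℂ)) ^ (r + 1) / (x : ℂ) ^ (k : ℂ) *
                  (Complex.Gamma k / Complex.Gamma (r + 1)) * H +
                ∑ m ∈ Finset.Icc 1 (r / 2),
                  Complex.Gamma (k - r + 2 * m) *
                    (zetaRecip (r - 2 * m) * (1 / riemannZeta (2 * m + 1))) *
                    ((-1) ^ m * 2 * (2 * (Real.pi : ℂ)) ^ (2 * m) / ((2 * m).factorial : ℂ)) *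
                    (x : ℂ) ^ ((r : ℂ) - k - 2 * m) +
                Z)) := by
  obtain ⟨A, T, hgood⟩ := exists_goodHeights hsimple
  refine ⟨A, hgood.pos, fun r hr k hk x hx => ?_⟩
  have hr0 : r ≠ 0 := hr.pos.ne'
  obtain ⟨hRs, hR⟩ := tendsto_sum_sigmaInv_mul_exp hr0 (x := x) hk
  obtain ⟨hHs, hH⟩ := tendsto_sum_sigmaInv_mul_kummerF hr0 (x := x) hk
  refine ⟨_, _, hH, ⟨bracket_finite hgood.exists_uncovered,
    (summable_bracket_sum hsimple hgood hr.pos hk hx).hasSum⟩, ?_⟩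
  set Z := ∑' b : ZetaBracket A, ∑ᶠ ρ ∈ b.zeros, zeroSummand r k x ρ
  have hlim := tendsto_residue_sums hsimple hgood hr hk hx
  have hsucc := tendsto_add_atTop_nat 1
  have hL := ((hHs.hasSum.mul_left ((-1) ^ ((r + 1) / 2) * (2 * (Real.pi : ℂ)) ^ (r + 1) /
    (x : ℂ) ^ (k : ℂ) * (Complex.Gamma k / Complex.Gamma (r + 1)))).tendsto_sum_nat).comp hsucc
  simp_rw [← leftTerm_eq hk] at hL
  -- The residue sums have two limits: -Z from the contour, and the ₁F₁ part plus the finite sum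
  -- minus the exponential part from the interchange of summations.
  have h := tendsto_nhds_unique hlim
    ((hL.add_const (∑ m ∈ Finset.Icc 1 (r / 2), midTerm r k x m)).sub
      (hRs.hasSum.tendsto_sum_nat.comp hsucc))
  simp only [midTerm] at h
  convert hR using 2
  linear_combination (-1 : ℂ) * h

end
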